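/- For a graph $X$ write $v(X)$ and $e(X)$ for its numbers of vertices and edges; $\mathrm{ex}(n,X)$ is the maximum number of edges of an $n$-vertex graph containing no copy of $X$. Copies are labelled: a copy of $X$ in $G$ is an injective graph homomorphism $X\to G$. A bipartite graph $X$ is $(\alpha,C,\beta)$-Erdős–Simonovits good if, for every $n$, every $n$-vertex graph $G$ with $e(G)=pn^2\ge Cn^{1+\alpha}$ contains at least $\beta\,p^{e(X)}n^{v(X)}$ copies of $X$. **Theorem.** Let $H$ be a finite graph on $h$ vertices, let $F$ be a subgraph of $H$ on $\ell$ vertices which is a forest with $1\le e(F)<e(H)$, and let $s\ge 1$. Let $H^*$ be the graph obtained from $s$ disjoint copies of $H$ by identifying, for each vertex $v$ of $F$, the $s$ copies of $v$ (parallel edges being merged). There is a constant $K>0$, depending only on $H$, $F$ and $s$, such that the following holds. Let $0\le\alpha<1$ and $A,\eta>0$ be such that $H$ is $(\alpha,A,\eta)$-Erdős–Simonovits good, and put $$\alpha'=\max\left\{1-\frac{h-\ell}{e(H)-e(F)},\;1-\frac{1-\alpha}{\ell-1+(1-e(F))(1-\alpha)}\right\}.$$ Then there is a constant $C>0$ such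 that $$\mathrm{ex}(n,H^*)\le C\,n^{1+\alpha'}\quad\text{for all } n,$$ and moreover, if $F$ is an induced subgraph of $H$ (so that the copies of $H$ in $H^*$ share only the edges of $F$), then with the same $C$ the graph $H^*$ is $(\alpha',C,\beta)$-Erdős–Simonovits good for $$\beta=\frac{1}{4^{e(H)}}\left(\frac{\eta}{4\cdot 8^{e(H)}(6K)^{e(F)}}\right)^{s}.$$ -/

import Mathlib

/-- A bipartite graph `H` is `(α, C, β)`-Erdős–Simonovits good if every graph `G` on `n` vertices with
`p n² ≥ C n^(1+α)` edges contains at least `β p^(e(H)) n^(v(H))` copies of `H`. Copies are labelled: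
a copy of `H` in `G` is an injective graph homomorphism from `H` to `G`. -/
def IsErdosSimonovitsGood {V : Type*} (H : SimpleGraph V) (α C β : ℝ) : Prop :=
  H.IsBipartite ∧
    ∀ (n : ℕ) (G : SimpleGraph (Fin n)) (p : ℝ),
      (G.edgeSet.ncard : ℝ) = p * (n : ℝ) ^ 2 →
      C * (n : ℝ) ^ (1 + α) ≤ p * (n : ℝ) ^ 2 →
      β * p ^ H.edgeSet.ncard * (n : ℝ) ^ Nat.card V ≤ (Nat.card (H.Copy G) : ℝ)

open Classical in
/-- The inclusion of the `i`-th copy of the vertex set `V` into the vertex set obtained from `s` copies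
of `V` by identifying, for each `v ∈ S`, all the copies of `v`. -/
noncomputable def gluingMap {V : Type*} (S : Set V) (s : ℕ) (i : Fin s) (v : V) :
    S ⊕ (Fin s × ↥Sᶜ) :=
  if h : v ∈ S then Sum.inl ⟨v, h⟩ else Sum.inr (i, ⟨v, h⟩)

/-- The graph obtained by gluing `s` copies of `H` along the labelled subgraph `F`: the copies of each
vertex of `F` are identified, all other vertices of distinct copies stay distinct, and the
edges are the images of the edges of the `s` copies of `H`. -/
noncomputable def gluedGraph {V : Type*} (H : SimpleGraph V) (F : H.Subgraph) (s : ℕ) :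
    SimpleGraph (F.verts ⊕ (Fin s × ↥(F.verts)ᶜ)) :=
  ⨆ i : Fin s, H.map (gluingMap F.verts s i)

/-- The exponent `α' = max {1 - (h-ℓ)/(e(H)-e(F)), 1 - (1-α)/(ℓ-1+(1-e(F))(1-α))}`, where
`h` and `ℓ` are the numbers of vertices of `H` and of `F`. -/
noncomputable def gluedExponent {V : Type*} (H : SimpleGraph V) (F : H.Subgraph) (α : ℝ) : ℝ :=
  max
    (1 - ((Nat.card V : ℝ) - (F.verts.ncard : ℝ)) /
      ((H.edgeSet.ncard : ℝ) - (F.edgeSet.ncard : ℝ)))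
    (1 - (1 - α) /
      ((F.verts.ncard : ℝ) - 1 + (1 - (F.edgeSet.ncard : ℝ)) * (1 - α)))

/-! Everything follows from one supersaturation bound, `exists_le_card_copy_gluedGraph`: a graph on
`n` vertices with `p n² ≥ C n^(1+α')` edges contains at least `c η^s p^E n^(v(H*))` copies of `H*`,
with `c` independent of `α`, `A`, `η`, and with `E = e(H*)` when `F` is induced. Positivity of this
count bounds the extremal number, and `K = max 1 (1/c)` makes the required `β` at most `c η^s`.

Suppose first that `H*` contains a cycle. A copy of `H*` is a copy `φ` of `F` together with `s`
extensions to `H` that are disjoint outside `φ`. Let `T φ` be a set of at most `(s-1)(h-ℓ)` vertices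
off `φ` whose removal leaves the least weight `d(φ)` of extensions. Extensions can then be chosen
greedily, so `φ` has at least `d(φ)^s` weighted disjoint `s`-tuples, and convexity over `φ` leaves
only two quantities to bound: the total weight of copies `φ` from above and `∑ d(φ)` from below.

The first bound is leaf peeling in a forest (`IsSparse.sum_hom_mul_pow_le`), given a degree bound.
For the second (`sum_avoiding_copies_ge`), split the host into `2m` blocks and sample one vertex
from each. Delete one edge of every sampled copy `φ` of `F` for which `T φ` meets the sample. Few
edges disappear on average, so goodness of `H` on `2m` vertices yields many copies of `H`, and each
of them avoids the set `T φ` of its own copy of `F`. The sample must be dense enough for goodness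
and small enough to spoil few copies of `F`; `exists_scale` meets both demands exactly when the
density is at least about `n^(-δ)`, where `1-δ` is the second term of `α'`.

The degree bound comes from a pair of sides `A`, `B` maximizing `e(A,B)/(|A||B|)^(1/N)`
(`exists_biregular_subgraph`). The sides may be unbalanced, but maximality makes the density grow
enough as they shrink (`density_le_mul_rpow`, `density_pow_le`). This needs `δ ≤ 1-1/N`, which holds
because a good graph with a cycle on `h` vertices has `α ≥ 1/h`. The weighted count becomes a true
count because each side receives fewer than `e(H*)` non-isolated vertices of `H*`.

If `H*` is a forest, direct forest supersaturation suffices (`IsSparse.supersaturation`). -/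

section SparseGraphs
-- Forests described by edge counts of vertex sets, and resampling of one coordinate.
open Classical Finset

/-- The number of ordered adjacent pairs of vertices inside `S`. -/
noncomputable def adjPairs {U : Type*} (G : SimpleGraph U) (S : Finset U) : ℕ :=
  ∑ u ∈ S, ∑ v ∈ S, if G.Adj u v then 1 else 0

/-- A graph each of whose nonempty finite vertex sets spans fewer edges than it has vertices. -/
def IsSparse {U : Type*} (G : SimpleGraph U) : Prop :=
  ∀ S : Finset U, S.Nonempty → adjPairs G S + 2 ≤ 2 * S.card

lemma adjPairs_univ {U : Type*} [Fintype U] (G : SimpleGraph U) :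
    adjPairs G univ = 2 * G.edgeSet.ncard := by
  have h := G.sum_degrees_eq_twice_card_edges
  rw [← SimpleGraph.coe_edgeFinset, Set.ncard_coe_finset, ← h]
  unfold adjPairs
  refine sum_congr rfl fun u _ => ?_
  rw [← SimpleGraph.card_neighborFinset_eq_degree, SimpleGraph.neighborFinset_eq_filter,
    card_filter]

lemma adjPairs_eq_induce {U : Type*} (G : SimpleGraph U) (S : Finset U) :
    adjPairs G S = adjPairs (G.induce (S : Set U)) univ := by
  unfold adjPairs
  simp only [SimpleGraph.comap_adj, Function.Embedding.subtype_apply]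
  rw [← sum_coe_sort S]
  refine sum_congr rfl fun u _ => ?_
  rw [← sum_coe_sort S]
  rfl

/-- The induced forest on `S` extends to a spanning tree of the complete graph on `S`, which has
`|S| - 1` edges. -/
lemma SimpleGraph.IsAcyclic.isSparse {U : Type*} {G : SimpleGraph U} (h : G.IsAcyclic) :
    IsSparse G := by
  intro S hS
  rw [adjPairs_eq_induce]
  have : Nonempty (S : Set U) := hS.to_subtype
  obtain ⟨T, hT, -, htree⟩ := (SimpleGraph.connected_top
    (V := (S : Set U))).exists_isTree_le_of_le_of_isAcyclic le_top (h.induce (S : Set U))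
  have h1 : adjPairs (G.induce (S : Set U)) univ ≤ adjPairs T univ := by
    unfold adjPairs
    gcongr with u _ v _
    split_ifs with h1 h2
    · exact le_rfl
    · exact absurd (hT h1) h2
    · exact Nat.zero_le _
    · exact le_rfl
  have h2 := htree.card_edgeFinset
  rw [adjPairs_univ T, ← SimpleGraph.coe_edgeFinset, Set.ncard_coe_finset] at h1
  have h3 : Fintype.card (S : Set U) = S.card := by simp
  omega

lemma adjPairs_eq_sum_degree {U : Type*} (G : SimpleGraph U) (S : Finset U) :
    adjPairs G S = ∑ u ∈ S, (S.filter (G.Adj u)).card := by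
  unfold adjPairs
  exact sum_congr rfl fun u _ => (card_filter _ _).symm

lemma adjPairs_erase {U : Type*} (G : SimpleGraph U) {S : Finset U} {v : U} (hv : v ∈ S) :
    adjPairs G S = adjPairs G (S.erase v) + 2 * (S.filter (G.Adj v)).card := by
  have h1 : (S.filter (G.Adj v)).card = ∑ u ∈ S.erase v, if G.Adj v u then 1 else 0 := by
    rw [card_filter, ← add_sum_erase _ _ hv]; simp
  have h2 : adjPairs G S = (S.filter (G.Adj v)).card
      + ∑ u ∈ S.erase v, ∑ x ∈ S, if G.Adj u x then 1 else 0 := by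
    unfold adjPairs
    rw [← add_sum_erase _ _ hv, card_filter]
  have h3 : ∑ u ∈ S.erase v, ∑ x ∈ S, (if G.Adj u x then 1 else 0) =
      (S.filter (G.Adj v)).card + adjPairs G (S.erase v) := by
    rw [h1]; unfold adjPairs
    rw [← sum_add_distrib]
    refine sum_congr rfl fun u _ => ?_
    rw [← add_sum_erase _ _ hv]
    simp [G.adj_comm]
  omega

/-- The average degree inside `S` is below two. This supplies the leaf for every induction on
forests below. -/
lemma IsSparse.exists_card_le_one {U : Type*} {G : SimpleGraph U} (h : IsSparse G)
    {S : Finset U} (hS : S.Nonempty) : ∃ v ∈ S, (S.filter (G.Adj v)).card ≤ 1 := by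
  by_contra! hc
  have h1 := h S hS
  have h2 : ∑ u ∈ S, 2 ≤ ∑ u ∈ S, (S.filter (G.Adj u)).card :=
    sum_le_sum fun u hu => hc u hu
  rw [← adjPairs_eq_sum_degree, sum_const, smul_eq_mul] at h2
  omega

lemma adjPairs_le_map {U X : Type*} {G : SimpleGraph U} {G' : SimpleGraph X} (f : U ↪ X)
    (hf : ∀ u v, G.Adj u v → G'.Adj (f u) (f v)) (S : Finset U) :
    adjPairs G S ≤ adjPairs G' (S.map f) := by
  unfold adjPairs
  rw [sum_map]
  refine sum_le_sum fun u _ => ?_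
  rw [sum_map]
  refine sum_le_sum fun v _ => ?_
  split_ifs with h1 h2
  · exact le_rfl
  · exact absurd (hf _ _ h1) h2
  · exact Nat.zero_le _
  · exact le_rfl

lemma ncard_edgeSet_coe {V : Type*} {H : SimpleGraph V} (F : H.Subgraph) :
    F.coe.edgeSet.ncard = F.edgeSet.ncard := by
  rw [← SimpleGraph.Subgraph.image_coe_edgeSet_coe,
    Set.ncard_image_of_injective _ (Sym2.map.injective Subtype.val_injective)]

/-- Averaging the resampling of one coordinate. -/
lemma sum_update_eq {U X : Type*} [Fintype U] [Fintype X] (w : X → ℝ) (g : (U → X) → ℝ) (v : U) :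
    ∑ φ : U → X, (∏ u, w (φ u)) * ∑ x, w x * g (Function.update φ v x) =
      (∑ x, w x) * ∑ φ : U → X, (∏ u, w (φ u)) * g φ := by
  let eqv := Equiv.funSplitAt v X
  have hval : ∀ (x : X) (ψ : {j // j ≠ v} → X), eqv.symm (x, ψ) v = x := by
    intro x ψ; simp [eqv]
  have hval' : ∀ (x : X) (ψ : {j // j ≠ v} → X) (j : {j // j ≠ v}),
      eqv.symm (x, ψ) j = ψ j := by
    intro x ψ j; simp [eqv, j.2]
  have hupd : ∀ (x y : X) (ψ : {j // j ≠ v} → X),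
      Function.update (eqv.symm (x, ψ)) v y = eqv.symm (y, ψ) := by
    intro x y ψ
    funext j
    by_cases hj : j = v
    · subst hj; simp [hval]
    · rw [Function.update_of_ne hj, hval' x ψ ⟨j, hj⟩, hval' y ψ ⟨j, hj⟩]
  have hprod : ∀ (x : X) (ψ : {j // j ≠ v} → X),
      ∏ u, w (eqv.symm (x, ψ) u) = w x * ∏ j, w (ψ j) := by
    intro x ψ
    rw [← mul_prod_erase univ _ (mem_univ v), hval]
    congr 1
    rw [prod_subtype (univ.erase v) (p := fun j => j ≠ v) (by simp)]
    exact prod_congr rfl fun j _ => by rw [hval']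
  rw [← eqv.symm.sum_comp, ← eqv.symm.sum_comp (fun φ => (∏ u, w (φ u)) * g φ),
    Fintype.sum_prod_type, Fintype.sum_prod_type]
  simp only [hupd, hprod]
  rw [sum_mul]
  refine sum_congr rfl fun x _ => ?_
  simp_rw [mul_sum]
  rw [sum_comm]
  refine sum_congr rfl fun y _ => sum_congr rfl fun ψ _ => ?_
  ring

end SparseGraphs

/-! ### Upper bound for weighted homomorphisms of forests; maps that are copies on a subset. -/

section PartialCopies
open Classical Finset

/-- Peel off a vertex with at most one neighbour in `S`: each edge removed replaces a factor `∑ w`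
by `D`. All maps on `U` are summed throughout and only the set of constraints shrinks, so the domain
stays fixed during the induction. -/
lemma IsSparse.sum_hom_mul_pow_le {U X : Type*} [Fintype U] [Fintype X] {F : SimpleGraph U}
    (hF : IsSparse F) (G : SimpleGraph X) (w : X → ℝ) (hw : ∀ x, 0 ≤ w x) (D : ℝ) (hD0 : 0 ≤ D)
    (hD : ∀ x, ∑ y, (if G.Adj x y then w y else 0) ≤ D) (S : Finset U) :
    ∀ k : ℕ, adjPairs F S = 2 * k →
      (∑ φ : U → X, (∏ u, w (φ u)) *
        (if ∀ u ∈ S, ∀ v ∈ S, F.Adj u v → G.Adj (φ u) (φ v) then 1 else 0)) *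
          (∑ x, w x) ^ k ≤ (∑ x, w x) ^ Fintype.card U * D ^ k := by
  have hM : 0 ≤ ∑ x, w x := sum_nonneg fun x _ => hw x
  have hW : ∀ φ : U → X, 0 ≤ ∏ u, w (φ u) := fun φ => prod_nonneg fun u _ => hw _
  induction S using Finset.strongInduction with
  | H S ih =>
  intro k hk
  rcases S.eq_empty_or_nonempty with rfl | hS
  · have : k = 0 := by simp [adjPairs] at hk; omega
    subst this
    simp [← Finset.prod_univ_sum, ← Fintype.piFinset_univ]
  obtain ⟨v, hv, hdeg⟩ := hF.exists_card_le_one hS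
  have her := adjPairs_erase F hv
  have hmono : ∀ φ : U → X,
      (if ∀ u ∈ S, ∀ v ∈ S, F.Adj u v → G.Adj (φ u) (φ v) then (1 : ℝ) else 0) ≤
      (if ∀ u ∈ S.erase v, ∀ z ∈ S.erase v, F.Adj u z → G.Adj (φ u) (φ z) then (1 : ℝ) else 0) := by
    intro φ
    split_ifs with h1 h2
    · exact le_rfl
    · exact absurd (fun u hu z hz => h1 u (mem_of_mem_erase hu) z (mem_of_mem_erase hz)) h2
    · exact zero_le_one
    · exact le_rfl
  rcases Nat.le_one_iff_eq_zero_or_eq_one.mp hdeg with h0 | h1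
  · refine le_trans ?_ (ih _ (erase_ssubset hv) k (by omega))
    gcongr with φ _
    · exact hW φ
    · exact hmono φ
  · obtain ⟨u, hu⟩ := card_eq_one.mp h1
    have hu' : u ∈ S ∧ F.Adj v u := by
      have : u ∈ S.filter (F.Adj v) := by rw [hu]; simp
      simpa using this
    obtain ⟨j, rfl⟩ : ∃ j, k = j + 1 := ⟨k - 1, by omega⟩
    have ih' := ih _ (erase_ssubset hv) j (by omega)
    have huv : u ≠ v := hu'.2.ne'
    have key := sum_update_eq w (fun φ : U → X =>
      if ∀ u ∈ S, ∀ v ∈ S, F.Adj u v → G.Adj (φ u) (φ v) then (1 : ℝ) else 0) v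
    have hle : (∑ φ : U → X, (∏ u, w (φ u)) *
        (if ∀ u ∈ S, ∀ v ∈ S, F.Adj u v → G.Adj (φ u) (φ v) then 1 else 0)) * (∑ x, w x) ≤
        D * (∑ φ : U → X, (∏ u, w (φ u)) *
          (if ∀ u ∈ S.erase v, ∀ z ∈ S.erase v, F.Adj u z → G.Adj (φ u) (φ z)
            then 1 else 0)) := by
      -- By `key`, multiplying by `∑ w` amounts to resampling the image of the leaf `v`. For the
      -- constraints on `S` to hold, the new image must be adjacent to `φ u`, and such vertices have
      -- total weight at most `D`.
      rw [mul_comm, ← key, mul_sum]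
      refine sum_le_sum fun φ _ => ?_
      rw [mul_left_comm]
      refine mul_le_mul_of_nonneg_left ?_ (hW φ)
      split_ifs with hφ
      · rw [mul_one]
        refine le_trans ?_ (hD (φ u))
        refine sum_le_sum fun x _ => ?_
        by_cases hx : G.Adj (φ u) x
        · rw [if_pos hx]
          split_ifs <;> simp [hw x]
        · rw [if_neg hx, if_neg, mul_zero]
          intro h
          have := h u hu'.1 v hv hu'.2.symm
          rw [Function.update_self, Function.update_of_ne huv] at this
          exact hx this
      · rw [mul_zero]
        refine le_of_eq (sum_eq_zero fun x _ => ?_)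
        rw [if_neg, mul_zero]
        intro h
        apply hφ
        intro a ha b hb hab
        have := h a (mem_of_mem_erase ha) b (mem_of_mem_erase hb) hab
        rwa [Function.update_of_ne (ne_of_mem_erase ha),
          Function.update_of_ne (ne_of_mem_erase hb)] at this
    calc _ = (∑ φ : U → X, (∏ u, w (φ u)) *
        (if ∀ u ∈ S, ∀ v ∈ S, F.Adj u v → G.Adj (φ u) (φ v) then 1 else 0)) * (∑ x, w x)
          * (∑ x, w x) ^ j := by ring
      _ ≤ D * (∑ φ : U → X, (∏ u, w (φ u)) *
          (if ∀ u ∈ S.erase v, ∀ z ∈ S.erase v, F.Adj u z → G.Adj (φ u) (φ z)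
            then 1 else 0)) * (∑ x, w x) ^ j := by gcongr
      _ = D * ((∑ φ : U → X, (∏ u, w (φ u)) *
          (if ∀ u ∈ S.erase v, ∀ z ∈ S.erase v, F.Adj u z → G.Adj (φ u) (φ z)
            then 1 else 0)) * (∑ x, w x) ^ j) := by ring
      _ ≤ D * ((∑ x, w x) ^ Fintype.card U * D ^ j) := by gcongr
      _ = _ := by ring

/-- `φ` restricts to a copy of the subgraph of `Y` induced on `S`. -/
def IsCopyOn {U X : Type*} (Y : SimpleGraph U) (G : SimpleGraph X) (S : Finset U) (φ : U → X) :
    Prop :=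
  Set.InjOn φ S ∧ ∀ u ∈ S, ∀ v ∈ S, Y.Adj u v → G.Adj (φ u) (φ v)

lemma IsCopyOn.mono {U X : Type*} {Y : SimpleGraph U} {G : SimpleGraph X} {S T : Finset U}
    {φ : U → X} (h : IsCopyOn Y G T φ) (hST : S ⊆ T) : IsCopyOn Y G S φ :=
  ⟨h.1.mono (by exact_mod_cast hST), fun u hu v hv => h.2 u (hST hu) v (hST hv)⟩

lemma IsCopyOn.update {U X : Type*} {Y : SimpleGraph U} {G : SimpleGraph X} {S : Finset U} {v : U}
    {φ : U → X} (h : IsCopyOn Y G (S.erase v) φ) {x : X} (hx : x ∉ (S.erase v).image φ)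
    (hadj : ∀ u ∈ S, Y.Adj v u → G.Adj x (φ u)) : IsCopyOn Y G S (Function.update φ v x) := by
  constructor
  · intro a ha b hb hab
    by_cases hav : a = v <;> by_cases hbv : b = v
    · rw [hav, hbv]
    · subst hav
      rw [Function.update_self, Function.update_of_ne hbv] at hab
      exact absurd (mem_image.mpr ⟨b, mem_erase.mpr ⟨hbv, hb⟩, hab.symm⟩) hx
    · subst hbv
      rw [Function.update_self, Function.update_of_ne hav] at hab
      exact absurd (mem_image.mpr ⟨a, mem_erase.mpr ⟨hav, ha⟩, hab⟩) hx
    · rw [Function.update_of_ne hav, Function.update_of_ne hbv] at hab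
      exact h.1 (by simpa using ⟨ha, hav⟩) (by simpa using ⟨hb, hbv⟩) hab
  · intro a ha b hb hab
    by_cases hav : a = v <;> by_cases hbv : b = v
    · subst hav hbv; exact absurd hab (Y.irrefl)
    · subst hav
      rw [Function.update_self, Function.update_of_ne hbv]
      exact hadj b hb hab
    · subst hbv
      rw [Function.update_self, Function.update_of_ne hav]
      exact (hadj a ha hab.symm).symm
    · rw [Function.update_of_ne hav, Function.update_of_ne hbv]
      exact h.2 a (mem_erase.mpr ⟨hav, ha⟩) b (mem_erase.mpr ⟨hbv, hb⟩) hab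

/-- The number of maps `U → X` which restrict to a copy on `S`. -/
noncomputable def copyOnCount {U X : Type*} [Fintype U] [Fintype X] (Y : SimpleGraph U)
    (G : SimpleGraph X) (S : Finset U) : ℝ :=
  ∑ φ : U → X, if IsCopyOn Y G S φ then 1 else 0

lemma copyOnCount_nonneg {U X : Type*} [Fintype U] [Fintype X] (Y : SimpleGraph U)
    (G : SimpleGraph X) (S : Finset U) : 0 ≤ copyOnCount Y G S :=
  sum_nonneg fun φ _ => by split_ifs <;> simp

lemma copyOnCount_univ {U X : Type*} [Fintype U] [Fintype X] (Y : SimpleGraph U)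
    (G : SimpleGraph X) : copyOnCount Y G univ = Nat.card (Y.Copy G) := by
  unfold copyOnCount
  rw [sum_boole, Nat.cast_inj, ← Fintype.card_subtype, ← Nat.card_eq_fintype_card]
  refine Nat.card_congr ⟨fun φ => ⟨⟨φ.1, fun {a b} h => φ.2.2 a (mem_univ _) b (mem_univ _) h⟩,
    fun a b h => φ.2.1 (by simp) (by simp) h⟩,
    fun f => ⟨f, fun a _ b _ h => f.injective h, fun a _ b _ h => f.toHom.map_adj h⟩, ?_, ?_⟩
  · intro φ; rfl
  · intro f; rfl

lemma copyOnCount_mono {U X : Type*} [Fintype U] [Fintype X] (Y : SimpleGraph U)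
    {G G' : SimpleGraph X} (h : G ≤ G') (S : Finset U) :
    copyOnCount Y G S ≤ copyOnCount Y G' S := by
  refine sum_le_sum fun φ _ => ?_
  split_ifs with h1 h2
  · exact le_rfl
  · exact absurd ⟨h1.1, fun u hu v hv huv => h (h1.2 u hu v hv huv)⟩ h2
  · exact zero_le_one
  · exact le_rfl

lemma sum_update_one {U X : Type*} [Fintype U] [Fintype X] (g : (U → X) → ℝ) (v : U) :
    ∑ φ : U → X, ∑ x, g (Function.update φ v x) = Fintype.card X * ∑ φ : U → X, g φ := by
  have := sum_update_eq (fun _ : X => (1 : ℝ)) g v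
  simpa using this

lemma mul_copyOnCount_erase_le {U X : Type*} [Fintype U] [Fintype X] {Y : SimpleGraph U}
    {G : SimpleGraph X} {S : Finset U} {v : U} {d : ℝ}
    (h : ∀ φ, IsCopyOn Y G (S.erase v) φ → d ≤ ∑ x, if x ∉ (S.erase v).image φ ∧
      ∀ u ∈ S, Y.Adj v u → G.Adj x (φ u) then (1 : ℝ) else 0) :
    d * copyOnCount Y G (S.erase v) ≤ Fintype.card X * copyOnCount Y G S := by
  unfold copyOnCount
  rw [← sum_update_one _ v, mul_sum]
  refine sum_le_sum fun φ _ => ?_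
  split_ifs with hφ
  · rw [mul_one]
    refine (h φ hφ).trans (sum_le_sum fun x _ => ?_)
    split_ifs with h1 h2
    · exact le_rfl
    · exact absurd (hφ.update h1.1 h1.2) h2
    · exact zero_le_one
    · exact le_rfl
  · rw [mul_zero]
    exact sum_nonneg fun x _ => by split_ifs <;> simp

/-- The only restriction on an isolated vertex is injectivity, which excludes at most `|U| ≤ |X|/2`
images. -/
lemma copyOnCount_insert_isolated {U X : Type*} [Fintype U] [Fintype X] {Y : SimpleGraph U}
    {G : SimpleGraph X} {S : Finset U} {v : U} (h0 : ∀ u ∈ S, ¬ Y.Adj v u)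
    (hX : 2 * (Fintype.card U : ℝ) ≤ Fintype.card X) (hX0 : 0 < Fintype.card X) :
    1 / 2 * copyOnCount Y G (S.erase v) ≤ copyOnCount Y G S := by
  have key := mul_copyOnCount_erase_le (Y := Y) (G := G) (S := S) (v := v)
    (d := (Fintype.card X : ℝ) / 2) (by
      intro φ hφ
      have hc : ((S.erase v).image φ).card ≤ Fintype.card U :=
        card_image_le.trans (card_le_univ _)
      have hc' : (((S.erase v).image φ).card : ℝ) ≤ Fintype.card U := by exact_mod_cast hc
      have : ∑ x, (if x ∉ (S.erase v).image φ ∧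
          ∀ u ∈ S, Y.Adj v u → G.Adj x (φ u) then (1 : ℝ) else 0) =
          ((Fintype.card X : ℝ) - ((S.erase v).image φ).card) := by
        rw [← Nat.cast_sub (card_le_univ _), ← card_compl, sum_boole]
        congr 2
        ext x
        simp only [mem_filter, mem_univ, true_and, mem_compl]
        exact ⟨fun h => h.1, fun h => ⟨h, fun u hu hvu => absurd hvu (h0 u hu)⟩⟩
      rw [this]; linarith)
  have hX0' : (0 : ℝ) < Fintype.card X := by exact_mod_cast hX0
  have : (Fintype.card X : ℝ) * (1 / 2 * copyOnCount Y G (S.erase v)) ≤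
      Fintype.card X * copyOnCount Y G S := by linarith
  exact le_of_mul_le_mul_left this hX0'

lemma pow_mul_copyOnCount_le_of_isolated {U X : Type*} [Fintype U] [Fintype X] {Y : SimpleGraph U}
    {G : SimpleGraph X} (I S : Finset U) (h0 : ∀ v ∈ I, ∀ u, ¬ Y.Adj v u) (hIS : Disjoint I S)
    (hX : 2 * (Fintype.card U : ℝ) ≤ Fintype.card X) (hX0 : 0 < Fintype.card X) :
    (1 / 2 : ℝ) ^ I.card * copyOnCount Y G S ≤ copyOnCount Y G (I ∪ S) := by
  induction I using Finset.induction_on with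
  | empty => simp
  | insert v I hv ih =>
    have hvS : v ∉ S := fun h => (disjoint_left.mp hIS) (mem_insert_self _ _) h
    have ih' := ih (fun x hx => h0 x (mem_insert_of_mem hx))
      (hIS.mono_left (by simp))
    have := copyOnCount_insert_isolated (Y := Y) (G := G) (S := insert v (I ∪ S)) (v := v)
      (fun u _ => h0 v (mem_insert_self _ _) u) hX hX0
    rw [erase_insert (by simp [hv, hvS])] at this
    rw [insert_union, card_insert_of_notMem hv, pow_succ]
    linarith

end PartialCopies

/-! ### Lower bounds for the number of copies of a forest. -/

section ForestSupersaturation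
open Classical Finset

lemma sum_ite_notMem_ge {X : Type*} [Fintype X] (R : Finset X) (p : X → Prop) :
    (∑ x, if p x then (1 : ℝ) else 0) - R.card ≤ ∑ x, if x ∉ R ∧ p x then (1 : ℝ) else 0 := by
  have hR : (R.card : ℝ) = ∑ x, if x ∈ R then (1 : ℝ) else 0 := by simp
  rw [hR, ← sum_sub_distrib]
  refine sum_le_sum fun x _ => ?_
  by_cases h1 : x ∈ R <;> by_cases h2 : p x <;> simp [h1, h2]

/-- Embed leaf by leaf. The minimum degree hypothesis concerns non-isolated vertices of `G` only, so
a leaf can be attached freely only where its neighbour is already the end of an embedded edge; an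
isolated edge of the forest is embedded as a whole, using the total number of edges. Each vertex
costs at most a factor `1/2` for injectivity. -/
lemma IsSparse.le_copyOnCount {U X : Type*} [Fintype U] [Fintype X] {Y : SimpleGraph U}
    (hY : IsSparse Y) (G : SimpleGraph X) (δ : ℝ) (hδ : 4 * (Fintype.card U : ℝ) ≤ δ)
    (hX : 2 * (Fintype.card U : ℝ) ≤ Fintype.card X) (hX0 : 0 < Fintype.card X) (hδ0 : 0 ≤ δ)
    (hG : ∀ x y, G.Adj x y → δ ≤ ∑ z, if G.Adj z x then (1 : ℝ) else 0)
    (hE : δ * Fintype.card X ≤ ∑ x, ∑ y, if G.Adj x y then (1 : ℝ) else 0) (S : Finset U) :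
    ∀ k : ℕ, adjPairs Y S = 2 * k →
      (Fintype.card X : ℝ) ^ Fintype.card U * (1 / 2) ^ S.card *
        (δ / (2 * Fintype.card X)) ^ k ≤ copyOnCount Y G S := by
  have hX0' : (0 : ℝ) < Fintype.card X := by exact_mod_cast hX0
  set n : ℝ := (Fintype.card X : ℝ) with hn
  set q : ℝ := δ / (2 * n) with hq
  have hq0 : 0 ≤ q := by positivity
  induction S using Finset.strongInduction with
  | H S ih =>
  intro k hk
  rcases S.eq_empty_or_nonempty with rfl | hS
  · have : k = 0 := by simp [adjPairs] at hk; omega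
    subst this
    simp [copyOnCount, IsCopyOn, hn]
  obtain ⟨v, hv, hdeg⟩ := hY.exists_card_le_one hS
  have her := adjPairs_erase Y hv
  have hcard : ∀ T : Finset U, T ⊂ S → (1 / 2 : ℝ) ^ S.card ≤ 1 / 2 * (1 / 2) ^ T.card := by
    intro T hT
    rw [← pow_succ']
    exact pow_le_pow_of_le_one (by norm_num) (by norm_num) (card_lt_card hT)
  have hR : ∀ (T : Finset U) (φ : U → X), ((T.image φ).card : ℝ) ≤ Fintype.card U := by
    intro T φ
    exact_mod_cast card_image_le.trans (card_le_univ _)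
  rcases Nat.le_one_iff_eq_zero_or_eq_one.mp hdeg with h0 | h1
  · have ih' := ih _ (erase_ssubset hv) k (by omega)
    have h0' : ∀ u ∈ S, ¬ Y.Adj v u := by
      simpa [card_eq_zero, filter_eq_empty_iff] using h0
    refine le_trans ?_ (copyOnCount_insert_isolated h0' hX hX0)
    refine le_trans ?_ (mul_le_mul_of_nonneg_left ih' (by norm_num))
    calc _ ≤ n ^ Fintype.card U * (1 / 2 * (1 / 2) ^ (S.erase v).card) * q ^ k := by
          gcongr; exact hcard _ (erase_ssubset hv)
      _ = _ := by ring
  obtain ⟨u, hu⟩ := card_eq_one.mp h1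
  have hadj : ∀ z, z ∈ S ∧ Y.Adj v z ↔ z = u := by
    intro z
    have : z ∈ S.filter (Y.Adj v) ↔ z = u := by rw [hu]; simp
    simpa using this
  obtain ⟨huS, hvu⟩ := (hadj u).mpr rfl
  obtain ⟨j, rfl⟩ : ∃ j, k = j + 1 := ⟨k - 1, by omega⟩
  have huv : u ≠ v := hvu.ne'
  have huE : u ∈ S.erase v := mem_erase.mpr ⟨huv, huS⟩
  have fin : ∀ T : Finset U, T ⊂ S → adjPairs Y T = 2 * j →
      q * copyOnCount Y G T ≤ copyOnCount Y G S →
      n ^ Fintype.card U * (1 / 2) ^ S.card * q ^ (j + 1) ≤ copyOnCount Y G S := by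
    intro T hT hTj hle
    refine le_trans ?_ hle
    refine le_trans ?_ (mul_le_mul_of_nonneg_left (ih T hT j hTj) hq0)
    calc _ ≤ n ^ Fintype.card U * (1 / 2 * (1 / 2) ^ T.card) * q ^ (j + 1) := by
          gcongr; exact hcard _ hT
      _ ≤ n ^ Fintype.card U * (1 * (1 / 2) ^ T.card) * q ^ (j + 1) := by
          gcongr; norm_num
      _ = _ := by ring
  -- If `u` has another neighbour `z`, then `φ u` is not isolated and has at least `δ - |U| ≥ δ/2`
  -- usable neighbours. Otherwise `uv` is a component of the forest inside `S`, and both ends are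
  -- removed together.
  by_cases hz : ∃ z ∈ S.erase v, Y.Adj u z
  · obtain ⟨z, hzS, huz⟩ := hz
    refine fin (S.erase v) (erase_ssubset hv) (by omega) ?_
    have key := mul_copyOnCount_erase_le (Y := Y) (G := G) (S := S) (v := v) (d := δ / 2) (by
      intro φ hφ
      have h1 := hG (φ u) (φ z) (hφ.2 u huE z hzS huz)
      have h2 := sum_ite_notMem_ge ((S.erase v).image φ) (fun x => G.Adj x (φ u))
      have h3 := hR (S.erase v) φ
      refine le_trans ?_ (h2.trans (sum_le_sum fun x _ => ?_))
      · linarith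
      · split_ifs with h4 h5
        · exact le_rfl
        · refine absurd ⟨h4.1, fun a ha hva => ?_⟩ h5
          rw [(hadj a).mp ⟨ha, hva⟩]; exact h4.2
        · exact zero_le_one
        · exact le_rfl)
    have : n * (q * copyOnCount Y G (S.erase v)) ≤ n * copyOnCount Y G S := by
      have : n * (q * copyOnCount Y G (S.erase v)) = δ / 2 * copyOnCount Y G (S.erase v) := by
        rw [hq]; field_simp
      rw [this]; exact key
    exact le_of_mul_le_mul_left this hX0'
  · push Not at hz
    set T := (S.erase v).erase u with hT
    have her2 := adjPairs_erase Y huE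
    rw [← hT] at her2
    have hdeg0 : ((S.erase v).filter (Y.Adj u)).card = 0 := by
      rw [card_eq_zero, filter_eq_empty_iff]; exact hz
    refine fin T ((erase_ssubset huE).trans (erase_ssubset hv)) (by omega) ?_
    have key : n * n * q * copyOnCount Y G T ≤ n * (n * copyOnCount Y G S) := by
      have h1 : n * copyOnCount Y G S = _ :=
        (sum_update_one (fun φ => if IsCopyOn Y G S φ then (1 : ℝ) else 0) v).symm
      rw [h1, ← sum_update_one (fun φ => ∑ x, if IsCopyOn Y G S (Function.update φ v x)
        then (1 : ℝ) else 0) u]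
      unfold copyOnCount
      rw [mul_sum]
      refine sum_le_sum fun φ _ => ?_
      split_ifs with hφ
      -- Here `y` and `x` are the new images of `u` and `v`. The last term discards an image `y`
      -- already taken, at the cost of its whole degree, which is at most `n`. Summed over `y`, the
      -- two losses are at most `2|U|n ≤ δn/2`.
      · have h2 : ∀ y, (∑ x, if G.Adj y x then (1 : ℝ) else 0) - Fintype.card U -
            (if y ∈ T.image φ then n else 0) ≤
            ∑ x, if IsCopyOn Y G S (Function.update (Function.update φ u y) v x)
              then (1 : ℝ) else 0 := by
          intro y
          split_ifs with hy
          · have : (∑ x, if G.Adj y x then (1 : ℝ) else 0) ≤ n := by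
              rw [sum_boole, hn]
              exact_mod_cast card_le_univ _
            have h3 : (0 : ℝ) ≤ Fintype.card U := Nat.cast_nonneg _
            have h4 : (0 : ℝ) ≤ ∑ x, if IsCopyOn Y G S
                (Function.update (Function.update φ u y) v x) then (1 : ℝ) else 0 :=
              sum_nonneg fun x _ => by split_ifs <;> simp
            linarith
          · have h3 := sum_ite_notMem_ge (T.image φ) (fun x => G.Adj y x)
            have h4 := hR T φ
            have h5 : (∑ x, if x ∉ T.image φ ∧ G.Adj y x then (1 : ℝ) else 0) ≤
                ∑ x, if IsCopyOn Y G S (Function.update (Function.update φ u y) v x)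
                  then (1 : ℝ) else 0 := by
              refine sum_le_sum fun x _ => ?_
              split_ifs with h6 h7
              · exact le_rfl
              · refine absurd (IsCopyOn.update (IsCopyOn.update hφ hy ?_) ?_ ?_) h7
                · intro a ha hua
                  exact absurd hua (hz a ha)
                · intro hx
                  obtain ⟨a, ha, hax⟩ := mem_image.mp hx
                  by_cases hau : a = u
                  · subst hau
                    rw [Function.update_self] at hax
                    exact h6.2.ne hax
                  · rw [Function.update_of_ne hau] at hax
                    exact h6.1 (mem_image.mpr ⟨a, mem_erase.mpr ⟨hau, ha⟩, hax⟩)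
                · intro a ha hva
                  rw [(hadj a).mp ⟨ha, hva⟩, Function.update_self]
                  exact h6.2.symm
              · exact zero_le_one
              · exact le_rfl
            linarith
        have h3 := sum_le_sum fun y (_ : y ∈ (univ : Finset X)) => h2 y
        refine le_trans ?_ h3
        rw [sum_sub_distrib, sum_sub_distrib, sum_ite_mem, univ_inter, sum_const, sum_const,
          card_univ, nsmul_eq_mul, nsmul_eq_mul, ← hn]
        have h4 : ((T.image φ).card : ℝ) * n ≤ Fintype.card U * n := by
          gcongr; exact_mod_cast hR T φ
        have h5 : n * n * q = δ * n / 2 := by rw [hq]; field_simp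
        have h6 : 4 * (Fintype.card U : ℝ) * n ≤ δ * n := by gcongr
        rw [mul_one, h5]
        linarith
      · rw [mul_zero]
        exact sum_nonneg fun y _ => sum_nonneg fun x _ => by split_ifs <;> simp
    have h2 : n * n * (q * copyOnCount Y G T) ≤ n * n * copyOnCount Y G S := by linarith
    exact le_of_mul_le_mul_left h2 (by positivity)

/-- Keep the edges inside a set `S` maximizing `2e(S) - 2δ|S|`: deleting a vertex of degree below
`δ` would increase this quantity, and comparison with the full vertex set bounds the loss of edges.
-/
lemma exists_subgraph_degree_ge {X : Type*} [Fintype X] (G : SimpleGraph X) (δ : ℝ)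
    (hδ : 0 ≤ δ) : ∃ G' ≤ G, (∀ x y, G'.Adj x y → δ ≤ ∑ z, if G'.Adj z x then (1 : ℝ) else 0) ∧
      (∑ x, ∑ y, if G.Adj x y then (1 : ℝ) else 0) - 2 * δ * Fintype.card X ≤
        ∑ x, ∑ y, if G'.Adj x y then (1 : ℝ) else 0 := by
  obtain ⟨S, -, hS⟩ := exists_max_image (univ : Finset (Finset X))
    (fun S => (adjPairs G S : ℝ) - 2 * δ * S.card) ⟨∅, mem_univ _⟩
  obtain ⟨G', hadj⟩ : ∃ G' : SimpleGraph X, ∀ x y, G'.Adj x y ↔ x ∈ S ∧ y ∈ S ∧ G.Adj x y :=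
    ⟨{ Adj := fun x y => x ∈ S ∧ y ∈ S ∧ G.Adj x y
       symm := ⟨fun x y h => ⟨h.2.1, h.1, h.2.2.symm⟩⟩
       loopless := ⟨fun x h => G.irrefl h.2.2⟩ }, fun _ _ => Iff.rfl⟩
  refine ⟨G', fun x y h => ((hadj x y).mp h).2.2, ?_, ?_⟩
  · intro x y hxy
    have hx : x ∈ S := ((hadj x y).mp hxy).1
    have h1 := hS (S.erase x) (mem_univ _)
    have h2 := adjPairs_erase G hx
    have h3 : (∑ z, if G'.Adj z x then (1 : ℝ) else 0) = (S.filter (G.Adj x)).card := by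
      rw [sum_boole]
      congr 2
      ext z
      simp only [mem_filter, mem_univ, true_and, hadj]
      exact ⟨fun h => ⟨h.1, h.2.2.symm⟩, fun h => ⟨h.1, hx, h.2.symm⟩⟩
    rw [h3]
    have h4 : (S.card : ℝ) = (S.erase x).card + 1 := by
      exact_mod_cast (card_erase_add_one hx).symm
    have h5 : (adjPairs G S : ℝ) = adjPairs G (S.erase x) + 2 * (S.filter (G.Adj x)).card := by
      exact_mod_cast h2
    rw [h4, h5] at h1
    linarith
  · have h1 := hS univ (mem_univ _)
    have h2 : (adjPairs G univ : ℝ) = ∑ x, ∑ y, if G.Adj x y then (1 : ℝ) else 0 := by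
      simp [adjPairs]
    have h3 : (adjPairs G S : ℝ) = ∑ x, ∑ y, if G'.Adj x y then (1 : ℝ) else 0 := by
      unfold adjPairs
      push_cast
      rw [← sum_subset (subset_univ S)]
      · refine sum_congr rfl fun x hx => ?_
        rw [← sum_subset (subset_univ S)]
        · refine sum_congr rfl fun y hy => ?_
          simp [hadj, hx, hy]
        · intro y _ hy
          simp [hadj, hy]
      · intro x _ hx
        simp [hadj, hx]
    simp only [card_univ] at h1
    rw [h2, h3] at h1
    have : 0 ≤ 2 * δ * (S.card : ℝ) := by positivity
    linarith

lemma sum_adj_eq {X : Type*} [Fintype X] (G : SimpleGraph X) :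
    (∑ x, ∑ y, if G.Adj x y then (1 : ℝ) else 0) = 2 * G.edgeSet.ncard := by
  have := adjPairs_univ G
  unfold adjPairs at this
  exact_mod_cast this

lemma sum_adj_le {X : Type*} [Fintype X] (G : SimpleGraph X) :
    (∑ x, ∑ y, if G.Adj x y then (1 : ℝ) else 0) ≤ (Fintype.card X : ℝ) ^ 2 := by
  calc _ ≤ ∑ x : X, ∑ y : X, (1 : ℝ) := by
        gcongr; split_ifs <;> simp
    _ = _ := by simp [sq]

/-- Supersaturation for forests. -/
lemma IsSparse.supersaturation {U : Type*} [Fintype U] {Y : SimpleGraph U} (hY : IsSparse Y)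
    {n : ℕ} (hn : 0 < n) (G : SimpleGraph (Fin n)) (p : ℝ)
    (hp : (G.edgeSet.ncard : ℝ) = p * n ^ 2) (hpn : 8 * (Fintype.card U : ℝ) ≤ p * n) :
    (1 / 2 : ℝ) ^ Fintype.card U * (p / 4) ^ Y.edgeSet.ncard * n ^ Fintype.card U ≤
      Nat.card (Y.Copy G) := by
  have hn' : (0 : ℝ) < n := by exact_mod_cast hn
  have hp0 : 0 ≤ p := by
    by_contra! h
    have : p * (n : ℝ) ^ 2 < 0 := mul_neg_of_neg_of_pos h (by positivity)
    rw [← hp] at this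
    exact absurd this (not_lt.mpr (Nat.cast_nonneg _))
  have hle := sum_adj_le G
  rw [sum_adj_eq, hp, Fintype.card_fin] at hle
  have hp1 : p ≤ 1 := by
    have : p * (n : ℝ) ^ 2 ≤ 1 * (n : ℝ) ^ 2 := by nlinarith [mul_nonneg hp0 (sq_nonneg (n : ℝ))]
    exact le_of_mul_le_mul_right this (by positivity)
  have hδ0 : 0 ≤ p * n / 2 := by positivity
  -- With this minimum degree at least `pn²` of the `2pn²` ordered adjacent pairs survive, and
  -- `δ/(2n) = p/4`.
  obtain ⟨G', hG', hdeg, hsum⟩ := exists_subgraph_degree_ge G (p * n / 2) hδ0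
  rw [sum_adj_eq, hp, Fintype.card_fin] at hsum
  have key := hY.le_copyOnCount G' (p * n / 2) (by linarith) (by
      rw [Fintype.card_fin]
      nlinarith [mul_le_mul_of_nonneg_right hp1 hn'.le]) (by simpa using hn) hδ0 hdeg (by
      rw [Fintype.card_fin]
      nlinarith [mul_nonneg hp0 (sq_nonneg (n : ℝ))]) univ _ (adjPairs_univ Y)
  rw [Fintype.card_fin, card_univ] at key
  rw [← copyOnCount_univ]
  refine le_trans (le_of_eq ?_) (key.trans (copyOnCount_mono Y hG' univ))
  have : p * n / 2 / (2 * n) = p / 4 := by field_simp; norm_num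
  rw [this]; ring

end ForestSupersaturation

/-! ### Locally sparse graphs, and what goodness forces on `α` and `η`. -/

section LocallySparse
open Classical Finset

lemma adjPairs_eq_add_sdiff {U : Type*} (G : SimpleGraph U) {S T : Finset U} (hT : T ⊆ S)
    (h : ∀ x ∈ T, ∀ y ∈ S, G.Adj x y → y ∈ T) :
    adjPairs G S = adjPairs G T + adjPairs G (S \ T) := by
  have h1 : ∀ x ∈ T, ∑ y ∈ S, (if G.Adj x y then 1 else 0) = ∑ y ∈ T, if G.Adj x y then 1 else 0 := by
    intro x hx
    refine (sum_subset hT fun y hy hyT => ?_).symm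
    rw [if_neg fun hxy => hyT (h x hx y hy hxy)]
  have h2 : ∀ x ∈ S \ T, ∑ y ∈ S, (if G.Adj x y then 1 else 0) =
      ∑ y ∈ S \ T, if G.Adj x y then 1 else 0 := by
    intro x hx
    refine (sum_subset sdiff_subset fun y hy hyT => ?_).symm
    have hyT' : y ∈ T := by
      by_contra hn
      exact hyT (mem_sdiff.mpr ⟨hy, hn⟩)
    rw [if_neg]
    intro hxy
    exact (mem_sdiff.mp hx).2 (h y hyT' x (mem_sdiff.mp hx).1 hxy.symm)
  unfold adjPairs
  rw [← sum_sdiff hT, add_comm, sum_congr rfl h1, sum_congr rfl h2]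

/-- Closed balls around `u` in a finite graph. -/
noncomputable def closedBall {X : Type*} [Fintype X] (G : SimpleGraph X) (u : X) : ℕ → Finset X
  | 0 => {u}
  | k + 1 => closedBall G u k ∪ (closedBall G u k).biUnion fun x => univ.filter (G.Adj x)

lemma card_closedBall_le {X : Type*} [Fintype X] {G : SimpleGraph X} {d : ℕ}
    (hd : ∀ x, (univ.filter (G.Adj x)).card ≤ d) (u : X) (k : ℕ) :
    (closedBall G u k).card ≤ (d + 1) ^ k := by
  induction k with
  | zero => simp [closedBall]
  | succ k ih =>
    calc _ ≤ (closedBall G u k).card + (closedBall G u k).card * d :=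
          (card_union_le _ _).trans (Nat.add_le_add_left (card_biUnion_le_card_mul _ _ _
            fun x _ => hd x) _)
      _ = (closedBall G u k).card * (d + 1) := by ring
      _ ≤ _ := by rw [pow_succ]; gcongr

lemma closedBall_mono {X : Type*} [Fintype X] (G : SimpleGraph X) (u : X) :
    Monotone (closedBall G u) :=
  monotone_nat_of_le_succ fun _ => subset_union_left

/-- Take an edge-maximal graph of maximum degree at most `d` in which sets of size at most `h` are
sparse. Two vertices of degree below `d` that are far apart could be joined without creating a short
cycle, so all vertices of small degree lie in one ball, of size at most `(d+1)^h`. -/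
lemma exists_locally_sparse (X : Type*) [Fintype X] (h d : ℕ) (hh : 1 ≤ h) :
    ∃ G : SimpleGraph X,
      (∀ S : Finset X, S.Nonempty → S.card ≤ h → adjPairs G S + 2 ≤ 2 * S.card) ∧
      d * Fintype.card X ≤ 2 * G.edgeSet.ncard + d * (d + 1) ^ h := by
  let P : Set (SimpleGraph X) := {G | (∀ S : Finset X, S.Nonempty → S.card ≤ h →
    adjPairs G S + 2 ≤ 2 * S.card) ∧ ∀ x, (univ.filter (G.Adj x)).card ≤ d}
  have hP : P.Nonempty := by
    refine ⟨⊥, fun S hS _ => ?_, fun x => by simp⟩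
    have := hS.card_pos
    simp [adjPairs]; omega
  obtain ⟨G, ⟨hG, hdeg⟩, hmax⟩ := (Set.toFinite P).exists_maximal hP
  refine ⟨G, hG, ?_⟩
  set L := univ.filter fun x => (univ.filter (G.Adj x)).card < d with hL
  have hLcard : L.card ≤ (d + 1) ^ h := by
    by_contra! hLc
    obtain ⟨u, hu⟩ : L.Nonempty := card_pos.mp (by omega)
    obtain ⟨v, hvL, hv⟩ := exists_mem_notMem_of_card_lt_card
      ((card_closedBall_le hdeg u h).trans_lt hLc)
    have huB : ∀ k, u ∈ closedBall G u k := fun k =>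
      closedBall_mono G u (Nat.zero_le k) (by simp [closedBall])
    have huv : u ≠ v := fun e => hv (e ▸ huB h)
    have hnadj : ¬ G.Adj u v := fun e => hv (closedBall_mono G u hh (by
      simp [closedBall, e]))
    have hsup : ∀ x y, (G ⊔ SimpleGraph.edge u v).Adj x y ↔
        G.Adj x y ∨ (x = u ∧ y = v ∨ x = v ∧ y = u) := by
      intro x y
      rw [SimpleGraph.sup_adj, SimpleGraph.edge_adj]
      constructor
      · rintro (h | h)
        · exact Or.inl h
        · tauto
      · rintro (h | h)
        · exact Or.inl h
        · refine Or.inr ⟨by tauto, ?_⟩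
          rcases h with ⟨rfl, rfl⟩ | ⟨rfl, rfl⟩
          · exact huv
          · exact huv.symm
    have hmem : G ⊔ SimpleGraph.edge u v ∈ P := by
      constructor
      · intro S hS hSh
        by_cases huS : u ∈ S ∧ v ∈ S
        · have h1 : adjPairs (G ⊔ SimpleGraph.edge u v) S ≤ adjPairs G S + 2 := by
            have h2 : adjPairs (G ⊔ SimpleGraph.edge u v) S ≤ ∑ x ∈ S, ∑ y ∈ S,
                ((if G.Adj x y then 1 else 0) + ((if x = u then if y = v then 1 else 0 else 0) +
                  (if x = v then if y = u then 1 else 0 else 0))) := by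
              refine sum_le_sum fun x _ => sum_le_sum fun y _ => ?_
              by_cases hxy : (G ⊔ SimpleGraph.edge u v).Adj x y
              · rw [if_pos hxy]
                rcases (hsup x y).mp hxy with h | ⟨h1, h2⟩ | ⟨h1, h2⟩
                · rw [if_pos h]; omega
                · rw [if_pos h1, if_pos h2]; omega
                · rw [if_pos h1, if_pos h2]; omega
              · rw [if_neg hxy]; exact Nat.zero_le _
            refine h2.trans (le_of_eq ?_)
            simp only [sum_add_distrib]
            simp [adjPairs, huS.1, huS.2, sum_ite_irrel]
          -- The traces of the balls around `u` on `S` cannot grow `h` times, since `|S| ≤ h` and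
          -- the first trace is nonempty. Where they stop growing, the trace is closed under
          -- adjacency in `S`, contains `u` and misses `v`.
          obtain ⟨k, hk, hkeq⟩ : ∃ k < h, (S ∩ closedBall G u (k + 1)).card =
              (S ∩ closedBall G u k).card := by
            by_contra! hne
            have : ∀ k ≤ h, k + 1 ≤ (S ∩ closedBall G u k).card := by
              intro k
              induction k with
              | zero => intro _; exact card_pos.mpr ⟨u, mem_inter.mpr ⟨huS.1, huB 0⟩⟩
              | succ k ih =>
                intro hk
                have h3 := ih (by omega)
                have h4 := hne k (by omega)
                have h5 : (S ∩ closedBall G u k).card ≤ (S ∩ closedBall G u (k + 1)).card :=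
                  card_le_card (inter_subset_inter_left (closedBall_mono G u (Nat.le_succ k)))
                omega
            have h3 := this h le_rfl
            have h4 : (S ∩ closedBall G u h).card ≤ S.card := card_le_card inter_subset_left
            omega
          have hTeq : S ∩ closedBall G u k = S ∩ closedBall G u (k + 1) :=
            eq_of_subset_of_card_le
              (inter_subset_inter_left (closedBall_mono G u (Nat.le_succ k))) hkeq.le
          set T := S ∩ closedBall G u k with hT
          have hTS : T ⊆ S := inter_subset_left
          have hsplit := adjPairs_eq_add_sdiff G hTS (by
            intro x hx y hy hxy
            rw [hTeq]
            refine mem_inter.mpr ⟨hy, ?_⟩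
            refine mem_union_right _ (mem_biUnion.mpr ⟨x, (mem_inter.mp hx).2, ?_⟩)
            simpa using hxy)
          have hTn : T.Nonempty := ⟨u, mem_inter.mpr ⟨huS.1, huB k⟩⟩
          have hvT : v ∉ T := fun hvT => hv (closedBall_mono G u hk.le (mem_inter.mp hvT).2)
          have hDn : (S \ T).Nonempty := ⟨v, mem_sdiff.mpr ⟨huS.2, hvT⟩⟩
          have hc := card_sdiff_add_card_eq_card hTS
          -- Two nonempty sparse pieces without edges between them leave a margin of four ordered
          -- pairs; the new edge uses two.
          have h3 := hG T hTn (by omega)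
          have h4 := hG _ hDn (by omega)
          omega
        · have h1 : adjPairs (G ⊔ SimpleGraph.edge u v) S = adjPairs G S := by
            refine sum_congr rfl fun x hx => sum_congr rfl fun y hy => ?_
            have : (G ⊔ SimpleGraph.edge u v).Adj x y ↔ G.Adj x y := by
              rw [hsup]
              refine ⟨?_, Or.inl⟩
              rintro (h | ⟨rfl, rfl⟩ | ⟨rfl, rfl⟩)
              · exact h
              · exact absurd ⟨hx, hy⟩ huS
              · exact absurd ⟨hy, hx⟩ huS
            simp only [this]
          rw [h1]; exact hG S hS hSh
      · intro x
        have hu' : (univ.filter (G.Adj u)).card < d := by simpa [hL] using hu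
        have hv' : (univ.filter (G.Adj v)).card < d := by simpa [hL] using hvL
        by_cases hxu : x = u
        · subst hxu
          calc _ ≤ (insert v (univ.filter (G.Adj x))).card := card_le_card fun y hy => by
                have := (hsup x y).mp (by simpa using hy)
                simp only [mem_insert, mem_filter, mem_univ, true_and]
                tauto
            _ ≤ _ := (card_insert_le _ _).trans hu'
        · by_cases hxv : x = v
          · subst hxv
            calc _ ≤ (insert u (univ.filter (G.Adj x))).card := card_le_card fun y hy => by
                  have := (hsup x y).mp (by simpa using hy)
                  simp only [mem_insert, mem_filter, mem_univ, true_and]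
                  tauto
              _ ≤ _ := (card_insert_le _ _).trans hv'
          · refine le_trans (card_le_card fun y hy => ?_) (hdeg x)
            have := (hsup x y).mp (by simpa using hy)
            simp only [mem_filter, mem_univ, true_and]
            tauto
    exact hnadj (hmax hmem le_sup_left ((hsup u v).mpr (by tauto)))
  have hsum : d * (univ \ L).card ≤ adjPairs G univ := by
    rw [adjPairs_eq_sum_degree, mul_comm, ← smul_eq_mul, ← sum_const]
    calc _ ≤ ∑ x ∈ univ \ L, (univ.filter (G.Adj x)).card := by
          refine sum_le_sum fun x hx => ?_
          simpa [hL] using hx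
      _ ≤ _ := sum_le_sum_of_subset sdiff_subset
  rw [adjPairs_univ] at hsum
  have hc := card_sdiff_add_card_eq_card (subset_univ L)
  rw [card_univ] at hc
  rw [← hc]
  have := Nat.mul_le_mul_left d hLcard
  rw [mul_add]; omega

/-- Graphs with a cycle have Turán exponent bounded away from one. -/
lemma IsErdosSimonovitsGood.one_div_le {U : Type*} [Fintype U] {Y : SimpleGraph U}
    (hY : ¬ IsSparse Y) {α A η : ℝ} (hη : 0 < η)
    (hgood : IsErdosSimonovitsGood Y α A η) : 1 / (Fintype.card U : ℝ) ≤ α := by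
  unfold IsSparse at hY
  push Not at hY
  obtain ⟨S, hS, hadj⟩ := hY
  have hh : 1 ≤ Fintype.card U := by
    obtain ⟨u, -⟩ := hS
    exact Fintype.card_pos_iff.mpr ⟨u⟩
  set h := Fintype.card U with hdef
  by_contra! hlt
  have hh' : (0 : ℝ) < h := by exact_mod_cast hh
  have hγ : 0 < 1 - h * α := by
    have : h * α < h * (1 / h) := by gcongr
    rw [mul_one_div_cancel hh'.ne'] at this
    linarith
  -- If `α < 1/h`, then on `N = 2(d+1)^h` vertices the locally sparse graph has at least `dN/4`
  -- edges, which exceeds `A N^(1+α)` for large `d` because `N^α` is at most `2(d+1)^(hα)`. It has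
  -- no copy of `Y`, so goodness fails.
  obtain ⟨d, hd1, hdA⟩ : ∃ d : ℕ, 1 ≤ d ∧ 16 * |A| ≤ ((d : ℝ) + 1) ^ (1 - h * α) := by
    have ht : Filter.Tendsto (fun d : ℕ => ((d : ℝ) + 1) ^ (1 - h * α)) Filter.atTop
        Filter.atTop :=
      (tendsto_rpow_atTop hγ).comp
        (Filter.tendsto_atTop_add_const_right _ _ tendsto_natCast_atTop_atTop)
    obtain ⟨d, h1, h2⟩ := ((Filter.eventually_ge_atTop 1).and
      (ht.eventually_ge_atTop (16 * |A|))).exists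
    exact ⟨d, h1, h2⟩
  obtain ⟨N, hN⟩ : ∃ N, N = 2 * (d + 1) ^ h := ⟨_, rfl⟩
  obtain ⟨G, hG, hE⟩ := exists_locally_sparse (Fin N) h d hh
  have hcopy : IsEmpty (Y.Copy G) := by
    refine ⟨fun f => ?_⟩
    have h1 := adjPairs_le_map (G' := G) f.toEmbedding (fun u v huv => f.toHom.map_adj huv) S
    have h2 := hG (S.map f.toEmbedding) (hS.map) (by
      rw [card_map]; exact card_le_univ S)
    rw [card_map] at h2
    omega
  have hN0 : 0 < N := by rw [hN]; positivity
  have hN0' : (0 : ℝ) < N := by exact_mod_cast hN0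
  rw [Fintype.card_fin] at hE
  have hE' : (d : ℝ) * N / 4 ≤ G.edgeSet.ncard := by
    have h1 : (d : ℝ) * N ≤ 2 * G.edgeSet.ncard + d * ((d : ℝ) + 1) ^ h := by exact_mod_cast hE
    have h2 : (N : ℝ) = 2 * ((d : ℝ) + 1) ^ h := by rw [hN]; push_cast; ring
    have h3 : (d : ℝ) * ((d : ℝ) + 1) ^ h = d * N / 2 := by rw [h2]; ring
    linarith
  have hd1' : (1 : ℝ) ≤ d := by exact_mod_cast hd1
  have hbound := hgood.2 N G (G.edgeSet.ncard / (N : ℝ) ^ 2) (by field_simp) (by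
    have h1 : (N : ℝ) ^ α ≤ 2 * ((d : ℝ) + 1) ^ (h * α) := by
      rw [hN]
      push_cast
      rw [Real.mul_rpow (by norm_num) (by positivity), Real.rpow_mul (by positivity),
        Real.rpow_natCast]
      gcongr
      calc (2 : ℝ) ^ α ≤ 2 ^ (1 : ℝ) := by
            apply Real.rpow_le_rpow_of_exponent_le (by norm_num)
            have : 1 / (h : ℝ) ≤ 1 := by
              rw [div_le_one hh']; exact_mod_cast hh
            linarith
        _ = 2 := by norm_num
    have h2 : ((d : ℝ) + 1) ^ (h * α) * ((d : ℝ) + 1) ^ (1 - h * α) = d + 1 := by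
      rw [← Real.rpow_add (by positivity)]; simp
    have h3 : 8 * |A| * ((d : ℝ) + 1) ^ (h * α) ≤ d := by
      have h4 : 16 * |A| * ((d : ℝ) + 1) ^ (h * α) ≤ d + 1 := by
        have h5 : ((d : ℝ) + 1) ^ (h * α) * (16 * |A|) ≤
            ((d : ℝ) + 1) ^ (h * α) * ((d : ℝ) + 1) ^ (1 - h * α) := by gcongr
        linarith
      linarith
    rw [Real.rpow_add hN0', Real.rpow_one, div_mul_cancel₀ _ (by positivity)]
    refine le_trans ?_ hE'
    calc A * (N * (N : ℝ) ^ α) ≤ |A| * (N * (N : ℝ) ^ α) := by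
          gcongr; exact le_abs_self A
      _ ≤ |A| * (N * (2 * ((d : ℝ) + 1) ^ (h * α))) := by gcongr
      _ = 8 * |A| * ((d : ℝ) + 1) ^ (h * α) * N / 4 := by ring
      _ ≤ _ := by gcongr)
  rw [@Nat.card_of_isEmpty _ hcopy] at hbound
  have hpos : 0 < (G.edgeSet.ncard : ℝ) := lt_of_lt_of_le (by positivity) hE'
  have : 0 < η * ((G.edgeSet.ncard : ℝ) / (N : ℝ) ^ 2) ^ Y.edgeSet.ncard *
      (N : ℝ) ^ Nat.card U := by positivity
  push_cast at hbound
  linarith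

/-- Complete graphs bound the density in supersaturation. -/
lemma IsErdosSimonovitsGood.le_four_pow {U : Type*} [Finite U] {Y : SimpleGraph U}
    {α A η : ℝ} (hα1 : α < 1)
    (hgood : IsErdosSimonovitsGood Y α A η) : η ≤ 4 ^ Y.edgeSet.ncard := by
  have := Fintype.ofFinite U
  obtain ⟨n, hn2, hnA⟩ : ∃ n : ℕ, 2 ≤ n ∧ 4 * |A| ≤ (n : ℝ) ^ (1 - α) := by
    have ht : Filter.Tendsto (fun d : ℕ => (d : ℝ) ^ (1 - α)) Filter.atTop Filter.atTop :=
      (tendsto_rpow_atTop (by linarith)).comp tendsto_natCast_atTop_atTop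
    obtain ⟨d, h1, h2⟩ := ((Filter.eventually_ge_atTop 2).and
      (ht.eventually_ge_atTop (4 * |A|))).exists
    exact ⟨d, h1, h2⟩
  have hn0 : (0 : ℝ) < n := by exact_mod_cast (by omega : 0 < n)
  have hn2' : (2 : ℝ) ≤ n := by exact_mod_cast hn2
  obtain ⟨T, hT⟩ : ∃ T : SimpleGraph (Fin n), ∀ x y, T.Adj x y ↔ x ≠ y := ⟨⊤, fun _ _ => Iff.rfl⟩
  have hedge : (T.edgeSet.ncard : ℝ) = (n : ℝ) * (n - 1) / 2 := by
    have h1 := sum_adj_eq T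
    have h2 : (∑ x : Fin n, ∑ y : Fin n, if T.Adj x y
        then (1 : ℝ) else 0) = n * (n - 1) := by
      have h3 : ∀ x : Fin n, (∑ y : Fin n, if T.Adj x y
          then (1 : ℝ) else 0) = n - 1 := by
        intro x
        have : ∀ y : Fin n, (if T.Adj x y then (1 : ℝ) else 0) =
            1 - if x = y then 1 else 0 := by
          intro y
          by_cases h : x = y <;> simp [h, hT]
        simp only [this, sum_sub_distrib]
        simp
      simp only [h3]
      simp [mul_sub]
    rw [h2] at h1
    linarith
  have hq : (n : ℝ) / 4 ≤ ((n : ℝ) - 1) / 2 := by linarith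
  -- The complete graph has density `(n-1)/(2n) ≥ 1/4`, while the number of its copies of `Y` is at
  -- most `n^(v(Y))`.
  have key := hgood.2 n T (((n : ℝ) - 1) / (2 * n)) (by rw [hedge]; field_simp) (by
    have h1 : ((n : ℝ) - 1) / (2 * n) * (n : ℝ) ^ 2 = n * ((n - 1) / 2) := by field_simp
    rw [h1]
    have h2 : (n : ℝ) ^ (1 + α) * (n : ℝ) ^ (1 - α) = n * n := by
      rw [← Real.rpow_add hn0, show (1 + α + (1 - α)) = ((2 : ℕ) : ℝ) by push_cast; ring,
        Real.rpow_natCast, sq]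
    have h3 : A * (n : ℝ) ^ (1 + α) ≤ |A| * (n : ℝ) ^ (1 + α) := by
      gcongr; exact le_abs_self A
    have h4 : (n : ℝ) ^ (1 + α) * (4 * |A|) ≤ (n : ℝ) ^ (1 + α) * (n : ℝ) ^ (1 - α) := by
      gcongr
    nlinarith)
  have hcount : (Nat.card (Y.Copy T) : ℝ) ≤ (n : ℝ) ^ Nat.card U := by
    rw [← copyOnCount_univ]
    calc _ ≤ ∑ φ : U → Fin n, (1 : ℝ) := by
          unfold copyOnCount; gcongr; split_ifs <;> simp
      _ = _ := by simp
  have h5 : η * (((n : ℝ) - 1) / (2 * n)) ^ Y.edgeSet.ncard ≤ 1 := by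
    have h6 : (0 : ℝ) < (n : ℝ) ^ Nat.card U := by positivity
    have h7 := key.trans hcount
    have h8 : η * (((n : ℝ) - 1) / (2 * n)) ^ Y.edgeSet.ncard * (n : ℝ) ^ Nat.card U ≤
      1 * (n : ℝ) ^ Nat.card U := by rw [one_mul]; exact h7
    exact le_of_mul_le_mul_right h8 h6
  by_cases hη : η ≤ 0
  · exact hη.trans (by positivity)
  push Not at hη
  have h9 : (1 / 4 : ℝ) ≤ ((n : ℝ) - 1) / (2 * n) := by
    rw [div_le_div_iff₀ (by norm_num) (by positivity)]; linarith
  have h10 : η * (1 / 4 : ℝ) ^ Y.edgeSet.ncard ≤ 1 := le_trans (by gcongr) h5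
  rw [one_div, inv_pow, ← div_eq_mul_inv, div_le_one (by positivity)] at h10
  exact h10

end LocallySparse

/-! ### Adjacency, edge counts and acyclicity of the glued graph. -/

section GluedGraph
open Classical Finset

lemma gluedGraph_adj_inl_inl {V : Type*} {H : SimpleGraph V} {F : H.Subgraph} {s : ℕ} (hs : 1 ≤ s)
    (a b : F.verts) : (gluedGraph H F s).Adj (Sum.inl a) (Sum.inl b) ↔ H.Adj a b := by
  unfold gluedGraph
  rw [SimpleGraph.iSup_adj]
  constructor
  · rintro ⟨i, -, u, v, huv, hu, hv⟩
    unfold gluingMap at hu hv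
    split_ifs at hu hv
    cases hu; cases hv; exact huv
  · intro h
    refine ⟨⟨0, hs⟩, fun e => h.ne (congrArg Subtype.val (Sum.inl_injective e)), a, b, h, ?_, ?_⟩ <;>
      simp [gluingMap]

lemma gluedGraph_adj_inl_inr {V : Type*} {H : SimpleGraph V} {F : H.Subgraph} {s : ℕ}
    (a : F.verts) (p : Fin s × ↥(F.verts)ᶜ) :
    (gluedGraph H F s).Adj (Sum.inl a) (Sum.inr p) ↔ H.Adj a p.2 := by
  obtain ⟨i, x⟩ := p
  unfold gluedGraph
  rw [SimpleGraph.iSup_adj]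
  constructor
  · rintro ⟨j, -, u, v, huv, hu, hv⟩
    unfold gluingMap at hu hv
    split_ifs at hu hv
    cases hu; cases hv; exact huv
  · intro h
    refine ⟨i, Sum.inl_ne_inr, a, x, h, ?_, ?_⟩
    · simp [gluingMap]
    · have hx : (x : V) ∉ F.verts := x.2
      simp [gluingMap, hx]

lemma gluedGraph_adj_inr_inr {V : Type*} {H : SimpleGraph V} {F : H.Subgraph} {s : ℕ}
    (p q : Fin s × ↥(F.verts)ᶜ) :
    (gluedGraph H F s).Adj (Sum.inr p) (Sum.inr q) ↔ p.1 = q.1 ∧ H.Adj p.2 q.2 := by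
  obtain ⟨i, x⟩ := p
  obtain ⟨j, y⟩ := q
  unfold gluedGraph
  rw [SimpleGraph.iSup_adj]
  constructor
  · rintro ⟨k, -, u, v, huv, hu, hv⟩
    unfold gluingMap at hu hv
    split_ifs at hu hv
    cases hu; cases hv; exact ⟨rfl, huv⟩
  · rintro ⟨h0, h⟩
    dsimp at h0 h
    subst h0
    have hx : (x : V) ∉ F.verts := x.2
    have hy : (y : V) ∉ F.verts := y.2
    refine ⟨i, fun e => h.ne ?_, x, y, h, ?_, ?_⟩
    · have := Sum.inr_injective e
      exact congrArg (fun p : Fin s × ↥(F.verts)ᶜ => (p.2 : V)) this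
    · simp [gluingMap, hx]
    · simp [gluingMap, hy]

lemma gluedGraph_isBipartite {V : Type*} {H : SimpleGraph V} (F : H.Subgraph) {s : ℕ} (hs : 1 ≤ s)
    (h : H.IsBipartite) : (gluedGraph H F s).IsBipartite := by
  obtain ⟨c⟩ := h
  refine ⟨SimpleGraph.Coloring.mk (Sum.elim (fun a => c a) fun p => c p.2) ?_⟩
  rintro (a | p) (b | q) hab
  · exact c.valid ((gluedGraph_adj_inl_inl hs a b).mp hab)
  · exact c.valid ((gluedGraph_adj_inl_inr a q).mp hab)
  · exact c.valid ((gluedGraph_adj_inl_inr b p).mp hab.symm).symm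
  · exact c.valid ((gluedGraph_adj_inr_inr p q).mp hab).2

/-- The number of adjacent pairs in `A × B`. -/
noncomputable def crossPairs {U : Type*} (G : SimpleGraph U) (A B : Finset U) : ℕ :=
  ∑ u ∈ A, ∑ v ∈ B, if G.Adj u v then 1 else 0

lemma adjPairs_union {U : Type*} (G : SimpleGraph U) {A B : Finset U} (h : Disjoint A B) :
    adjPairs G (A ∪ B) = adjPairs G A + adjPairs G B + 2 * crossPairs G A B := by
  have hc : ∑ u ∈ B, ∑ v ∈ A, (if G.Adj u v then 1 else 0) = crossPairs G A B := by
    rw [sum_comm]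
    exact sum_congr rfl fun u _ => sum_congr rfl fun v _ => by rw [G.adj_comm]
  unfold adjPairs
  rw [sum_union h]
  simp only [sum_union h, sum_add_distrib]
  rw [hc]
  unfold crossPairs
  ring

lemma crossPairs_mono_left {U : Type*} (G : SimpleGraph U) {A A' : Finset U} (B : Finset U)
    (h : A ⊆ A') : crossPairs G A B ≤ crossPairs G A' B :=
  sum_le_sum_of_subset h

section Fibres
variable {V : Type*} [Fintype V] {S : Set V} {s : ℕ}

/-- The shared part of a vertex set of a glued graph. -/
noncomputable def gluedCore (T : Finset (S ⊕ (Fin s × ↥Sᶜ))) : Finset V :=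
  (univ.filter fun x : S => Sum.inl x ∈ T).map (Function.Embedding.subtype _)

/-- The part of a vertex set of a glued graph in the `i`-th copy. -/
noncomputable def gluedPart (T : Finset (S ⊕ (Fin s × ↥Sᶜ))) (i : Fin s) : Finset V :=
  (univ.filter fun x : ↥Sᶜ => Sum.inr (i, x) ∈ T).map (Function.Embedding.subtype _)

lemma card_eq_gluedCore_add (T : Finset (S ⊕ (Fin s × ↥Sᶜ))) :
    T.card = (gluedCore T).card + ∑ i, (gluedPart T i).card := by
  unfold gluedCore gluedPart
  simp only [card_map]
  conv_lhs => rw [← filter_univ_mem T, card_filter]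
  rw [Fintype.sum_sum_type, Fintype.sum_prod_type]
  simp only [card_filter]

lemma disjoint_gluedPart {A : Finset V} (hA : ∀ a ∈ A, a ∈ S) (T : Finset (S ⊕ (Fin s × ↥Sᶜ)))
    (i : Fin s) : Disjoint A (gluedPart T i) := by
  rw [disjoint_left]
  intro a ha hb
  obtain ⟨x, -, rfl⟩ := mem_map.mp hb
  exact x.2 (hA _ ha)

end Fibres

lemma adjPairs_gluedGraph {V : Type*} [Fintype V] {H : SimpleGraph V} (F : H.Subgraph) {s : ℕ}
    (hs : 1 ≤ s) (T : Finset (F.verts ⊕ (Fin s × ↥(F.verts)ᶜ))) :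
    adjPairs (gluedGraph H F s) T = adjPairs H (gluedCore T) +
      ∑ i, (adjPairs H (gluedPart T i) + 2 * crossPairs H (gluedCore T) (gluedPart T i)) := by
  have hT : ∀ f : F.verts ⊕ (Fin s × ↥(F.verts)ᶜ) → ℕ, ∑ u ∈ T, f u =
      (∑ a ∈ univ.filter (fun x : F.verts => Sum.inl x ∈ T), f (Sum.inl a)) +
      ∑ i, ∑ x ∈ univ.filter (fun x : ↥(F.verts)ᶜ => Sum.inr (i, x) ∈ T), f (Sum.inr (i, x)) := by
    intro f
    conv_lhs => rw [← filter_univ_mem T, sum_filter]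
    rw [Fintype.sum_sum_type, Fintype.sum_prod_type]
    simp only [sum_filter]
  have hadj : ∀ (p q : Fin s × ↥(F.verts)ᶜ),
      (if (gluedGraph H F s).Adj (Sum.inr p) (Sum.inr q) then 1 else 0) =
      if p.1 = q.1 then if H.Adj p.2 q.2 then 1 else 0 else 0 := by
    intro p q
    rw [if_congr (gluedGraph_adj_inr_inr p q) rfl rfl, ite_and]
  have h1 : ∀ a b : F.verts, (if (gluedGraph H F s).Adj (Sum.inl a) (Sum.inl b) then 1 else 0) =
      if H.Adj a b then 1 else 0 := fun a b => if_congr (gluedGraph_adj_inl_inl hs a b) rfl rfl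
  have h2 : ∀ (a : F.verts) (p : Fin s × ↥(F.verts)ᶜ),
      (if (gluedGraph H F s).Adj (Sum.inl a) (Sum.inr p) then 1 else 0) =
      if H.Adj a p.2 then 1 else 0 := fun a p => if_congr (gluedGraph_adj_inl_inr a p) rfl rfl
  have h3 : ∀ (a : F.verts) (p : Fin s × ↥(F.verts)ᶜ),
      (if (gluedGraph H F s).Adj (Sum.inr p) (Sum.inl a) then 1 else 0) =
      if H.Adj a p.2 then 1 else 0 := by
    intro a p
    rw [← h2, (gluedGraph H F s).adj_comm]
  have hcross : ∀ i, ∑ x ∈ univ.filter (fun x : ↥(F.verts)ᶜ => Sum.inr (i, x) ∈ T),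
      ∑ a ∈ univ.filter (fun x : F.verts => Sum.inl x ∈ T), (if H.Adj a x then 1 else 0) =
      crossPairs H (gluedCore T) (gluedPart T i) := by
    intro i
    rw [sum_comm]
    simp only [crossPairs, gluedCore, gluedPart, sum_map, Function.Embedding.subtype_apply]
    congr!
  have hcross' : ∑ a ∈ univ.filter (fun x : F.verts => Sum.inl x ∈ T), ∑ i,
      ∑ x ∈ univ.filter (fun x : ↥(F.verts)ᶜ => Sum.inr (i, x) ∈ T), (if H.Adj a x then 1 else 0) =
      ∑ i, crossPairs H (gluedCore T) (gluedPart T i) := by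
    rw [sum_comm]
    exact sum_congr rfl fun i _ => by rw [← hcross i, sum_comm]
  have hpart : ∀ i, ∑ x ∈ univ.filter (fun x : ↥(F.verts)ᶜ => Sum.inr (i, x) ∈ T), ∑ j,
      ∑ y ∈ univ.filter (fun y : ↥(F.verts)ᶜ => Sum.inr (j, y) ∈ T),
        (if i = j then if H.Adj x y then 1 else 0 else 0) = adjPairs H (gluedPart T i) := by
    intro i
    simp only [adjPairs, gluedPart, sum_map, Function.Embedding.subtype_apply, sum_ite_irrel,
      sum_const_zero, sum_ite_eq, mem_univ, if_true]
    congr!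
  have hcore : ∑ a ∈ univ.filter (fun x : F.verts => Sum.inl x ∈ T),
      ∑ b ∈ univ.filter (fun x : F.verts => Sum.inl x ∈ T), (if H.Adj a b then 1 else 0) =
      adjPairs H (gluedCore T) := by
    simp only [adjPairs, gluedCore, sum_map, Function.Embedding.subtype_apply]
    congr!
  conv_lhs => unfold adjPairs
  simp only [hT, hadj, h1, h2, h3, sum_add_distrib, hcross, hcross', hpart, hcore]
  rw [← mul_sum]
  ring

lemma adjPairs_toFinset_verts_ge {V : Type*} [Fintype V] {H : SimpleGraph V} (F : H.Subgraph) :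
    2 * F.edgeSet.ncard ≤ adjPairs H F.verts.toFinset := by
  rw [← ncard_edgeSet_coe, ← adjPairs_univ]
  refine (adjPairs_le_map (G' := H) (Function.Embedding.subtype _)
    (fun u v huv => F.coe_adj_sub u v huv) univ).trans (le_of_eq ?_)
  congr!

lemma adjPairs_toFinset_verts_eq {V : Type*} [Fintype V] {H : SimpleGraph V} {F : H.Subgraph}
    (hF : F.IsInduced) : adjPairs H F.verts.toFinset = 2 * F.edgeSet.ncard := by
  rw [← ncard_edgeSet_coe, ← adjPairs_univ]
  have : F.verts.toFinset = (univ : Finset F.verts).map (Function.Embedding.subtype _) := by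
    ext x; simp
  rw [this]
  unfold adjPairs
  rw [sum_map]
  refine sum_congr rfl fun u _ => ?_
  rw [sum_map]
  refine sum_congr rfl fun v _ => ?_
  refine if_congr ?_ rfl rfl
  simp only [Function.Embedding.subtype_apply, SimpleGraph.Subgraph.coe_adj]
  exact ⟨fun h => hF u.2 v.2 h, fun h => F.adj_sub h⟩

/-- All edges of `H` inside `F.verts` are merged, not only those of `F`; hence the correction term
counts pairs adjacent in `H`. Subtraction is avoided by adding the overcount on the left. -/
lemma ncard_edgeSet_gluedGraph {V : Type*} [Fintype V] {H : SimpleGraph V} (F : H.Subgraph) {s : ℕ}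
    (hs : 1 ≤ s) : 2 * (gluedGraph H F s).edgeSet.ncard + s * adjPairs H F.verts.toFinset =
      adjPairs H F.verts.toFinset + 2 * (s * H.edgeSet.ncard) := by
  have h1 := adjPairs_gluedGraph F hs univ
  have hc : gluedCore (univ : Finset (F.verts ⊕ (Fin s × ↥(F.verts)ᶜ))) = F.verts.toFinset := by
    ext x; simp [gluedCore]
  have hp : ∀ i, gluedPart (univ : Finset (F.verts ⊕ (Fin s × ↥(F.verts)ᶜ))) i =
      (F.verts.toFinset)ᶜ := by
    intro i; ext x; simp [gluedPart]
  have h2 := adjPairs_union H (disjoint_compl_right (a := F.verts.toFinset))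
  rw [union_compl, adjPairs_univ] at h2
  rw [adjPairs_univ] at h1
  simp only [hc, hp, sum_const, card_univ, Fintype.card_fin, smul_eq_mul] at h1
  rw [h1, mul_left_comm, h2]
  ring

/-- Gluing copies of a forest along a subtree yields a forest. -/
lemma IsSparse.gluedGraph {V : Type*} [Fintype V] {H : SimpleGraph V} (hH : IsSparse H)
    (F : H.Subgraph) (hF : F.edgeSet.ncard + 1 = F.verts.ncard) {s : ℕ} (hs : 1 ≤ s) :
    IsSparse (gluedGraph H F s) := by
  intro T hT
  rw [adjPairs_gluedGraph F hs, card_eq_gluedCore_add T]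
  have hcoreS : gluedCore T ⊆ F.verts.toFinset := by
    intro x hx
    obtain ⟨y, -, rfl⟩ := mem_map.mp hx
    simp
  -- Since `F` has one edge fewer than vertices, `F.verts` attains the sparsity bound. Sparsity of
  -- `F.verts` together with the `i`-th part then allows that part to contribute no more edges than
  -- vertices.
  have hF2 : adjPairs H F.verts.toFinset + 2 ≥ 2 * F.verts.toFinset.card := by
    have := adjPairs_toFinset_verts_ge F
    rw [← Set.ncard_eq_toFinset_card']
    omega
  have hne : F.verts.toFinset.Nonempty := by
    rw [← card_pos, ← Set.ncard_eq_toFinset_card']; omega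
  have hpart : ∀ i, adjPairs H (gluedPart T i) + 2 * crossPairs H (gluedCore T) (gluedPart T i) ≤
      2 * (gluedPart T i).card := by
    intro i
    have hd : Disjoint F.verts.toFinset (gluedPart T i) :=
      disjoint_gluedPart (fun a ha => by simpa using ha) T i
    have h1 := hH (F.verts.toFinset ∪ gluedPart T i) (hne.mono subset_union_left)
    rw [adjPairs_union H hd, card_union_of_disjoint hd] at h1
    have h2 := crossPairs_mono_left H (gluedPart T i) hcoreS
    omega
  -- The parts alone give no strict inequality. The missing edge is supplied by sparsity of the core
  -- if it is nonempty, and otherwise by sparsity of one nonempty part.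
  rcases (gluedCore T).eq_empty_or_nonempty with h0 | h0
  · rw [h0]
    have hcard := card_eq_gluedCore_add T
    rw [h0, card_empty, zero_add] at hcard
    obtain ⟨i, -, hi⟩ : ∃ i ∈ (univ : Finset (Fin s)), (gluedPart T i).card ≠ 0 := by
      apply exists_ne_zero_of_sum_ne_zero
      have := hT.card_pos
      omega
    have h1 := hH (gluedPart T i) (card_pos.mp (by omega))
    have h2 : ∑ j ∈ univ.erase i, (adjPairs H (gluedPart T j) +
        2 * crossPairs H ∅ (gluedPart T j)) ≤ ∑ j ∈ univ.erase i, 2 * (gluedPart T j).card := by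
      refine sum_le_sum fun j _ => ?_
      have := hpart j
      rwa [h0] at this
    rw [← mul_sum] at h2
    rw [← add_sum_erase univ _ (mem_univ i), ← add_sum_erase univ (fun j => (gluedPart T j).card)
      (mem_univ i)]
    simp only [crossPairs, adjPairs, sum_empty, card_empty] at h1 h2 ⊢
    omega
  · have h1 := hH _ h0
    have h2 := sum_le_sum fun i (_ : i ∈ (univ : Finset (Fin s))) => hpart i
    rw [← mul_sum] at h2
    omega

end GluedGraph

/-! ### Uniformly random sections of a block partition, and their first moments. -/

section Sections
open Classical Finset

/-- The `i`-th block of the partition of `Y` induced by `b`. -/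
noncomputable def block {X : Type*} {M : ℕ} (Y : Finset X) (b : X → Fin M) (i : Fin M) : Finset X :=
  Y.filter fun x => b x = i

/-- The probability that a uniformly random section of the block partition contains `x`. -/
noncomputable def blockWeight {X : Type*} {M : ℕ} (Y : Finset X) (b : X → Fin M) (x : X) : ℝ :=
  if x ∈ Y then 1 / ((block Y b (b x)).card : ℝ) else 0

/-- The sections of a block partition. -/
noncomputable def blockSections {X : Type*} {M : ℕ} (Y : Finset X) (b : X → Fin M) :
    Finset (Fin M → X) :=
  Fintype.piFinset (block Y b)

/-- The sections containing `T`. -/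
noncomputable def sectionsThrough {X : Type*} {M : ℕ} (Y : Finset X) (b : X → Fin M)
    (T : Finset X) : Finset (Fin M → X) :=
  (blockSections Y b).filter fun σ => ∀ v ∈ T, σ (b v) = v

lemma mem_sectionsThrough {X : Type*} {M : ℕ} {Y : Finset X} {b : X → Fin M} {T : Finset X}
    {σ : Fin M → X} :
    σ ∈ sectionsThrough Y b T ↔ σ ∈ blockSections Y b ∧ ∀ v ∈ T, σ (b v) = v :=
  mem_filter

lemma mem_blockSections {X : Type*} {M : ℕ} {Y : Finset X} {b : X → Fin M} {σ : Fin M → X} :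
    σ ∈ blockSections Y b ↔ ∀ i, σ i ∈ Y ∧ b (σ i) = i := by
  simp [blockSections, Fintype.mem_piFinset, block]

lemma blockWeight_nonneg {X : Type*} {M : ℕ} (Y : Finset X) (b : X → Fin M) (x : X) :
    0 ≤ blockWeight Y b x := by
  unfold blockWeight; split_ifs <;> positivity

lemma sum_blockWeight {X : Type*} [Fintype X] {M : ℕ} {Y : Finset X} {b : X → Fin M}
    (hne : ∀ i, (block Y b i).Nonempty) : ∑ x, blockWeight Y b x = M := by
  have h1 : ∑ x, blockWeight Y b x = ∑ x ∈ Y, 1 / ((block Y b (b x)).card : ℝ) := by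
    unfold blockWeight
    rw [← sum_filter]
    simp
  rw [h1, ← sum_fiberwise Y b]
  calc _ = ∑ i : Fin M, (1 : ℝ) := by
        refine sum_congr rfl fun i _ => ?_
        have h2 : ∑ x ∈ Y.filter (fun x => b x = i), 1 / ((block Y b (b x)).card : ℝ) =
            ∑ x ∈ block Y b i, 1 / ((block Y b i).card : ℝ) :=
          sum_congr rfl fun x hx => by rw [(mem_filter.mp hx).2]
        have h3 : ((block Y b i).card : ℝ) ≠ 0 := by
          exact_mod_cast (card_pos.mpr (hne i)).ne'
        rw [h2, sum_const, nsmul_eq_mul, mul_one_div_cancel h3]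
    _ = M := by simp

lemma card_blockSections_pos {X : Type*} {M : ℕ} {Y : Finset X} {b : X → Fin M}
    (hne : ∀ i, (block Y b i).Nonempty) : 0 < (blockSections Y b).card := by
  unfold blockSections
  rw [Fintype.card_piFinset]
  exact prod_pos fun i _ => card_pos.mpr (hne i)

/-- A random section chooses independently in each block, so containing vertices of distinct blocks
has the product probability. Distinct vertices of one block exclude each other, which leaves only
the inequality. -/
lemma card_blockSections_through {X : Type*} {M : ℕ} {Y : Finset X} {b : X → Fin M}
    (hne : ∀ i, (block Y b i).Nonempty) (T : Finset X) :
    ((sectionsThrough Y b T).card : ℝ) ≤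
        (blockSections Y b).card * ∏ v ∈ T, blockWeight Y b v ∧
      (Set.InjOn b T → ((sectionsThrough Y b T).card : ℝ) =
        (blockSections Y b).card * ∏ v ∈ T, blockWeight Y b v) := by
  unfold sectionsThrough
  by_cases hTY : T ⊆ Y
  swap
  · obtain ⟨v, hvT, hvY⟩ := not_subset.mp hTY
    have h1 : (blockSections Y b).filter (fun σ => ∀ v ∈ T, σ (b v) = v) = ∅ := by
      rw [filter_eq_empty_iff]
      intro σ hσ h
      exact hvY (h v hvT ▸ (mem_blockSections.mp hσ (b v)).1)
    have h2 : ∏ v ∈ T, blockWeight Y b v = 0 := prod_eq_zero hvT (by simp [blockWeight, hvY])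
    rw [h1, h2]
    simp
  have hfil : (blockSections Y b).filter (fun σ => ∀ v ∈ T, σ (b v) = v) =
      Fintype.piFinset fun i => (block Y b i).filter fun x => ∀ v ∈ T, b v = i → x = v := by
    ext σ
    simp only [blockSections, mem_filter, Fintype.mem_piFinset]
    constructor
    · rintro ⟨h1, h2⟩ i
      exact ⟨h1 i, fun v hv hvi => hvi ▸ h2 v hv⟩
    · intro h
      exact ⟨fun i => (h i).1, fun v hv => (h (b v)).2 v hv rfl⟩
  have hprod : ((blockSections Y b).card : ℝ) * ∏ v ∈ T, blockWeight Y b v =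
      ∏ i, (((block Y b i).card : ℝ) *
        (1 / ((block Y b i).card : ℝ)) ^ (T.filter fun v => b v = i).card) := by
    unfold blockSections
    rw [Fintype.card_piFinset, prod_mul_distrib, Nat.cast_prod, ← prod_fiberwise T b]
    congr 1
    refine prod_congr rfl fun i _ => ?_
    rw [← prod_const]
    refine prod_congr rfl fun v hv => ?_
    have := mem_filter.mp hv
    rw [blockWeight, if_pos (hTY this.1), this.2]
  have hfactor : ∀ i, (T.filter fun v => b v = i).card ≤ 1 →
      ((((block Y b i).filter fun x => ∀ v ∈ T, b v = i → x = v).card : ℕ) : ℝ) =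
      ((block Y b i).card : ℝ) *
        (1 / ((block Y b i).card : ℝ)) ^ (T.filter fun v => b v = i).card := by
    intro i hi
    rcases Nat.le_one_iff_eq_zero_or_eq_one.mp hi with h0 | h1
    · rw [h0, pow_zero, mul_one, filter_true_of_mem]
      intro x _ v hv hvi
      rw [card_eq_zero, filter_eq_empty_iff] at h0
      exact absurd hvi (h0 hv)
    · obtain ⟨v, hv⟩ := card_eq_one.mp h1
      have hv' : ∀ z, z ∈ T ∧ b z = i ↔ z = v := by
        intro z
        have : z ∈ T.filter (fun v => b v = i) ↔ z = v := by rw [hv]; simp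
        simpa using this
      have hvm := (hv' v).mpr rfl
      have h2 : (block Y b i).filter (fun x => ∀ v ∈ T, b v = i → x = v) = {v} := by
        ext x
        simp only [mem_filter, mem_singleton, block]
        constructor
        · rintro ⟨-, h⟩; exact h v hvm.1 hvm.2
        · rintro rfl
          exact ⟨⟨hTY hvm.1, hvm.2⟩, fun z hz hzi => ((hv' z).mp ⟨hz, hzi⟩).symm⟩
      have h3 : ((block Y b i).card : ℝ) ≠ 0 := by
        exact_mod_cast (card_pos.mpr (hne i)).ne'
      rw [h1, h2, pow_one, mul_one_div_cancel h3]
      simp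
  rw [hfil, Fintype.card_piFinset, hprod, Nat.cast_prod]
  constructor
  · refine prod_le_prod (fun i _ => Nat.cast_nonneg _) fun i _ => ?_
    by_cases hi : (T.filter fun v => b v = i).card ≤ 1
    · exact (hfactor i hi).le
    · push Not at hi
      obtain ⟨u, hu, v, hv, huv⟩ := one_lt_card.mp hi
      have h2 : (block Y b i).filter (fun x => ∀ v ∈ T, b v = i → x = v) = ∅ := by
        rw [filter_eq_empty_iff]
        intro x _ h
        have hu' := mem_filter.mp hu
        have hv' := mem_filter.mp hv
        exact huv ((h u hu'.1 hu'.2).symm.trans (h v hv'.1 hv'.2))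
      rw [h2]
      simp only [card_empty, Nat.cast_zero]
      positivity
  · intro hinj
    refine prod_congr rfl fun i _ => hfactor i ?_
    rw [card_le_one]
    intro u hu v hv
    have hu' := mem_filter.mp hu
    have hv' := mem_filter.mp hv
    exact hinj hu'.1 hv'.1 (hu'.2.trans hv'.2.symm)

lemma sum_section_eq {X : Type*} [Fintype X] {M : ℕ} {Y : Finset X} {b : X → Fin M}
    {σ : Fin M → X} (hσ : σ ∈ blockSections Y b) (f : X → ℝ) :
    ∑ x, (if σ (b x) = x then f x else 0) = ∑ i, f (σ i) := by
  have hb := fun i => (mem_blockSections.mp hσ i).2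
  have hinj : Function.Injective σ := fun i j h => by rw [← hb i, h, hb j]
  rw [← sum_filter]
  have : univ.filter (fun x => σ (b x) = x) = univ.image σ := by
    ext x
    simp only [mem_filter, mem_univ, true_and, mem_image]
    exact ⟨fun h => ⟨_, h⟩, fun ⟨i, hi⟩ => by rw [← hi, hb i]⟩
  rw [this, sum_image fun i _ j _ h => hinj h]

/-- The copies of `F` in the section `σ` whose forbidden set meets `σ`. -/
noncomputable def spoiledCopies {V X : Type*} [Fintype V] [Fintype X] {H : SimpleGraph V}
    (F : H.Subgraph) (G : SimpleGraph X) {M : ℕ} (b : X → Fin M)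
    (T : (F.verts → X) → Finset X) (σ : Fin M → X) : Finset (F.verts → X) :=
  univ.filter fun φ => Function.Injective φ ∧ (∀ u v, F.coe.Adj u v → G.Adj (φ u) (φ v)) ∧
    (∀ u, σ (b (φ u)) = φ u) ∧ ∃ v ∈ T φ, σ (b v) = v

/-- Union bound: a spoiled copy requires its own vertices and one of at most `t` further vertices of
`T φ` in the section. Disjointness of `T φ` from `φ` makes that vertex cost an additional factor
`ω`. -/
lemma sum_card_spoiledCopies_le {V X : Type*} [Fintype V] [Fintype X] {H : SimpleGraph V}
    (F : H.Subgraph) {G : SimpleGraph X} {M : ℕ} {Y : Finset X}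
    {b : X → Fin M} (hne : ∀ i, (block Y b i).Nonempty)
    (T : (F.verts → X) → Finset X) (hTd : ∀ φ u, φ u ∉ T φ) {t : ℕ} (hTt : ∀ φ, (T φ).card ≤ t)
    {Q ω : ℝ} (hω : ∀ x, blockWeight Y b x ≤ ω) (hω0 : 0 ≤ ω)
    (hQ : ∑ φ : F.verts → X, (∏ u, blockWeight Y b (φ u)) *
      (if ∀ u ∈ (univ : Finset F.verts), ∀ v ∈ (univ : Finset F.verts),
        F.coe.Adj u v → G.Adj (φ u) (φ v) then 1 else 0) ≤ Q) :
    ∑ σ ∈ blockSections Y b, ((spoiledCopies F G b T σ).card : ℝ) ≤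
      (blockSections Y b).card * (Q * (t * ω)) := by
  set w := blockWeight Y b with hw
  have hw0 : ∀ x, 0 ≤ w x := blockWeight_nonneg Y b
  set Ω := blockSections Y b with hΩ
  have h1 : ∀ φ : F.verts → X, (∑ σ ∈ Ω, if φ ∈ spoiledCopies F G b T σ then (1 : ℝ) else 0) ≤
      Ω.card * ((∏ u, w (φ u)) * (if ∀ u ∈ (univ : Finset F.verts), ∀ v ∈
        (univ : Finset F.verts), F.coe.Adj u v → G.Adj (φ u) (φ v) then 1 else 0) * (t * ω)) := by
    intro φ
    by_cases hφ : Function.Injective φ ∧ ∀ u v, F.coe.Adj u v → G.Adj (φ u) (φ v)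
    · rw [if_pos fun u _ v _ => hφ.2 u v, mul_one, sum_boole]
      have h2 : Ω.filter (fun σ => φ ∈ spoiledCopies F G b T σ) ⊆ (T φ).biUnion fun v =>
          sectionsThrough Y b (insert v (univ.image φ)) := by
        intro σ hσ
        obtain ⟨hσ1, hσ2⟩ := mem_filter.mp hσ
        obtain ⟨-, -, -, h3, v, hv, hσv⟩ := mem_filter.mp hσ2
        refine mem_biUnion.mpr ⟨v, hv, mem_sectionsThrough.mpr ⟨hσ1, ?_⟩⟩
        intro x hx
        rcases mem_insert.mp hx with rfl | hx
        · exact hσv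
        · obtain ⟨u, -, rfl⟩ := mem_image.mp hx
          exact h3 u
      have h3 : ∀ v ∈ T φ, ((sectionsThrough Y b (insert v (univ.image φ))).card : ℝ) ≤ Ω.card * ((∏ u, w (φ u)) * ω) := by
        intro v hv
        refine (card_blockSections_through hne (insert v (univ.image φ))).1.trans ?_
        have hvn : v ∉ univ.image φ := by
          intro h
          obtain ⟨u, -, rfl⟩ := mem_image.mp h
          exact hTd φ u hv
        rw [prod_insert hvn, prod_image fun u _ u' _ h => hφ.1 h, mul_comm (blockWeight Y b v)]
        gcongr
        · exact prod_nonneg fun u _ => hw0 _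
        · exact hω v
      calc ((Ω.filter fun σ => φ ∈ spoiledCopies F G b T σ).card : ℝ)
          ≤ ∑ v ∈ T φ, ((sectionsThrough Y b (insert v (univ.image φ))).card : ℝ) := by
            exact_mod_cast (card_le_card h2).trans card_biUnion_le
        _ ≤ ∑ v ∈ T φ, (Ω.card * ((∏ u, w (φ u)) * ω) : ℝ) := sum_le_sum h3
        _ = (T φ).card * (Ω.card * ((∏ u, w (φ u)) * ω)) := by rw [sum_const, nsmul_eq_mul]
        _ ≤ t * (Ω.card * ((∏ u, w (φ u)) * ω)) := by
            have h4 : 0 ≤ ∏ u, w (φ u) := prod_nonneg fun u _ => hw0 _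
            have h5 : ((T φ).card : ℝ) ≤ t := by exact_mod_cast hTt φ
            gcongr
        _ = _ := by ring
    · have h2 : ∀ σ, φ ∉ spoiledCopies F G b T σ := fun σ h => by
        obtain ⟨-, h3, h4, -⟩ := mem_filter.mp h
        exact hφ ⟨h3, h4⟩
      simp only [h2, if_false, sum_const_zero]
      have h4 : 0 ≤ ∏ u, w (φ u) := prod_nonneg fun u _ => hw0 _
      split_ifs <;> positivity
  calc ∑ σ ∈ Ω, ((spoiledCopies F G b T σ).card : ℝ) = ∑ σ ∈ Ω, ∑ φ, if φ ∈ spoiledCopies F G b T σ then (1 : ℝ) else 0 := by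
        refine sum_congr rfl fun σ _ => ?_
        rw [sum_boole]; simp
    _ = ∑ φ, ∑ σ ∈ Ω, if φ ∈ spoiledCopies F G b T σ then (1 : ℝ) else 0 := sum_comm
    _ ≤ _ := sum_le_sum fun φ _ => h1 φ
    _ = Ω.card * ((∑ φ : F.verts → X, (∏ u, w (φ u)) *
        (if ∀ u ∈ (univ : Finset F.verts), ∀ v ∈ (univ : Finset F.verts),
          F.coe.Adj u v → G.Adj (φ u) (φ v) then 1 else 0)) * (t * ω)) := by
        rw [sum_mul, mul_sum]
    _ ≤ _ := by gcongr

/-- Linearity of expectation over ordered adjacent pairs; the ends of an edge lie in different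
blocks, so they are chosen independently. -/
lemma card_mul_le_sum_pairs {X : Type*} [Fintype X] {G : SimpleGraph X} {M : ℕ} {Y : Finset X}
    {b : X → Fin M} (hne : ∀ i, (block Y b i).Nonempty)
    (hG : ∀ x y, G.Adj x y → b x ≠ b y) {E : ℝ}
    (hE : E ≤ ∑ x, ∑ y, if G.Adj x y then blockWeight Y b x * blockWeight Y b y else 0) :
    (blockSections Y b).card * E ≤ ∑ σ ∈ blockSections Y b, ∑ i, ∑ j,
      if G.Adj (σ i) (σ j) then (1 : ℝ) else 0 := by
  set w := blockWeight Y b with hw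
  set Ω := blockSections Y b with hΩ
  calc Ω.card * E ≤ Ω.card * ∑ x, ∑ y, if G.Adj x y then w x * w y else 0 := by gcongr
    _ = ∑ x, ∑ y, ∑ σ ∈ Ω, if σ (b x) = x then (if σ (b y) = y then
          (if G.Adj x y then (1 : ℝ) else 0) else 0) else 0 := by
        rw [mul_sum]
        refine sum_congr rfl fun x _ => ?_
        rw [mul_sum]
        refine sum_congr rfl fun y _ => ?_
        by_cases hxy : G.Adj x y
        · have h1 := (card_blockSections_through hne {x, y}).2 (by
            intro u hu v hv huv
            simp only [coe_insert, coe_singleton, Set.mem_insert_iff,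
              Set.mem_singleton_iff] at hu hv
            rcases hu with rfl | rfl <;> rcases hv with rfl | rfl
            · rfl
            · exact absurd huv (hG _ _ hxy)
            · exact absurd huv (hG _ _ hxy.symm)
            · rfl)
          rw [prod_pair hxy.ne] at h1
          simp only [hxy, if_true]
          rw [← h1]
          have h2 : sectionsThrough Y b {x, y} =
              Ω.filter fun σ => σ (b x) = x ∧ σ (b y) = y := by
            ext σ; simp [mem_sectionsThrough, hΩ]
          rw [h2, ← sum_boole]
          exact sum_congr rfl fun σ _ => ite_and _ _ _ _
        · simp [hxy]
    _ = ∑ σ ∈ Ω, ∑ x, if σ (b x) = x then ∑ y, (if σ (b y) = y then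
          (if G.Adj x y then (1 : ℝ) else 0) else 0) else 0 := by
        rw [sum_comm' (s := Ω) (t' := univ) (t := fun _ => univ) (s' := fun _ => Ω) (by simp)]
        refine sum_congr rfl fun x _ => ?_
        rw [sum_comm]
        refine sum_congr rfl fun σ _ => ?_
        split_ifs <;> simp
    _ = _ := by
        refine sum_congr rfl fun σ hσ => ?_
        rw [sum_section_eq hσ]
        refine sum_congr rfl fun i _ => ?_
        rw [sum_section_eq hσ]

end Sections

/-! ### Copies of `H` that avoid the forbidden set of their copy of `F`. -/

section Sections
open Classical Finset

/-- Deleting an edge of each spoiled copy of `F` in a section leaves a graph in which every copy of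
`H` avoids the forbidden sets. -/
lemma exists_sampled_graph {V X : Type*} [Fintype V] [Fintype X] {H : SimpleGraph V}
    (F : H.Subgraph) (hF : 0 < F.edgeSet.ncard) (G : SimpleGraph X) {M : ℕ} {Y : Finset X}
    {b : X → Fin M} (T : (F.verts → X) → Finset X) {σ : Fin M → X} (hσ : σ ∈ blockSections Y b) :
    ∃ W : SimpleGraph (Fin M),
      (∑ i, ∑ j, if G.Adj (σ i) (σ j) then (1 : ℝ) else 0) - 2 * (spoiledCopies F G b T σ).card ≤
        2 * W.edgeSet.ncard ∧
      (Nat.card (H.Copy W) : ℝ) ≤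
        ∑ ψ : V → X, if (IsCopyOn H G univ ψ ∧ ∀ v, v ∉ F.verts → ψ v ∉ T fun u => ψ u) ∧
          ∀ v, σ (b (ψ v)) = ψ v then (1 : ℝ) else 0 := by
  -- One fixed edge of `F`: its image is the edge deleted for every spoiled copy. As `σ` is
  -- injective, each spoiled copy costs at most two ordered pairs.
  obtain ⟨x₀, y₀, hxy₀⟩ : ∃ x y, F.Adj x y := by
    obtain ⟨e, he⟩ := Set.nonempty_of_ncard_ne_zero hF.ne'
    induction e with
    | h x y => exact ⟨x, y, he⟩
  let a₀ : F.verts := ⟨x₀, F.edge_vert hxy₀⟩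
  let c₀ : F.verts := ⟨y₀, F.edge_vert hxy₀.symm⟩
  set Bad := spoiledCopies F G b T σ with hBad
  have hb := fun i => (mem_blockSections.mp hσ i).2
  have hinj : Function.Injective σ := fun i j h => by rw [← hb i, h, hb j]
  obtain ⟨W, hW⟩ : ∃ W : SimpleGraph (Fin M), ∀ i j, W.Adj i j ↔ G.Adj (σ i) (σ j) ∧
      ∀ φ ∈ Bad, ¬ (σ i = φ a₀ ∧ σ j = φ c₀) ∧ ¬ (σ j = φ a₀ ∧ σ i = φ c₀) :=
    ⟨{ Adj := fun i j => G.Adj (σ i) (σ j) ∧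
        ∀ φ ∈ Bad, ¬ (σ i = φ a₀ ∧ σ j = φ c₀) ∧ ¬ (σ j = φ a₀ ∧ σ i = φ c₀)
       symm := ⟨fun i j h => ⟨h.1.symm, fun φ hφ => (h.2 φ hφ).symm⟩⟩
       loopless := ⟨fun i h => G.irrefl h.1⟩ }, fun _ _ => Iff.rfl⟩
  have hone : ∀ x y : X, ∑ i : Fin M, ∑ j : Fin M,
      (if σ i = x ∧ σ j = y then (1 : ℝ) else 0) ≤ 1 := by
    intro x y
    have h1 : ∀ z : X, ∑ i : Fin M, (if σ i = z then (1 : ℝ) else 0) ≤ 1 := by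
      intro z
      rw [sum_boole]
      have h2 : (univ.filter fun i : Fin M => σ i = z).card ≤ 1 := card_le_one.mpr fun i hi j hj =>
        hinj ((mem_filter.mp hi).2.trans (mem_filter.mp hj).2.symm)
      exact_mod_cast h2
    calc _ = (∑ i : Fin M, (if σ i = x then (1 : ℝ) else 0)) *
          ∑ j : Fin M, (if σ j = y then (1 : ℝ) else 0) := by
          rw [sum_mul_sum]
          refine sum_congr rfl fun i _ => sum_congr rfl fun j _ => ?_
          by_cases h1 : σ i = x <;> by_cases h2 : σ j = y <;> simp [h1, h2]
      _ ≤ 1 * 1 := by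
          gcongr
          · exact h1 x
          · exact h1 y
      _ = 1 := one_mul 1
  have hWpairs : (∑ i, ∑ j, if G.Adj (σ i) (σ j) then (1 : ℝ) else 0) - 2 * (Bad).card ≤
      2 * W.edgeSet.ncard := by
    rw [← sum_adj_eq W]
    have h1 : ∀ i j : Fin M, (if G.Adj (σ i) (σ j) then (1 : ℝ) else 0) ≤
        (if W.Adj i j then (1 : ℝ) else 0) + ∑ φ ∈ Bad,
          ((if σ i = φ a₀ ∧ σ j = φ c₀ then (1 : ℝ) else 0) +
            (if σ j = φ a₀ ∧ σ i = φ c₀ then (1 : ℝ) else 0)) := by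
      intro i j
      have hnn : ∀ φ ∈ Bad, 0 ≤ ((if σ i = φ a₀ ∧ σ j = φ c₀ then (1 : ℝ) else 0) +
            (if σ j = φ a₀ ∧ σ i = φ c₀ then (1 : ℝ) else 0)) := by
        intro φ _; split_ifs <;> norm_num
      by_cases hWij : W.Adj i j
      · rw [if_pos hWij]
        have := sum_nonneg hnn
        split_ifs <;> linarith
      · rw [if_neg hWij, zero_add]
        by_cases hGij : G.Adj (σ i) (σ j)
        · rw [if_pos hGij]
          rw [hW] at hWij
          push Not at hWij
          obtain ⟨φ, hφ, hor⟩ := hWij hGij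
          refine le_trans ?_ (single_le_sum hnn hφ)
          by_cases h2 : σ i = φ a₀ ∧ σ j = φ c₀
          · rw [if_pos h2]; split_ifs <;> norm_num
          · rw [if_neg h2, if_pos (hor fun h3 h4 => h2 ⟨h3, h4⟩)]; norm_num
        · rw [if_neg hGij]; exact sum_nonneg hnn
    have h2 : (∑ i, ∑ j, if G.Adj (σ i) (σ j) then (1 : ℝ) else 0) ≤
        (∑ i, ∑ j, if W.Adj i j then (1 : ℝ) else 0) + ∑ φ ∈ Bad, 2 := by
      calc _ ≤ _ := sum_le_sum fun i _ => sum_le_sum fun j _ => h1 i j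
        _ = (∑ i, ∑ j, if W.Adj i j then (1 : ℝ) else 0) + ∑ φ ∈ Bad,
            ((∑ i, ∑ j, if σ i = φ a₀ ∧ σ j = φ c₀ then (1 : ℝ) else 0) +
            ∑ i, ∑ j, if σ j = φ a₀ ∧ σ i = φ c₀ then (1 : ℝ) else 0) := by
          simp only [sum_add_distrib]
          congr 1
          congr 1
          · rw [sum_comm' (s := Bad) (t' := univ) (t := fun _ => univ)
              (s' := fun _ => Bad) (by simp)]
            exact sum_congr rfl fun i _ => sum_comm
          · rw [sum_comm' (s := Bad) (t' := univ) (t := fun _ => univ)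
              (s' := fun _ => Bad) (by simp)]
            exact sum_congr rfl fun i _ => sum_comm
        _ ≤ _ := by
          gcongr with φ _
          have h3 := hone (φ a₀) (φ c₀)
          have h4 := hone (φ a₀) (φ c₀)
          rw [sum_comm] at h4
          linarith
    rw [sum_const, nsmul_eq_mul] at h2
    linarith
  have hcount : (Nat.card (H.Copy W) : ℝ) ≤
      ∑ ψ : V → X, if (IsCopyOn H G univ ψ ∧ ∀ v, v ∉ F.verts → ψ v ∉ T fun u => ψ u) ∧
        ∀ v, σ (b (ψ v)) = ψ v then (1 : ℝ) else 0 := by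
    rw [← copyOnCount_univ]
    unfold copyOnCount
    rw [sum_boole, sum_boole]
    have hle : (univ.filter fun ψ : V → Fin M => IsCopyOn H W univ ψ).card ≤
        (univ.filter fun ψ : V → X => (IsCopyOn H G univ ψ ∧ ∀ v, v ∉ F.verts →
          ψ v ∉ T fun u => ψ u) ∧ ∀ v, σ (b (ψ v)) = ψ v).card := by
      refine card_le_card_of_injOn (fun ψ => σ ∘ ψ) ?_ ?_
      · intro ψ hψ
        have hψ' : IsCopyOn H W univ ψ := by simpa using hψ
        have hcopy : IsCopyOn H G univ (σ ∘ ψ) :=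
          ⟨fun u hu v hv h => hψ'.1 hu hv (hinj h),
            fun u hu v hv h => ((hW _ _).mp (hψ'.2 u hu v hv h)).1⟩
        have hsec : ∀ v, σ (b ((σ ∘ ψ) v)) = (σ ∘ ψ) v := fun v => by simp [hb]
        simp only [coe_filter, mem_univ, true_and, Set.mem_ofPred_eq]
        refine ⟨⟨hcopy, fun v hv hT => ?_⟩, hsec⟩
        -- All vertices of `σ ∘ ψ` are sampled, so meeting its own forbidden set would make its copy
        -- of `F` spoiled; but then the image of `x₀y₀` would have been deleted.
        have hφbad : (fun u : F.verts => (σ ∘ ψ) u) ∈ Bad := by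
          refine mem_filter.mpr ⟨mem_univ _, ?_, ?_, fun u => hsec u, _, hT, hsec v⟩
          · intro u u' h
            exact Subtype.ext (hcopy.1 (by simp) (by simp) h)
          · intro u u' h
            exact hcopy.2 u (mem_univ _) u' (mem_univ _) (F.coe_adj_sub u u' h)
        have hadj := hψ'.2 x₀ (mem_univ _) y₀ (mem_univ _) (F.adj_sub hxy₀)
        exact (((hW _ _).mp hadj).2 _ hφbad).1 ⟨rfl, rfl⟩
      · intro ψ _ ψ' _ h
        exact hinj.comp_left h
    exact_mod_cast hle
  exact ⟨W, hWpairs, hcount⟩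

/-- Sampling one vertex per block and deleting an edge of each sampled copy `φ` of `F` whose
forbidden set `T φ` meets the sample shows that many copies of `H` avoid the forbidden sets. -/
lemma sum_avoiding_copies_ge {V X : Type*} [Fintype V] [Fintype X] {H : SimpleGraph V}
    (F : H.Subgraph) (hF : 0 < F.edgeSet.ncard) {G : SimpleGraph X} {M : ℕ} {Y : Finset X}
    {b : X → Fin M} (hne : ∀ i, (block Y b i).Nonempty)
    (hG : ∀ x y, G.Adj x y → b x ≠ b y)
    {α A η : ℝ} (hη : 0 ≤ η) (hH : IsErdosSimonovitsGood H α A η)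
    (hH0 : 0 < H.edgeSet.ncard)
    (T : (F.verts → X) → Finset X) (hTd : ∀ φ u, φ u ∉ T φ) {t : ℕ} (hTt : ∀ φ, (T φ).card ≤ t)
    {E Q ω : ℝ} (hω : ∀ x, blockWeight Y b x ≤ ω) (hω0 : 0 ≤ ω)
    (hE : E ≤ ∑ x, ∑ y, if G.Adj x y then blockWeight Y b x * blockWeight Y b y else 0)
    (hE0 : 0 ≤ E)
    (hQ : ∑ φ : F.verts → X, (∏ u, blockWeight Y b (φ u)) *
      (if ∀ u ∈ (univ : Finset F.verts), ∀ v ∈ (univ : Finset F.verts),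
        F.coe.Adj u v → G.Adj (φ u) (φ v) then 1 else 0) ≤ Q)
    (hM : 0 < M)
    (hQE : 4 * (Q * (t * ω)) ≤ E) (hA : A * (M : ℝ) ^ (1 + α) ≤ E / 8) :
    η * (M : ℝ) ^ Fintype.card V * (E / (8 * (M : ℝ) ^ 2)) ^ H.edgeSet.ncard ≤
      ∑ ψ : V → X, if IsCopyOn H G univ ψ ∧ ∀ v, v ∉ F.verts → ψ v ∉ T fun u => ψ u
        then ∏ v, blockWeight Y b (ψ v) else 0 := by
  have hM' : (0 : ℝ) < M := by exact_mod_cast hM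
  set w := blockWeight Y b with hw
  have hw0 : ∀ x, 0 ≤ w x := blockWeight_nonneg Y b
  have hbad := sum_card_spoiledCopies_le F hne T hTd hTt hω hω0 hQ
  have hpairs := card_mul_le_sum_pairs hne hG hE
  have hthrough := fun ψ : V → X => (card_blockSections_through hne (univ.image ψ)).1
  have hsample := fun σ => exists_sampled_graph F hF G (Y := Y) (b := b) T (σ := σ)
  have hΩ0 : (0 : ℝ) < (blockSections Y b).card := by exact_mod_cast card_blockSections_pos hne
  set Ω := blockSections Y b with hΩ
  set Bad := spoiledCopies F G b T with hBad
  -- Half of the average density that remains guaranteed: on average at least `E - E/2` ordered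
  -- pairs survive, which means density `2z₀`.
  set z₀ := E / (8 * (M : ℝ) ^ 2) with hz₀
  have hz₀0 : 0 ≤ z₀ := by positivity
  -- A lower bound linear in the density, valid for every section: above `z₀` one has `z^e ≥
  -- z₀^(e-1) z`, and below `z₀` the left side is not positive. Only the average density is then
  -- needed.
  have hmain : ∀ σ ∈ Ω, η * (M : ℝ) ^ Fintype.card V * z₀ ^ (H.edgeSet.ncard - 1) *
      (((∑ i, ∑ j, if G.Adj (σ i) (σ j) then (1 : ℝ) else 0) - 2 * (Bad σ).card) /
        (2 * (M : ℝ) ^ 2) - z₀) ≤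
      ∑ ψ : V → X, if (IsCopyOn H G univ ψ ∧ ∀ v, v ∉ F.verts → ψ v ∉ T fun u => ψ u) ∧
        ∀ v, σ (b (ψ v)) = ψ v then (1 : ℝ) else 0 := by
    intro σ hσ
    obtain ⟨W, hWpairs, hcount⟩ := hsample σ hσ
    refine le_trans ?_ hcount
    set z : ℝ := W.edgeSet.ncard / (M : ℝ) ^ 2 with hz
    have hzle : ((∑ i, ∑ j, if G.Adj (σ i) (σ j) then (1 : ℝ) else 0) - 2 * (Bad σ).card) /
        (2 * (M : ℝ) ^ 2) ≤ z := by
      rw [hz, div_le_div_iff₀ (by positivity) (by positivity)]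
      nlinarith [mul_le_mul_of_nonneg_right hWpairs (sq_nonneg (M : ℝ))]
    have hz0 : 0 ≤ z := by positivity
    by_cases hzz : z₀ ≤ z
    · have hg := hH.2 M W z (by rw [hz]; field_simp) (by
        refine hA.trans ?_
        have : E / 8 = z₀ * (M : ℝ) ^ 2 := by rw [hz₀]; field_simp
        rw [this]; gcongr)
      refine le_trans ?_ hg
      rw [Nat.card_eq_fintype_card]
      calc _ ≤ η * (M : ℝ) ^ Fintype.card V * z₀ ^ (H.edgeSet.ncard - 1) * z := by
            refine mul_le_mul_of_nonneg_left ?_ (by positivity)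
            have : ((∑ i, ∑ j, if G.Adj (σ i) (σ j) then (1 : ℝ) else 0) - 2 * (Bad σ).card) /
              (2 * (M : ℝ) ^ 2) - z₀ ≤ z := by linarith
            exact this
        _ ≤ η * (M : ℝ) ^ Fintype.card V * z ^ (H.edgeSet.ncard - 1) * z := by gcongr
        _ = _ := by
            rw [mul_assoc, ← pow_succ, Nat.sub_add_cancel hH0]; ring
    · push Not at hzz
      refine le_trans ?_ (Nat.cast_nonneg _)
      apply mul_nonpos_of_nonneg_of_nonpos
      · positivity
      · linarith
  have hsum : ∑ σ ∈ Ω, ∑ ψ : V → X, (if (IsCopyOn H G univ ψ ∧ ∀ v, v ∉ F.verts →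
      ψ v ∉ T fun u => ψ u) ∧ ∀ v, σ (b (ψ v)) = ψ v then (1 : ℝ) else 0) ≤
      Ω.card * ∑ ψ : V → X, if IsCopyOn H G univ ψ ∧ ∀ v, v ∉ F.verts → ψ v ∉ T fun u => ψ u
        then ∏ v, w (ψ v) else 0 := by
    rw [sum_comm, mul_sum]
    refine sum_le_sum fun ψ _ => ?_
    by_cases hψ : IsCopyOn H G univ ψ ∧ ∀ v, v ∉ F.verts → ψ v ∉ T fun u => ψ u
    · rw [if_pos hψ]
      have h1 := hthrough ψ
      rw [prod_image fun u _ v _ h => hψ.1.1 (by simp) (by simp) h] at h1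
      refine le_trans (le_of_eq ?_) h1
      rw [sum_boole]
      congr 2
      ext σ
      simp only [mem_filter, mem_sectionsThrough, mem_image, mem_univ, true_and,
        forall_exists_index, forall_apply_eq_imp_iff, hψ.1, hΩ]
      exact ⟨fun h => ⟨h.1, h.2.2⟩, fun h => ⟨h.1, hψ.2, h.2⟩⟩
    · simp [hψ]
  have htot := (sum_le_sum hmain).trans hsum
  rw [← mul_sum, sum_sub_distrib, ← sum_div, sum_sub_distrib, ← mul_sum, sum_const,
    nsmul_eq_mul] at htot
  have hfin : Ω.card * z₀ ≤ ((∑ σ ∈ Ω, ∑ i, ∑ j, if G.Adj (σ i) (σ j) then (1 : ℝ) else 0) -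
      2 * ∑ σ ∈ Ω, ((Bad σ).card : ℝ)) / (2 * (M : ℝ) ^ 2) - Ω.card * z₀ := by
    have h1 : (Ω.card : ℝ) * (4 * (Q * (t * ω))) ≤ Ω.card * E := by gcongr
    have h2 : Ω.card * E / 2 ≤ (∑ σ ∈ Ω, ∑ i, ∑ j, if G.Adj (σ i) (σ j) then (1 : ℝ) else 0) -
      2 * ∑ σ ∈ Ω, ((Bad σ).card : ℝ) := by linarith
    have h3 : Ω.card * E / 2 / (2 * (M : ℝ) ^ 2) = 2 * (Ω.card * z₀) := by
      rw [hz₀]; field_simp; norm_num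
    have h4 : Ω.card * E / 2 / (2 * (M : ℝ) ^ 2) ≤ _ :=
      div_le_div_of_nonneg_right h2 (by positivity : (0 : ℝ) ≤ 2 * (M : ℝ) ^ 2)
    linarith
  have hc0 : 0 ≤ η * (M : ℝ) ^ Fintype.card V * z₀ ^ (H.edgeSet.ncard - 1) := by positivity
  have h5 := (mul_le_mul_of_nonneg_left hfin hc0).trans htot
  have h6 : (Ω.card : ℝ) * (η * (M : ℝ) ^ Fintype.card V * z₀ ^ H.edgeSet.ncard) =
      η * (M : ℝ) ^ Fintype.card V * z₀ ^ (H.edgeSet.ncard - 1) * (Ω.card * z₀) := by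
    have : z₀ ^ H.edgeSet.ncard = z₀ ^ (H.edgeSet.ncard - 1) * z₀ := by
      rw [← pow_succ, Nat.sub_add_cancel hH0]
    rw [this]; ring
  rw [← h6] at h5
  exact le_of_mul_le_mul_left h5 hΩ0

end Sections

/-! ### Disjoint extensions of a copy of `F`, and convexity. -/

section GluedCopies
open Classical Finset

/-- Jensen's inequality for `x ↦ x^s` with weights `a i / ∑ a`; a vanishing total weight is treated
separately. -/
lemma pow_sum_mul_le {ι : Type*} (I : Finset ι) (a d : ι → ℝ) (ha : ∀ i ∈ I, 0 ≤ a i)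
    (hd : ∀ i ∈ I, 0 ≤ d i) {s : ℕ} (hs : 1 ≤ s) :
    (∑ i ∈ I, a i * d i) ^ s ≤ (∑ i ∈ I, a i) ^ (s - 1) * ∑ i ∈ I, a i * d i ^ s := by
  set A := ∑ i ∈ I, a i with hA
  rcases (sum_nonneg ha).eq_or_lt with h0 | h0
  · have hz : ∀ i ∈ I, a i = 0 := (sum_eq_zero_iff_of_nonneg ha).mp h0.symm
    rw [sum_eq_zero fun i hi => by rw [hz i hi, zero_mul],
      sum_eq_zero (s := I) (f := fun i => a i * d i ^ s) fun i hi => by rw [hz i hi, zero_mul],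
      mul_zero, zero_pow (by omega)]
  · rw [← hA] at h0
    have h1 := Real.pow_arith_mean_le_arith_mean_pow I (fun i => a i / A) d
      (fun i hi => div_nonneg (ha i hi) h0.le) (by rw [← sum_div, div_self h0.ne']) hd s
    have h2 : ∀ f : ι → ℝ, ∑ i ∈ I, a i / A * f i = (∑ i ∈ I, a i * f i) / A := by
      intro f; rw [sum_div]; exact sum_congr rfl fun i _ => by ring
    rw [h2, h2, div_pow, div_le_div_iff₀ (by positivity) h0] at h1
    have h3 : A ^ s = A ^ (s - 1) * A := by rw [← pow_succ, Nat.sub_add_cancel hs]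
    rw [h3] at h1
    have h4 : (∑ i ∈ I, a i * d i) ^ s * A ≤ (A ^ (s - 1) * ∑ i ∈ I, a i * d i ^ s) * A := by
      linarith
    exact le_of_mul_le_mul_right h4 h0

/-- The function on `V` with prescribed restrictions to `S` and its complement. -/
noncomputable def glueFun {V X : Type*} {S : Set V} (φ : S → X) (g : ↥Sᶜ → X) (v : V) : X :=
  Sum.elim φ g ((Equiv.Set.sumCompl S).symm v)

@[simp] lemma glueFun_coe {V X : Type*} {S : Set V} (φ : S → X) (g : ↥Sᶜ → X) (u : S) :
    glueFun φ g u = φ u := by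
  simp [glueFun]

@[simp] lemma glueFun_compl {V X : Type*} {S : Set V} (φ : S → X) (g : ↥Sᶜ → X) (x : ↥Sᶜ) :
    glueFun φ g x = g x := by
  simp [glueFun]

lemma sum_fun_eq_sum_glueFun {V X : Type*} [Fintype V] [Fintype X] (S : Set V)
    (f : (V → X) → ℝ) : ∑ ψ, f ψ = ∑ φ : S → X, ∑ g : ↥Sᶜ → X, f (glueFun φ g) := by
  let e : (V → X) ≃ (S → X) × (↥Sᶜ → X) :=
    (Equiv.arrowCongr (Equiv.Set.sumCompl S).symm (Equiv.refl X)).trans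
      (Equiv.sumArrowEquivProdArrow S ↥Sᶜ X)
  rw [← e.symm.sum_comp, Fintype.sum_prod_type]
  rfl

lemma prod_glueFun {V X : Type*} [Fintype V] {S : Set V} (w : X → ℝ) (φ : S → X)
    (g : ↥Sᶜ → X) : ∏ v, w (glueFun φ g v) = (∏ u, w (φ u)) * ∏ x, w (g x) := by
  rw [← (Equiv.Set.sumCompl S).prod_comp, Fintype.prod_sum_type]
  simp

/-- The weighted number of extensions of `φ` to a copy of `H` avoiding `T`. -/
noncomputable def extWeight {V X : Type*} [Fintype V] [Fintype X] (H : SimpleGraph V)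
    (S : Set V) (G : SimpleGraph X) (w : X → ℝ) (φ : S → X) (T : Finset X) : ℝ :=
  ∑ g : ↥Sᶜ → X, if IsCopyOn H G univ (glueFun φ g) ∧ ∀ x, g x ∉ T then ∏ x, w (g x) else 0

lemma extWeight_nonneg {V X : Type*} [Fintype V] [Fintype X] (H : SimpleGraph V)
    (S : Set V) (G : SimpleGraph X) {w : X → ℝ} (hw : ∀ x, 0 ≤ w x) (φ : S → X) (T : Finset X) :
    0 ≤ extWeight H S G w φ T :=
  sum_nonneg fun g _ => by
    split_ifs
    · exact prod_nonneg fun x _ => hw _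
    · exact le_rfl

/-- Choosing the worst forbidden set for each `φ` means that the weight avoiding this one set bounds
from below the weight avoiding any other set of the allowed size. -/
lemma exists_min_extWeight {V X : Type*} [Fintype V] [Fintype X] (H : SimpleGraph V)
    (S : Set V) (G : SimpleGraph X) (w : X → ℝ) (t : ℕ) :
    ∃ T : (S → X) → Finset X, (∀ φ u, φ u ∉ T φ) ∧ (∀ φ, (T φ).card ≤ t) ∧
      ∀ φ T', (∀ u, φ u ∉ T') → T'.card ≤ t → extWeight H S G w φ (T φ) ≤ extWeight H S G w φ T' := by
  have h : ∀ φ : S → X, ∃ T : Finset X, ((∀ u, φ u ∉ T) ∧ T.card ≤ t) ∧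
      ∀ T', (∀ u, φ u ∉ T') → T'.card ≤ t → extWeight H S G w φ T ≤ extWeight H S G w φ T' := by
    intro φ
    obtain ⟨T, hT, hmin⟩ := exists_min_image
      (univ.filter fun T : Finset X => (∀ u, φ u ∉ T) ∧ T.card ≤ t) (extWeight H S G w φ)
      ⟨∅, by simp⟩
    exact ⟨T, by simpa using hT, fun T' h1 h2 =>
      hmin T' (mem_filter.mpr ⟨mem_univ _, h1, h2⟩)⟩
  choose T hT hmin using h
  exact ⟨T, fun φ => (hT φ).1, fun φ => (hT φ).2, hmin⟩

/-- The weighted number of `j`-tuples of extensions of `φ` which are disjoint outside `φ`. -/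
noncomputable def tupleWeight {V X : Type*} [Fintype V] [Fintype X] (H : SimpleGraph V)
    (S : Set V) (G : SimpleGraph X) (w : X → ℝ) (φ : S → X) (j : ℕ) : ℝ :=
  ∑ g : Fin j → ↥Sᶜ → X, if (∀ i, IsCopyOn H G univ (glueFun φ (g i))) ∧
    (∀ i i', i ≠ i' → ∀ x y, g i x ≠ g i' y) then ∏ i, ∏ x, w (g i x) else 0

/-- Greedy choice: the extensions already chosen, at most `s-1` in number, occupy a set of the
allowed size off `φ`, and weight at least `d` of extensions avoids it. -/
lemma pow_le_tupleWeight {V X : Type*} [Fintype V] [Fintype X] (H : SimpleGraph V)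
    (S : Set V) (G : SimpleGraph X) {w : X → ℝ} (hw : ∀ x, 0 ≤ w x) (φ : S → X) {s : ℕ} {d : ℝ}
    (hd0 : 0 ≤ d) (hd : ∀ T, (∀ u, φ u ∉ T) → T.card ≤ (s - 1) * Fintype.card ↥Sᶜ →
      d ≤ extWeight H S G w φ T) (j : ℕ) (hj : j ≤ s) : d ^ j ≤ tupleWeight H S G w φ j := by
  induction j with
  | zero => simp [tupleWeight]
  | succ j ih =>
    have ih' := ih (by omega)
    unfold tupleWeight
    rw [← (Fin.consEquiv fun _ : Fin (j + 1) => (↥Sᶜ → X)).sum_comp, Fintype.sum_prod_type_right,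
      pow_succ]
    calc d ^ j * d ≤ tupleWeight H S G w φ j * d := by gcongr
      _ ≤ _ := by
        unfold tupleWeight
        rw [sum_mul]
        refine sum_le_sum fun g _ => ?_
        have hnn : ∀ z : ↥Sᶜ → X, 0 ≤ ∏ x, w (z x) := fun z => prod_nonneg fun x _ => hw _
        split_ifs with hg
        · set T : Finset X := univ.biUnion fun i => univ.image (g i) with hT
          have hTc : T.card ≤ (s - 1) * Fintype.card ↥Sᶜ := by
            calc T.card ≤ (univ : Finset (Fin j)).card * Fintype.card ↥Sᶜ :=
                  card_biUnion_le_card_mul _ _ _ fun i _ => card_image_le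
              _ ≤ _ := by
                  rw [card_univ, Fintype.card_fin]
                  exact Nat.mul_le_mul_right _ (by omega)
          have hTφ : ∀ u, φ u ∉ T := by
            intro u hu
            obtain ⟨i, -, hi⟩ := mem_biUnion.mp hu
            obtain ⟨x, -, hx⟩ := mem_image.mp hi
            have h1 : glueFun φ (g i) x = glueFun φ (g i) u := by simpa using hx
            have h2 := (hg.1 i).1 (by simp) (by simp) h1
            exact x.2 (h2 ▸ u.2)
          refine (mul_le_mul_of_nonneg_left (hd T hTφ hTc)
            (prod_nonneg fun i _ => hnn _)).trans ?_
          unfold extWeight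
          rw [mul_sum]
          refine sum_le_sum fun z _ => ?_
          split_ifs with hz hc
          · refine le_of_eq ?_
            rw [Fin.prod_univ_succ, mul_comm]
            simp
          · refine absurd ⟨?_, ?_⟩ hc
            · intro i
              refine Fin.cases ?_ (fun i => ?_) i
              · simpa using hz.1
              · simpa using hg.1 i
            · have key : ∀ (i : Fin j) x y, z x ≠ g i y := fun i x y h =>
                hz.2 x (mem_biUnion.mpr ⟨i, mem_univ _, mem_image.mpr ⟨y, mem_univ _, h.symm⟩⟩)
              intro i i'
              refine Fin.cases ?_ (fun i => ?_) i <;> refine Fin.cases ?_ (fun i' => ?_) i'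
              · intro h; exact absurd rfl h
              · intro _ x y; simpa using key i' x y
              · intro _ x y; simpa using (key i y x).symm
              · intro h x y
                simpa using hg.2 i i' (fun e => h (by rw [e])) x y
          · rw [mul_zero]; exact prod_nonneg fun i _ => hnn _
          · rw [mul_zero]
        · rw [zero_mul]
          exact sum_nonneg fun z _ => by
            split_ifs
            · exact prod_nonneg fun i _ => hnn _
            · exact le_rfl

lemma isCopyOn_gluedGraph {V X : Type*} [Fintype V] {H : SimpleGraph V} (F : H.Subgraph)
    {G : SimpleGraph X} {s : ℕ} (hs : 1 ≤ s) {φ : F.verts → X}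
    {g : Fin s → ↥(F.verts)ᶜ → X} (hg : ∀ i, IsCopyOn H G univ (glueFun φ (g i)))
    (hd : ∀ i i', i ≠ i' → ∀ x y, g i x ≠ g i' y) :
    IsCopyOn (gluedGraph H F s) G univ (Sum.elim φ fun p => g p.1 p.2) := by
  have hinl : ∀ (a : F.verts) (i : Fin s) (x : ↥(F.verts)ᶜ), φ a ≠ g i x := by
    intro a i x h
    have h1 : glueFun φ (g i) a = glueFun φ (g i) x := by simpa using h
    have h2 : (a : V) = x := (hg i).1 (by simp) (by simp) h1
    exact x.2 (h2 ▸ a.2)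
  constructor
  · rintro (a | ⟨i, x⟩) - (b | ⟨j, y⟩) - h
    · have h1 : glueFun φ (g ⟨0, hs⟩) a = glueFun φ (g ⟨0, hs⟩) b := by simpa using h
      exact congrArg Sum.inl (Subtype.ext ((hg ⟨0, hs⟩).1 (by simp) (by simp) h1))
    · exact absurd h (hinl a j y)
    · exact absurd h.symm (hinl b i x)
    · by_cases hij : i = j
      · subst hij
        have h1 : glueFun φ (g i) x = glueFun φ (g i) y := by simpa using h
        have h2 : x = y := Subtype.ext ((hg i).1 (by simp) (by simp) h1)
        rw [h2]
      · exact absurd h (hd i j hij x y)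
  · rintro (a | p) - (b | q) - h
    · simpa using (hg ⟨0, hs⟩).2 a (mem_univ _) b (mem_univ _)
        ((gluedGraph_adj_inl_inl hs a b).mp h)
    · simpa using (hg q.1).2 a (mem_univ _) q.2 (mem_univ _) ((gluedGraph_adj_inl_inr a q).mp h)
    · simpa using (hg p.1).2 p.2 (mem_univ _) b (mem_univ _)
        ((gluedGraph_adj_inl_inr b p).mp h.symm).symm
    · obtain ⟨h1, h2⟩ := (gluedGraph_adj_inr_inr p q).mp h
      have := (hg p.1).2 p.2 (mem_univ _) q.2 (mem_univ _) h2
      simpa [h1] using this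

/-- The weighted number of copies of `Y`. -/
noncomputable def copyWeight {U X : Type*} [Fintype U] [Fintype X] (Y : SimpleGraph U)
    (G : SimpleGraph X) (w : X → ℝ) : ℝ :=
  ∑ Φ : U → X, if IsCopyOn Y G univ Φ then ∏ u, w (Φ u) else 0

lemma copyWeight_eq_sum {U X Z : Type*} [Fintype U] [Fintype X] [Fintype Z] (Y : SimpleGraph U)
    (G : SimpleGraph X) (w : X → ℝ) (e : Z ≃ (U → X)) :
    copyWeight Y G w = ∑ z, if IsCopyOn Y G univ (e z) then ∏ u, w (e z u) else 0 :=
  (e.sum_comp _).symm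

lemma sum_tupleWeight_le {V X : Type*} [Fintype V] [Fintype X] {H : SimpleGraph V}
    (F : H.Subgraph) (G : SimpleGraph X) {w : X → ℝ} (hw : ∀ x, 0 ≤ w x) {s : ℕ} (hs : 1 ≤ s) :
    ∑ φ : F.verts → X, (∏ u, w (φ u)) * tupleWeight H F.verts G w φ s ≤
      copyWeight (gluedGraph H F s) G w := by
  let e : (F.verts ⊕ (Fin s × ↥(F.verts)ᶜ) → X) ≃ (F.verts → X) × (Fin s → ↥(F.verts)ᶜ → X) :=
    (Equiv.sumArrowEquivProdArrow _ _ X).trans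
      (Equiv.prodCongr (Equiv.refl _) (Equiv.curry _ _ _))
  rw [copyWeight_eq_sum _ _ _ e.symm, Fintype.sum_prod_type]
  refine sum_le_sum fun φ _ => ?_
  unfold tupleWeight
  rw [mul_sum]
  refine sum_le_sum fun g _ => ?_
  have he : e.symm (φ, g) = Sum.elim φ fun p => g p.1 p.2 := rfl
  rw [he]
  split_ifs with h1 h2
  · rw [Fintype.prod_sum_type, Fintype.prod_prod_type]
    simp
  · exact absurd (isCopyOn_gluedGraph F hs h1.1 h1.2) h2
  · rw [mul_zero]; exact prod_nonneg fun u _ => hw _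
  · rw [mul_zero]

/-- A lower bound for the weighted number of glued copies in terms of a block partition. -/
lemma pow_le_mul_copyWeight_gluedGraph {V X : Type*} [Fintype V] [Fintype X] {H : SimpleGraph V}
    (F : H.Subgraph) (hF : 0 < F.edgeSet.ncard) {G : SimpleGraph X} {M : ℕ} {Y : Finset X}
    {b : X → Fin M} (hne : ∀ i, (block Y b i).Nonempty)
    (hG : ∀ x y, G.Adj x y → b x ≠ b y)
    {α A η : ℝ} (hη : 0 ≤ η) (hH : IsErdosSimonovitsGood H α A η)
    (hH0 : 0 < H.edgeSet.ncard) {s : ℕ} (hs : 1 ≤ s)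
    {E Q ω : ℝ} (hω : ∀ x, blockWeight Y b x ≤ ω) (hω0 : 0 ≤ ω)
    (hE : E ≤ ∑ x, ∑ y, if G.Adj x y then blockWeight Y b x * blockWeight Y b y else 0)
    (hE0 : 0 ≤ E)
    (hQ : ∑ φ : F.verts → X, (∏ u, blockWeight Y b (φ u)) *
      (if ∀ u ∈ (univ : Finset F.verts), ∀ v ∈ (univ : Finset F.verts),
        F.coe.Adj u v → G.Adj (φ u) (φ v) then 1 else 0) ≤ Q)
    (hM : 0 < M)
    (hQE : 4 * (Q * (((s - 1) * Fintype.card ↥(F.verts)ᶜ : ℕ) * ω)) ≤ E)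
    (hA : A * (M : ℝ) ^ (1 + α) ≤ E / 8) :
    (η * (M : ℝ) ^ Fintype.card V * (E / (8 * (M : ℝ) ^ 2)) ^ H.edgeSet.ncard) ^ s ≤
      Q ^ (s - 1) * copyWeight (gluedGraph H F s) G (blockWeight Y b) := by
  set w := blockWeight Y b with hw
  have hw0 : ∀ x, 0 ≤ w x := blockWeight_nonneg Y b
  obtain ⟨T, hT1, hT2, hT3⟩ := exists_min_extWeight H F.verts G w
    ((s - 1) * Fintype.card ↥(F.verts)ᶜ)
  have h1 := sum_avoiding_copies_ge F hF hne hG hη hH hH0 T hT1 hT2 hω hω0 hE hE0 hQ hM hQE hA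
  set d : (F.verts → X) → ℝ := fun φ => extWeight H F.verts G w φ (T φ) with hd
  have hd0 : ∀ φ, 0 ≤ d φ := fun φ => extWeight_nonneg H F.verts G hw0 φ _
  -- Convexity is applied with the weights `a`, supported on homomorphisms of `F`. Restrictions of
  -- copies of `H` are such homomorphisms, so no weight is lost, while `∑ a ≤ Q` is what leaf
  -- peeling controls.
  set a : (F.verts → X) → ℝ := fun φ => (∏ u, w (φ u)) *
      (if ∀ u ∈ (univ : Finset F.verts), ∀ v ∈ (univ : Finset F.verts),
        F.coe.Adj u v → G.Adj (φ u) (φ v) then 1 else 0) with ha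
  have hwφ : ∀ φ : F.verts → X, 0 ≤ ∏ u, w (φ u) := fun φ => prod_nonneg fun u _ => hw0 _
  have ha0 : ∀ φ, 0 ≤ a φ := fun φ => mul_nonneg (hwφ φ) (by split_ifs <;> norm_num)
  have h2 : ∑ ψ : V → X, (if IsCopyOn H G univ ψ ∧ ∀ v, v ∉ F.verts → ψ v ∉ T fun u => ψ u
        then ∏ v, w (ψ v) else 0) ≤ ∑ φ, a φ * d φ := by
    rw [sum_fun_eq_sum_glueFun F.verts]
    refine sum_le_sum fun φ _ => ?_
    rw [hd, ha]
    simp only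
    unfold extWeight
    rw [mul_sum]
    refine sum_le_sum fun g _ => ?_
    have hres : (fun u : F.verts => glueFun φ g u) = φ := by funext u; simp
    rw [hres]
    split_ifs with h3 h4 h5
    · rw [mul_one, prod_glueFun]
    · refine absurd ?_ h5
      exact ⟨h3.1, fun x => by simpa using h3.2 x x.2⟩
    · refine absurd ?_ h4
      intro u _ v _ huv
      simpa using h3.1.2 u (mem_univ _) v (mem_univ _) (F.coe_adj_sub u v huv)
    · refine absurd ?_ h4
      intro u _ v _ huv
      simpa using h3.1.2 u (mem_univ _) v (mem_univ _) (F.coe_adj_sub u v huv)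
    all_goals
      first
      | exact mul_nonneg (mul_nonneg (hwφ φ) (by norm_num)) (prod_nonneg fun x _ => hw0 _)
      | simp
  have h3 : ∑ φ, a φ * d φ ^ s ≤ copyWeight (gluedGraph H F s) G w := by
    refine le_trans (sum_le_sum fun φ _ => ?_) (sum_tupleWeight_le F G hw0 hs)
    have h4 := pow_le_tupleWeight H F.verts G hw0 φ (hd0 φ) (hT3 φ) s le_rfl
    refine mul_le_mul ?_ h4 (pow_nonneg (hd0 φ) s) (hwφ φ)
    rw [ha]
    simp only
    split_ifs
    · rw [mul_one]
    · rw [mul_zero]; exact hwφ φ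
  have h4 := pow_sum_mul_le univ a d (fun φ _ => ha0 φ) (fun φ _ => hd0 φ) hs
  have hQ0 : 0 ≤ ∑ φ, a φ := sum_nonneg fun φ _ => ha0 φ
  have hQ1 : 0 ≤ Q := hQ0.trans hQ
  have h5 : 0 ≤ ∑ φ, a φ * d φ ^ s := sum_nonneg fun φ _ => mul_nonneg (ha0 φ) (pow_nonneg (hd0 φ) s)
  calc _ ≤ (∑ φ, a φ * d φ) ^ s := by
        gcongr
        exact h1.trans h2
    _ ≤ _ := h4
    _ ≤ _ := by gcongr

end GluedCopies

/-! ### Passing to a bipartite subgraph with degrees bounded by a multiple of the average. -/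

section Biregular
open Classical Finset

lemma crossPairs_comm {U : Type*} (G : SimpleGraph U) (A B : Finset U) :
    crossPairs G A B = crossPairs G B A := by
  unfold crossPairs
  rw [sum_comm]
  exact sum_congr rfl fun u _ => sum_congr rfl fun v _ => by rw [G.adj_comm]

lemma crossPairs_insert {U : Type*} (G : SimpleGraph U) {A : Finset U} (B : Finset U) {v : U}
    (hv : v ∉ A) : crossPairs G (insert v A) B = (B.filter (G.Adj v)).card + crossPairs G A B := by
  unfold crossPairs
  rw [sum_insert hv, card_filter]

/-- Every graph has a cut containing at least half of its edges. -/
lemma exists_cut {U : Type*} (G : SimpleGraph U) (S : Finset U) :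
    ∃ A B : Finset U, Disjoint A B ∧ A ∪ B = S ∧ adjPairs G S ≤ 4 * crossPairs G A B := by
  induction S using Finset.induction_on with
  | empty => exact ⟨∅, ∅, by simp, by simp, by simp [adjPairs]⟩
  | insert v S hv ih =>
    obtain ⟨A, B, hAB, rfl, hle⟩ := ih
    have hvA : v ∉ A := fun h => hv (mem_union_left _ h)
    have hvB : v ∉ B := fun h => hv (mem_union_right _ h)
    have h1 := adjPairs_erase G (mem_insert_self v (A ∪ B))
    rw [erase_insert hv] at h1
    have h2 : ((insert v (A ∪ B)).filter (G.Adj v)).card =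
        (A.filter (G.Adj v)).card + (B.filter (G.Adj v)).card := by
      rw [filter_insert, if_neg (G.irrefl), filter_union, card_union_of_disjoint]
      exact disjoint_filter_filter hAB
    rcases le_total (A.filter (G.Adj v)).card (B.filter (G.Adj v)).card with h | h
    · refine ⟨insert v A, B, ?_, insert_union v A B, ?_⟩
      · rw [disjoint_insert_left]; exact ⟨hvB, hAB⟩
      · rw [crossPairs_insert G B hvA]; omega
    · refine ⟨A, insert v B, ?_, union_insert v A B, ?_⟩
      · rw [disjoint_insert_right]; exact ⟨hvA, hAB⟩
      · rw [crossPairs_comm, crossPairs_insert G A hvB, crossPairs_comm G B A]; omega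

/-- Vertices of degree above `4^N` times the average form a set `A₀` of size at most `|A|/4^N`. By
maximality `e(A₀,B) ≤ e(A,B)(|A₀|/|A|)^(1/N)`, so they carry at most a quarter of the edges. -/
lemma crossPairs_prune {U : Type*} (G : SimpleGraph U) {A B : Finset U} {N : ℕ} (hN : 1 ≤ N)
    (h0 : 0 < crossPairs G A B)
    (hmax : ∀ A' ⊆ A, (crossPairs G A' B : ℝ) / ((A'.card : ℝ) * B.card) ^ (1 / (N : ℝ)) ≤
      (crossPairs G A B : ℝ) / ((A.card : ℝ) * B.card) ^ (1 / (N : ℝ))) :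
    4 * crossPairs G (A.filter fun x =>
      4 ^ N * crossPairs G A B < (B.filter (G.Adj x)).card * A.card) B ≤ crossPairs G A B := by
  set A₀ := A.filter fun x => 4 ^ N * crossPairs G A B < (B.filter (G.Adj x)).card * A.card with hA₀
  have hA₀A : A₀ ⊆ A := filter_subset _ _
  rcases A₀.eq_empty_or_nonempty with he | hne
  · rw [he]; simp [crossPairs]
  have hB : 0 < B.card := by
    rw [card_pos]
    by_contra hB
    rw [not_nonempty_iff_eq_empty] at hB
    simp [hB, crossPairs] at h0
  have hA : 0 < A.card := (card_pos.mpr hne).trans_le (card_le_card hA₀A)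
  have h1 : A₀.card * (4 ^ N * crossPairs G A B) ≤ crossPairs G A₀ B * A.card := by
    have : crossPairs G A₀ B * A.card = ∑ x ∈ A₀, (B.filter (G.Adj x)).card * A.card := by
      unfold crossPairs
      rw [sum_mul]
      exact sum_congr rfl fun x _ => by rw [card_filter]
    rw [this, ← smul_eq_mul, ← sum_const]
    exact sum_le_sum fun x hx => (mem_filter.mp hx).2.le
  have h2 : crossPairs G A₀ B ≤ crossPairs G A B := crossPairs_mono_left G B hA₀A
  have h3 : A₀.card * 4 ^ N ≤ A.card := by
    have : A₀.card * 4 ^ N * crossPairs G A B ≤ A.card * crossPairs G A B := by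
      calc _ = A₀.card * (4 ^ N * crossPairs G A B) := by ring
        _ ≤ crossPairs G A₀ B * A.card := h1
        _ ≤ crossPairs G A B * A.card := Nat.mul_le_mul_right _ h2
        _ = _ := by ring
    exact Nat.le_of_mul_le_mul_right this h0
  have h4 := hmax A₀ hA₀A
  have hA' : (0 : ℝ) < A.card := by exact_mod_cast hA
  have hA₀' : (0 : ℝ) < A₀.card := by exact_mod_cast card_pos.mpr hne
  have hB' : (0 : ℝ) < B.card := by exact_mod_cast hB
  have hN' : (N : ℝ) ≠ 0 := by positivity
  have h5 : (((A₀.card : ℝ) * B.card) ^ (1 / (N : ℝ))) * 4 ≤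
      ((A.card : ℝ) * B.card) ^ (1 / (N : ℝ)) := by
    have h6 : ((4 : ℝ) ^ N) ^ (1 / (N : ℝ)) = 4 := by
      rw [← Real.rpow_natCast, ← Real.rpow_mul (by norm_num), mul_one_div_cancel hN', Real.rpow_one]
    calc _ = (((A₀.card : ℝ) * B.card) ^ (1 / (N : ℝ))) * ((4 : ℝ) ^ N) ^ (1 / (N : ℝ)) := by
          rw [h6]
      _ = ((A₀.card : ℝ) * B.card * 4 ^ N) ^ (1 / (N : ℝ)) :=
          (Real.mul_rpow (by positivity) (by positivity)).symm
      _ ≤ _ := by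
          apply Real.rpow_le_rpow (by positivity) _ (by positivity)
          have : (A₀.card : ℝ) * 4 ^ N ≤ A.card := by exact_mod_cast h3
          calc (A₀.card : ℝ) * B.card * 4 ^ N = A₀.card * 4 ^ N * B.card := by ring
            _ ≤ _ := by gcongr
  rw [div_le_div_iff₀ (by positivity) (by positivity)] at h4
  have h6 : (4 * crossPairs G A₀ B : ℝ) * ((A₀.card : ℝ) * B.card) ^ (1 / (N : ℝ)) ≤
      crossPairs G A B * ((A₀.card : ℝ) * B.card) ^ (1 / (N : ℝ)) := by
    refine le_trans ?_ h4
    calc _ = (crossPairs G A₀ B : ℝ) * (((A₀.card : ℝ) * B.card) ^ (1 / (N : ℝ)) * 4) := by ring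
      _ ≤ _ := by gcongr
  have h7 := le_of_mul_le_mul_right h6 (by positivity)
  exact_mod_cast h7

/-- Every graph contains a dense bipartite subgraph whose degrees are, on either side, at most a
constant times the average, and which maximizes a suitable density up to a constant. -/
lemma exists_biregular_subgraph {X : Type*} [Fintype X] (G : SimpleGraph X) {N : ℕ} (hN : 1 ≤ N)
    (hG : 0 < G.edgeSet.ncard) :
    ∃ (A B : Finset X) (G' : SimpleGraph X), Disjoint A B ∧ G' ≤ G ∧
      (∀ x y, G'.Adj x y → x ∈ A ∧ y ∈ B ∨ x ∈ B ∧ y ∈ A) ∧ 0 < crossPairs G' A B ∧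
      (∀ x ∈ A, (univ.filter (G'.Adj x)).card * A.card ≤ 2 * 4 ^ N * crossPairs G' A B) ∧
      (∀ x ∈ B, (univ.filter (G'.Adj x)).card * B.card ≤ 2 * 4 ^ N * crossPairs G' A B) ∧
      (G.edgeSet.ncard : ℝ) * ((A.card : ℝ) * B.card) ^ (1 / (N : ℝ)) ≤
        4 * crossPairs G' A B * ((Fintype.card X : ℝ) ^ 2) ^ (1 / (N : ℝ)) := by
  -- Dividing by the small power `1/N` of `|A||B|` favours small dense pairs slightly; this is the
  -- source of both the pruning and the final density inequality.
  set val : Finset X × Finset X → ℝ := fun P =>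
    (crossPairs G P.1 P.2 : ℝ) / ((P.1.card : ℝ) * P.2.card) ^ (1 / (N : ℝ)) with hval
  obtain ⟨⟨A, B⟩, hAB, hmax⟩ := exists_max_image
    (univ.filter fun P : Finset X × Finset X => Disjoint P.1 P.2) val ⟨(∅, ∅), by simp⟩
  have hdis : Disjoint A B := by simpa using hAB
  have hmax' : ∀ A' B', Disjoint A' B' → val (A', B') ≤ val (A, B) := fun A' B' h =>
    hmax (A', B') (by simpa using h)
  obtain ⟨A₁, B₁, hdis₁, -, hcut⟩ := exists_cut G univ
  rw [adjPairs_univ] at hcut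
  have hn0 : 0 < Fintype.card X := by
    by_contra h
    have hX : IsEmpty X := Fintype.card_eq_zero_iff.mp (by omega)
    have : G.edgeSet = ∅ := by
      ext e; induction e with | h x y => exact hX.elim x
    simp [this] at hG
  have hn0' : (0 : ℝ) < Fintype.card X := by exact_mod_cast hn0
  have hposcard : ∀ A B : Finset X, 0 < crossPairs G A B → 0 < A.card ∧ 0 < B.card := by
    intro A B h
    constructor
    · rw [card_pos]; by_contra h'
      rw [not_nonempty_iff_eq_empty] at h'; simp [h', crossPairs] at h
    · rw [card_pos]; by_contra h'
      rw [not_nonempty_iff_eq_empty] at h'; simp [h', crossPairs] at h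
  have hc1 : 0 < crossPairs G A₁ B₁ := by omega
  obtain ⟨hA1, hB1⟩ := hposcard _ _ hc1
  have hval1 : (G.edgeSet.ncard : ℝ) / 2 / ((Fintype.card X : ℝ) ^ 2) ^ (1 / (N : ℝ)) ≤
      val (A₁, B₁) := by
    rw [hval]
    have h1 : (G.edgeSet.ncard : ℝ) / 2 ≤ crossPairs G A₁ B₁ := by
      rw [div_le_iff₀ (by norm_num)]
      exact_mod_cast (by omega : G.edgeSet.ncard ≤ crossPairs G A₁ B₁ * 2)
    have hA1' : (0 : ℝ) < A₁.card := by exact_mod_cast hA1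
    have hB1' : (0 : ℝ) < B₁.card := by exact_mod_cast hB1
    have h2 : (A₁.card : ℝ) * B₁.card ≤ (Fintype.card X : ℝ) ^ 2 := by
      rw [sq]
      have h3 : (A₁.card : ℝ) ≤ Fintype.card X := by exact_mod_cast card_le_univ _
      have h4 : (B₁.card : ℝ) ≤ Fintype.card X := by exact_mod_cast card_le_univ _
      gcongr
    dsimp only
    gcongr
  have hval2 := hval1.trans (hmax' A₁ B₁ hdis₁)
  have hc : 0 < crossPairs G A B := by
    by_contra h
    have h0 : crossPairs G A B = 0 := by omega
    have : val (A, B) = 0 := by simp [hval, h0]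
    rw [this] at hval2
    have : 0 < (G.edgeSet.ncard : ℝ) / 2 / ((Fintype.card X : ℝ) ^ 2) ^ (1 / (N : ℝ)) := by
      have : (0 : ℝ) < G.edgeSet.ncard := by exact_mod_cast hG
      positivity
    linarith
  obtain ⟨hA, hB⟩ := hposcard _ _ hc
  have hA' : (0 : ℝ) < A.card := by exact_mod_cast hA
  have hB' : (0 : ℝ) < B.card := by exact_mod_cast hB
  set A₀ := A.filter fun x => 4 ^ N * crossPairs G A B < (B.filter (G.Adj x)).card * A.card with hA₀
  set B₀ := B.filter fun x => 4 ^ N * crossPairs G B A < (A.filter (G.Adj x)).card * B.card with hB₀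
  have hpA := crossPairs_prune G (A := A) (B := B) hN hc fun A' hA' =>
    hmax' A' B (hdis.mono_left hA')
  have hpB := crossPairs_prune G (A := B) (B := A) hN (by rwa [crossPairs_comm]) fun B' hB' => by
    have h1 := hmax' A B' (hdis.mono_right hB')
    simp only [hval] at h1
    rwa [crossPairs_comm G B', crossPairs_comm G B, mul_comm (B'.card : ℝ),
      mul_comm (B.card : ℝ)]
  rw [← hA₀] at hpA
  rw [← hB₀, crossPairs_comm G B A] at hpB
  obtain ⟨G', hadj⟩ : ∃ G' : SimpleGraph X, ∀ x y, G'.Adj x y ↔ G.Adj x y ∧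
      (x ∈ A \ A₀ ∧ y ∈ B \ B₀ ∨ x ∈ B \ B₀ ∧ y ∈ A \ A₀) :=
    ⟨{ Adj := fun x y => G.Adj x y ∧ (x ∈ A \ A₀ ∧ y ∈ B \ B₀ ∨ x ∈ B \ B₀ ∧ y ∈ A \ A₀)
       symm := ⟨fun x y h => ⟨h.1.symm, by tauto⟩⟩
       loopless := ⟨fun x h => G.irrefl h.1⟩ }, fun _ _ => Iff.rfl⟩
  have hA₀A : A₀ ⊆ A := filter_subset _ _
  have hB₀B : B₀ ⊆ B := filter_subset _ _
  have hcross : crossPairs G A B ≤ crossPairs G' A B + crossPairs G A₀ B + crossPairs G B₀ A := by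
    have h1 : crossPairs G A₀ B = ∑ x ∈ A, ∑ y ∈ B, if x ∈ A₀ ∧ G.Adj x y then 1 else 0 := by
      unfold crossPairs
      rw [← sum_subset hA₀A fun x _ hx =>
        sum_eq_zero fun y _ => if_neg fun h => hx h.1]
      exact sum_congr rfl fun x hx => sum_congr rfl fun y _ => by simp [hx]
    have h2 : crossPairs G B₀ A = ∑ x ∈ A, ∑ y ∈ B, if y ∈ B₀ ∧ G.Adj x y then 1 else 0 := by
      rw [sum_comm]
      unfold crossPairs
      rw [← sum_subset hB₀B fun x _ hx =>
        sum_eq_zero fun y _ => if_neg fun h => hx h.1]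
      exact sum_congr rfl fun x hx => sum_congr rfl fun y _ => by simp only [hx, true_and, G.adj_comm y x]
    rw [h1, h2]
    unfold crossPairs
    rw [← sum_add_distrib, ← sum_add_distrib]
    refine sum_le_sum fun x hx => ?_
    rw [← sum_add_distrib, ← sum_add_distrib]
    refine sum_le_sum fun y hy => ?_
    by_cases hxy : G.Adj x y
    · by_cases hx0 : x ∈ A₀
      · simp [hxy, hx0]; omega
      · by_cases hy0 : y ∈ B₀
        · simp [hxy, hy0]
        · have : G'.Adj x y := (hadj x y).mpr
            ⟨hxy, Or.inl ⟨mem_sdiff.mpr ⟨hx, hx0⟩, mem_sdiff.mpr ⟨hy, hy0⟩⟩⟩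
          simp [hxy, this]; omega
    · simp [hxy]
  -- Pruning loses at most a quarter of the edges on each side. The sets `A` and `B` are kept
  -- unchanged; pruned vertices become isolated in `G'`.
  have hhalf : crossPairs G A B ≤ 2 * crossPairs G' A B := by omega
  have hAnB : ∀ x ∈ A, x ∉ B := fun x hx hx' => disjoint_left.mp hdis hx hx'
  refine ⟨A, B, G', hdis, fun x y h => ((hadj x y).mp h).1, ?_, by omega, ?_, ?_, ?_⟩
  · intro x y h
    rcases ((hadj x y).mp h).2 with h | h
    · exact Or.inl ⟨(mem_sdiff.mp h.1).1, (mem_sdiff.mp h.2).1⟩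
    · exact Or.inr ⟨(mem_sdiff.mp h.1).1, (mem_sdiff.mp h.2).1⟩
  · intro x hx
    by_cases hx0 : x ∈ A₀
    · have : univ.filter (G'.Adj x) = ∅ := by
        rw [filter_eq_empty_iff]
        intro y _ h
        rcases ((hadj x y).mp h).2 with h | h
        · exact (mem_sdiff.mp h.1).2 hx0
        · exact hAnB x hx (mem_sdiff.mp h.1).1
      simp [this]
    · have h1 : (univ.filter (G'.Adj x)).card ≤ (B.filter (G.Adj x)).card := by
        refine card_le_card fun y hy => ?_
        have h := (hadj x y).mp (by simpa using hy)
        rcases h.2 with h' | h'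
        · exact mem_filter.mpr ⟨(mem_sdiff.mp h'.2).1, h.1⟩
        · exact absurd (mem_sdiff.mp h'.1).1 (hAnB x hx)
      have h2 : (B.filter (G.Adj x)).card * A.card ≤ 4 ^ N * crossPairs G A B := by
        by_contra h
        exact hx0 (mem_filter.mpr ⟨hx, not_le.mp h⟩)
      calc _ ≤ (B.filter (G.Adj x)).card * A.card := Nat.mul_le_mul_right _ h1
        _ ≤ 4 ^ N * crossPairs G A B := h2
        _ ≤ 4 ^ N * (2 * crossPairs G' A B) := Nat.mul_le_mul_left _ hhalf
        _ = _ := by ring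
  · intro x hx
    have hxA : x ∉ A := fun h => hAnB x h hx
    by_cases hx0 : x ∈ B₀
    · have : univ.filter (G'.Adj x) = ∅ := by
        rw [filter_eq_empty_iff]
        intro y _ h
        rcases ((hadj x y).mp h).2 with h | h
        · exact hxA (mem_sdiff.mp h.1).1
        · exact (mem_sdiff.mp h.1).2 hx0
      simp [this]
    · have h1 : (univ.filter (G'.Adj x)).card ≤ (A.filter (G.Adj x)).card := by
        refine card_le_card fun y hy => ?_
        have h := (hadj x y).mp (by simpa using hy)
        rcases h.2 with h' | h'
        · exact absurd (mem_sdiff.mp h'.1).1 hxA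
        · exact mem_filter.mpr ⟨(mem_sdiff.mp h'.2).1, h.1⟩
      have h2 : (A.filter (G.Adj x)).card * B.card ≤ 4 ^ N * crossPairs G A B := by
        by_contra h
        rw [crossPairs_comm] at h
        exact hx0 (mem_filter.mpr ⟨hx, not_le.mp h⟩)
      calc _ ≤ (A.filter (G.Adj x)).card * B.card := Nat.mul_le_mul_right _ h1
        _ ≤ 4 ^ N * crossPairs G A B := h2
        _ ≤ 4 ^ N * (2 * crossPairs G' A B) := Nat.mul_le_mul_left _ hhalf
        _ = _ := by ring
  · simp only [hval] at hval2
    rw [div_le_div_iff₀ (by positivity) (by positivity)] at hval2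
    have h1 : (crossPairs G A B : ℝ) ≤ 2 * crossPairs G' A B := by exact_mod_cast hhalf
    have h2 : (crossPairs G A B : ℝ) * ((Fintype.card X : ℝ) ^ 2) ^ (1 / (N : ℝ)) ≤
      2 * crossPairs G' A B * ((Fintype.card X : ℝ) ^ 2) ^ (1 / (N : ℝ)) := by gcongr
    linarith

/-- Colour by index modulo `m`. Each class has `⌊|A|/m⌋` or one more elements, and `m ≤ |A|` makes
the floor at least one, so the sizes are within a factor two of `|A|/m`. -/
lemma exists_balanced_colouring {X : Type*} (A : Finset X) {m : ℕ} (hm : 0 < m)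
    (hmA : m ≤ A.card) : ∃ c : X → Fin m, ∀ i, A.card ≤ 2 * m * (A.filter fun x => c x = i).card ∧
      m * (A.filter fun x => c x = i).card ≤ 2 * A.card := by
  let idx : X → ℕ := fun x => if h : x ∈ A then (A.equivFin ⟨x, h⟩ : ℕ) else 0
  refine ⟨fun x => ⟨idx x % m, Nat.mod_lt _ hm⟩, fun i => ?_⟩
  have hcard : (A.filter fun x => (⟨idx x % m, Nat.mod_lt _ hm⟩ : Fin m) = i).card =
      ((range A.card).filter fun k => k ≡ i [MOD m]).card := by
    refine card_bij (fun x _ => idx x) ?_ ?_ ?_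
    · intro x hx
      obtain ⟨hxA, hxi⟩ := mem_filter.mp hx
      refine mem_filter.mpr ⟨?_, ?_⟩
      · simp only [idx, hxA, dif_pos, mem_range]
        exact (A.equivFin ⟨x, hxA⟩).2
      · have := congrArg Fin.val hxi
        rw [Nat.ModEq, Nat.mod_eq_of_lt i.2]
        exact this
    · intro x hx y hy hxy
      have hxA := (mem_filter.mp hx).1
      have hyA := (mem_filter.mp hy).1
      simp only [idx, hxA, hyA, dif_pos] at hxy
      have := A.equivFin.injective (Fin.ext hxy)
      exact congrArg Subtype.val this
    · intro k hk
      obtain ⟨hkr, hki⟩ := mem_filter.mp hk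
      have hk' : k < A.card := mem_range.mp hkr
      have hidx : idx (A.equivFin.symm ⟨k, hk'⟩ : X) = k := by
        simp [idx]
      refine ⟨(A.equivFin.symm ⟨k, hk'⟩ : X), mem_filter.mpr ⟨Subtype.prop _, ?_⟩, hidx⟩
      apply Fin.ext
      simp only [hidx]
      rw [Nat.ModEq, Nat.mod_eq_of_lt i.2] at hki
      exact hki
  rw [hcard, ← Nat.count_eq_card_filter_range, Nat.count_modEq_card _ hm]
  have h1 := Nat.div_add_mod A.card m
  have h2 := Nat.mod_lt A.card hm
  have h3 : 1 ≤ A.card / m := (Nat.one_le_div_iff hm).mpr hmA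
  have h4 : m ≤ m * (A.card / m) := Nat.le_mul_of_pos_right _ h3
  constructor
  · calc A.card ≤ 2 * (m * (A.card / m)) := by omega
      _ = 2 * m * (A.card / m) := by ring
      _ ≤ _ := Nat.mul_le_mul_left _ (Nat.le_add_right _ _)
  · rw [mul_add]
    split_ifs <;> simp <;> omega

end Biregular

/-! ### Bipartition classes of graphs with a cycle. -/

section SplitGraphs
open Classical Finset

lemma adjPairs_eq_two_mul_sum_of_split {U : Type*} {Y : SimpleGraph U} {P : Finset U}
    (hP : ∀ u v, Y.Adj u v → (u ∈ P ↔ v ∉ P)) (T : Finset U) :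
    adjPairs Y T = 2 * ∑ u ∈ T.filter (· ∈ P), (T.filter (Y.Adj u)).card := by
  have h1 : adjPairs Y T = ∑ u ∈ T, ∑ v ∈ T, ((if u ∈ P then if Y.Adj u v then 1 else 0 else 0) +
      (if v ∈ P then if Y.Adj v u then 1 else 0 else 0)) := by
    refine sum_congr rfl fun u _ => sum_congr rfl fun v _ => ?_
    by_cases h : Y.Adj u v
    · have := hP u v h
      by_cases hv : v ∈ P <;> simp_all [h.symm]
    · have h' : ¬ Y.Adj v u := fun h' => h h'.symm
      simp [h, h']
  have h2 : ∑ u ∈ T, ∑ v ∈ T, (if u ∈ P then if Y.Adj u v then 1 else 0 else 0) =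
      ∑ u ∈ T.filter (· ∈ P), (T.filter (Y.Adj u)).card := by
    rw [sum_filter]
    refine sum_congr rfl fun u _ => ?_
    split_ifs
    · rw [card_filter]
    · simp
  rw [h1]
  simp only [sum_add_distrib]
  rw [sum_comm (f := fun u v => if v ∈ P then if Y.Adj v u then 1 else 0 else 0), h2, two_mul]

/-- In a graph with a cycle, a set of non-isolated vertices meeting every edge exactly once has
fewer elements than the graph has edges. -/
lemma card_lt_ncard_edgeSet_of_split {U : Type*} [Fintype U] {Y : SimpleGraph U} {P : Finset U}
    (hP : ∀ u v, Y.Adj u v → (u ∈ P ↔ v ∉ P)) (hP' : ∀ u ∈ P, ∃ v, Y.Adj u v)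
    (hY : ¬ IsSparse Y) : P.card < Y.edgeSet.ncard := by
  by_contra! hle
  refine hY fun T hT => ?_
  have h1 := adjPairs_eq_two_mul_sum_of_split hP univ
  rw [adjPairs_univ] at h1
  have h2 : univ.filter (· ∈ P) = P := by ext; simp
  rw [h2] at h1
  have hpos : ∀ u ∈ P, 1 ≤ (univ.filter (Y.Adj u)).card := fun u hu => by
    obtain ⟨v, hv⟩ := hP' u hu
    exact card_pos.mpr ⟨v, by simpa using hv⟩
  -- The number of edges is the sum of the degrees over `P`, each at least one. If it is at most
  -- `|P|`, every degree in `P` is one and the graph is a union of stars and isolated vertices,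
  -- hence sparse.
  have hone : ∀ u ∈ P, 1 = (univ.filter (Y.Adj u)).card := by
    refine (sum_eq_sum_iff_of_le hpos).mp (le_antisymm (sum_le_sum hpos) ?_)
    rw [sum_const, smul_eq_mul, mul_one]
    omega
  have h3 : ∑ u ∈ T.filter (· ∈ P), (T.filter (Y.Adj u)).card ≤ (T.filter (· ∈ P)).card := by
    rw [card_eq_sum_ones]
    refine sum_le_sum fun u hu => ?_
    rw [hone u (mem_filter.mp hu).2]
    exact card_le_card (filter_subset_filter _ (subset_univ _))
  rw [adjPairs_eq_two_mul_sum_of_split hP T]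
  rcases Nat.eq_zero_or_pos (∑ u ∈ T.filter (· ∈ P), (T.filter (Y.Adj u)).card) with h0 | h0
  · have := card_pos.mpr hT
    omega
  · obtain ⟨u, hu, hu0⟩ := exists_ne_zero_of_sum_ne_zero h0.ne'
    obtain ⟨v, hv⟩ := card_pos.mp (Nat.pos_of_ne_zero hu0)
    obtain ⟨hvT, huv⟩ := mem_filter.mp hv
    have h4 : (T.filter (· ∈ P)).card < T.card :=
      card_lt_card (filter_ssubset.mpr ⟨v, hvT, (hP u v huv).mp (mem_filter.mp hu).2⟩)
    omega

end SplitGraphs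

/-! ### From weighted to unweighted numbers of copies. -/

section WeightToCount
open Classical Finset

/-- The condition on `S` ignores coordinates in `I`, so each of these can be resampled independently
and contributes `∑ w` in place of `|X|`. -/
lemma card_pow_mul_sum_copyOn {U X : Type*} [Fintype U] [Fintype X] (Y : SimpleGraph U)
    (G : SimpleGraph X) (w : X → ℝ) (I S : Finset U) (hIS : Disjoint I S) :
    (Fintype.card X : ℝ) ^ I.card * ∑ Φ : U → X, (if IsCopyOn Y G S Φ then ∏ u ∈ I, w (Φ u) else 0)
      = (∑ x, w x) ^ I.card * copyOnCount Y G S := by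
  induction I using Finset.induction_on with
  | empty => simp [copyOnCount]
  | insert v I hv ih =>
    rw [disjoint_insert_left] at hIS
    have hupd : ∀ (Φ : U → X) x, IsCopyOn Y G S (Function.update Φ v x) ↔ IsCopyOn Y G S Φ := by
      intro Φ x
      have h : ∀ u ∈ S, Function.update Φ v x u = Φ u := fun u hu =>
        Function.update_of_ne (fun h : u = v => hIS.1 (h ▸ hu)) _ _
      unfold IsCopyOn
      refine and_congr (Set.EqOn.injOn_iff fun u hu => h u hu) ?_
      refine forall₂_congr fun u hu => forall₂_congr fun u' hu' => ?_
      rw [h u hu, h u' hu']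
    have h1 := sum_update_eq (fun _ : X => (1 : ℝ)) (fun Φ : U → X =>
      if IsCopyOn Y G S Φ then ∏ u ∈ insert v I, w (Φ u) else 0) v
    have h2 : ∀ (Φ : U → X) x, (if IsCopyOn Y G S (Function.update Φ v x) then
        ∏ u ∈ insert v I, w (Function.update Φ v x u) else 0) =
        w x * if IsCopyOn Y G S Φ then ∏ u ∈ I, w (Φ u) else 0 := by
      intro Φ x
      have h3 : ∏ u ∈ I, w (Function.update Φ v x u) = ∏ u ∈ I, w (Φ u) :=
        prod_congr rfl fun u hu => by
          rw [Function.update_of_ne (fun h : u = v => hv (h ▸ hu))]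
      simp only [hupd, prod_insert hv, Function.update_self, h3]
      split_ifs <;> simp
    simp only [h2, prod_const_one, one_mul, ← sum_mul, ← mul_sum, sum_const, card_univ,
      nsmul_eq_mul, mul_one] at h1
    rw [card_insert_of_notMem hv, pow_succ, pow_succ, mul_assoc, ← h1,
      mul_right_comm _ (∑ x, w x), ← ih hIS.2]
    ring

end WeightToCount

section WeightToCountSplit
open Classical Finset

/-- Copies of a graph with a cycle in a graph with parts `A` and `B` can be counted by weight: each
part receives fewer non-isolated vertices than there are edges. -/
lemma card_pow_mul_copyWeight_le {U X : Type*} [Fintype U] [Fintype X] {Y : SimpleGraph U}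
    (hY : ¬ IsSparse Y) {G : SimpleGraph X} {A B : Finset X} (hdis : Disjoint A B)
    (hadj : ∀ x y, G.Adj x y → x ∈ A ∧ y ∈ B ∨ x ∈ B ∧ y ∈ A) {w : X → ℝ} (hw : ∀ x, 0 ≤ w x)
    {wA wB L : ℝ} (hwA : ∀ x ∈ A, w x ≤ wA) (hwB : ∀ x ∈ B, w x ≤ wB) {I S : Finset U}
    (hS : ∀ u, u ∈ S ↔ ∃ v, Y.Adj u v) (hI : ∀ u, u ∈ I ↔ u ∉ S)
    (hL0 : 0 ≤ L) (hL : ∀ i j, i < Y.edgeSet.ncard → j < Y.edgeSet.ncard → i + j = S.card →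
      wA ^ i * wB ^ j ≤ L) :
    (Fintype.card X : ℝ) ^ I.card * copyWeight Y G w ≤
      (∑ x, w x) ^ I.card * L * copyOnCount Y G S := by
  have hIS : Disjoint I S := disjoint_left.mpr fun u hu => (hI u).mp hu
  have hIS' : I ∪ S = univ := by
    ext u; simp only [mem_union, hI, mem_univ, iff_true]; tauto
  have hAB : ∀ x, x ∈ A → x ∉ B := fun x h h' => disjoint_left.mp hdis h h'
  have key : ∀ Φ : U → X, (if IsCopyOn Y G univ Φ then ∏ u, w (Φ u) else 0) ≤
      L * if IsCopyOn Y G S Φ then ∏ u ∈ I, w (Φ u) else 0 := by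
    intro Φ
    by_cases hΦ : IsCopyOn Y G univ Φ
    · have hΦS : IsCopyOn Y G S Φ := hΦ.mono (subset_univ S)
      rw [if_pos hΦ, if_pos hΦS, ← hIS', prod_union hIS, mul_comm]
      refine mul_le_mul_of_nonneg_right ?_ (prod_nonneg fun u _ => hw _)
      have hhom : ∀ u v, Y.Adj u v → G.Adj (Φ u) (Φ v) := fun u v h =>
        hΦ.2 u (mem_univ _) v (mem_univ _) h
      -- A copy splits the non-isolated vertices of `Y` according to the side they land on. Both
      -- classes meet every edge exactly once, so each is smaller than the number of edges.
      set SA := S.filter fun u => Φ u ∈ A with hSA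
      set SB := S.filter fun u => ¬ Φ u ∈ A with hSB
      have hSmem : ∀ u ∈ S, Φ u ∈ A ∨ Φ u ∈ B := fun u hu => by
        obtain ⟨v, hv⟩ := (hS u).mp hu
        rcases hadj _ _ (hhom u v hv) with h | h
        · exact Or.inl h.1
        · exact Or.inr h.1
      have hsplit : ∀ u v, Y.Adj u v → (Φ u ∈ A ↔ Φ v ∉ A) := fun u v h => by
        rcases hadj _ _ (hhom u v h) with h | h
        · exact ⟨fun _ h' => hAB _ h' h.2, fun _ => h.1⟩
        · exact ⟨fun h' => absurd h.1 (hAB _ h'), fun h' => absurd h.2 h'⟩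
      have hnon : ∀ u v, Y.Adj u v → u ∈ S := fun u v h => (hS u).mpr ⟨v, h⟩
      have hi : SA.card < Y.edgeSet.ncard := by
        refine card_lt_ncard_edgeSet_of_split (fun u v h => ?_)
          (fun u hu => (hS u).mp (mem_filter.mp hu).1) hY
        have := hsplit u v h
        simp only [hSA, mem_filter, hnon u v h, hnon v u h.symm, true_and]
        exact this
      have hj : SB.card < Y.edgeSet.ncard := by
        refine card_lt_ncard_edgeSet_of_split (fun u v h => ?_)
          (fun u hu => (hS u).mp (mem_filter.mp hu).1) hY
        have := hsplit u v h
        simp only [hSB, mem_filter, hnon u v h, hnon v u h.symm, true_and]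
        tauto
      refine le_trans ?_ (hL SA.card SB.card hi hj (card_filter_add_card_filter_not _))
      rw [← prod_filter_mul_prod_filter_not S fun u => Φ u ∈ A]
      refine mul_le_mul ?_ ?_ (prod_nonneg fun u _ => hw _) ?_
      · rw [← prod_const]
        exact prod_le_prod (fun u _ => hw _) fun u hu => hwA _ (mem_filter.mp hu).2
      · rw [← prod_const]
        exact prod_le_prod (fun u _ => hw _) fun u hu =>
          hwB _ ((hSmem u (mem_filter.mp hu).1).resolve_left (mem_filter.mp hu).2)
      · rw [← prod_const]
        exact (prod_nonneg fun u _ => hw (Φ u)).trans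
          (prod_le_prod (fun u _ => hw _) fun u hu => hwA _ (mem_filter.mp hu).2)
    · rw [if_neg hΦ]
      refine mul_nonneg hL0 ?_
      split_ifs
      · exact prod_nonneg fun u _ => hw _
      · exact le_rfl
  unfold copyWeight
  calc _ ≤ (Fintype.card X : ℝ) ^ I.card *
        (L * ∑ Φ : U → X, if IsCopyOn Y G S Φ then ∏ u ∈ I, w (Φ u) else 0) := by
        rw [mul_sum _ _ L]
        exact mul_le_mul_of_nonneg_left (sum_le_sum fun Φ _ => key Φ) (by positivity)
    _ = L * ((Fintype.card X : ℝ) ^ I.card *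
        ∑ Φ : U → X, if IsCopyOn Y G S Φ then ∏ u ∈ I, w (Φ u) else 0) := by ring
    _ = _ := by rw [card_pow_mul_sum_copyOn Y G w I S hIS]; ring

end WeightToCountSplit

/-! ### Choosing the number of blocks, and consequences of maximal density. -/

section Scale
open Real

/-- The numbers of blocks into which both sides of a dense bipartite graph can be split. -/
lemma exists_scale {ρ x A q K C δ : ℝ} {l f : ℕ} (hρ0 : 0 < ρ) (hρ1 : ρ ≤ 1) (hx0 : 0 < x)
    (hx1 : x ≤ 1) (hK : 1 ≤ K) (hf : 1 ≤ f) (hfl : f + 1 ≤ l) (hq : 0 < q)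
    (hδ : δ = x / ((l : ℝ) - 1 + (1 - f) * x))
    (hC : (K * (2 ^ (l - 1) * (64 * max A 1) ^ (((l - 1 : ℕ) : ℝ) / x))) ^ δ ≤ C)
    (hρq : C ≤ ρ * q ^ δ) :
    ∃ m : ℕ, 0 < m ∧ 64 * A ≤ ρ * (m : ℝ) ^ x ∧ K * (ρ ^ (f - 1) * (m : ℝ) ^ (l - 1)) ≤ q ∧
      (m : ℝ) ≤ q := by
  obtain ⟨f, rfl⟩ : ∃ k, f = k + 1 := ⟨f - 1, by omega⟩
  obtain ⟨d, rfl⟩ : ∃ d, l = f + 2 + d := ⟨l - (f + 2), by omega⟩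
  have e1 : f + 2 + d - 1 = f + 1 + d := by omega
  rw [e1] at hC
  simp only [e1, Nat.add_sub_cancel]
  set a := 64 * max A 1 with ha
  have ha64 : 64 ≤ a := by have := le_max_right A 1; linarith
  have ha0 : 0 < a := by linarith
  have hu1 : 1 ≤ a / ρ := by rw [le_div_iff₀ hρ0]; linarith
  -- Essentially the smallest scale with `ρ u^x ≥ 64A`. Using `max A 1` in `a` also forces `ρ u ≥
  -- 1`.
  set u := (a / ρ) ^ (1 / x) with hu
  have hxinv : 1 ≤ 1 / x := by rw [le_div_iff₀ hx0]; linarith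
  have hau : a / ρ ≤ u := by
    calc a / ρ = (a / ρ) ^ (1 : ℝ) := (rpow_one _).symm
      _ ≤ u := rpow_le_rpow_of_exponent_le hu1 hxinv
  have hu0 : 1 ≤ u := hu1.trans hau
  set m := ⌈u⌉₊ with hm
  have hmu : u ≤ m := Nat.le_ceil u
  have hm2 : (m : ℝ) ≤ 2 * u := by
    have := (Nat.ceil_lt_add_one (by linarith : 0 ≤ u)).le
    linarith
  have hm0 : 0 < m := by
    have : (0 : ℝ) < m := by linarith
    exact_mod_cast this
  have hux : u ^ x = a / ρ := by
    rw [hu, ← rpow_mul (by linarith), one_div_mul_cancel hx0.ne', rpow_one]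
  have hD : ((f + 2 + d : ℕ) : ℝ) - 1 + (1 - ((f + 1 : ℕ) : ℝ)) * x = (f + 1 + d) - f * x := by
    push_cast; ring
  have hDpos : (0 : ℝ) < (f + 1 + d) - f * x := by
    have : (f : ℝ) * x ≤ f := by
      have : (0 : ℝ) ≤ f := by positivity
      nlinarith
    have : (0 : ℝ) ≤ d := by positivity
    linarith
  rw [hD] at hδ
  have hδ0 : 0 < δ := hδ ▸ div_pos hx0 hDpos
  have hmain : K * (ρ ^ f * (m : ℝ) ^ (f + 1 + d)) ≤ q := by
    -- With `m` about `ρ^(-1/x)`, the exponent of `ρ` is `(f-1) - (l-1)/x = -1/δ` in the original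
    -- `f` and `l`. This is why `δ` has its form, and `C ≤ ρ q^δ` bounds `ρ^(-1/δ)` by a multiple of
    -- `q`.
    have h1 : ρ ^ f * (m : ℝ) ^ (f + 1 + d) ≤
        2 ^ (f + 1 + d) * a ^ (((f + 1 + d : ℕ) : ℝ) / x) * ρ ^ (-(1 / δ)) := by
      calc _ ≤ ρ ^ f * (2 * u) ^ (f + 1 + d) := by gcongr
        _ = 2 ^ (f + 1 + d) * (ρ ^ f * u ^ (f + 1 + d)) := by rw [mul_pow]; ring
        _ = 2 ^ (f + 1 + d) * (a ^ (((f + 1 + d : ℕ) : ℝ) / x) * ρ ^ (-(1 / δ))) := by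
          congr 1
          rw [hu, ← rpow_natCast ((a / ρ) ^ (1 / x)), ← rpow_mul (by positivity),
            div_rpow ha0.le hρ0.le, ← rpow_natCast ρ, one_div_mul_eq_div, mul_div_left_comm,
            ← rpow_sub hρ0]
          congr 2
          rw [hδ]
          field_simp
          push_cast
          ring
        _ = _ := by ring
    have h2 : K * (2 ^ (f + 1 + d) * a ^ (((f + 1 + d : ℕ) : ℝ) / x)) * ρ ^ (-(1 / δ)) ≤ q := by
      have h3 : (K * (2 ^ (f + 1 + d) * a ^ (((f + 1 + d : ℕ) : ℝ) / x)) * ρ ^ (-(1 / δ))) ^ δ ≤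
          q ^ δ := by
        rw [mul_rpow (by positivity) (by positivity), ← rpow_mul hρ0.le, neg_mul,
          one_div_mul_cancel hδ0.ne', rpow_neg_one, ← div_eq_mul_inv, div_le_iff₀ hρ0]
        linarith
      exact (rpow_le_rpow_iff (by positivity) hq.le hδ0).mp h3
    calc _ ≤ K * (2 ^ (f + 1 + d) * a ^ (((f + 1 + d : ℕ) : ℝ) / x) * ρ ^ (-(1 / δ))) := by gcongr
      _ = K * (2 ^ (f + 1 + d) * a ^ (((f + 1 + d : ℕ) : ℝ) / x)) * ρ ^ (-(1 / δ)) := by ring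
      _ ≤ q := h2
  refine ⟨m, hm0, ?_, hmain, ?_⟩
  · have h1 : u ^ x ≤ (m : ℝ) ^ x := rpow_le_rpow (by linarith) hmu hx0.le
    rw [hux, div_le_iff₀ hρ0] at h1
    have := le_max_left A 1
    nlinarith
  · refine le_trans ?_ hmain
    have h1 : 1 ≤ ρ * m := by
      have h2 := hau.trans hmu
      rw [div_le_iff₀ hρ0] at h2
      nlinarith
    have hm1 : (1 : ℝ) ≤ m := by exact_mod_cast hm0
    calc (m : ℝ) = 1 * (1 ^ f * (m * 1 ^ d)) := by ring
      _ ≤ K * ((ρ * m) ^ f * (m * m ^ d)) := by gcongr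
      _ = _ := by rw [mul_pow]; ring

/-- Consequences of the maximality of a pair of sets of relative sizes `u` and `v`. -/
lemma density_pow_le {p ρ u v : ℝ} {N E : ℕ} (hN : 1 ≤ N) (hu0 : 0 < u) (hu1 : u ≤ 1) (hv0 : 0 < v)
    (hv1 : v ≤ 1) (hp : 0 ≤ p) (hρ : 0 ≤ ρ) (h : p * (u * v) ^ (1 / (N : ℝ)) ≤ 4 * ρ * (u * v))
    (hE : E ≤ N) {i j : ℕ} (hi : i < E) (hj : j < E) :
    (p / 4) ^ E ≤ ρ ^ E * (u ^ i * v ^ j) := by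
  have huv0 : 0 < u * v := mul_pos hu0 hv0
  have huv1 : u * v ≤ 1 := mul_le_one₀ hu1 hv0.le hv1
  have hN0 : (0 : ℝ) < N := by exact_mod_cast hN
  -- Since `E ≤ N` and `uv ≤ 1`, one has `(uv)^(E/N) ≥ uv`. Cancelling `uv` leaves the power `E-1`,
  -- which suffices because `i, j ≤ E-1`.
  have h1 : (p / 4) ^ E * (u * v) ≤ ρ ^ E * (u * v) ^ E := by
    calc (p / 4) ^ E * (u * v) ≤ (p / 4) ^ E * ((u * v) ^ (1 / (N : ℝ))) ^ E := by
          gcongr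
          rw [← rpow_natCast, ← rpow_mul huv0.le]
          nth_rewrite 1 [← rpow_one (u * v)]
          apply rpow_le_rpow_of_exponent_ge huv0 huv1
          rw [one_div_mul_eq_div, div_le_one hN0]
          exact_mod_cast hE
      _ = (p * (u * v) ^ (1 / (N : ℝ)) / 4) ^ E := by rw [← mul_pow]; ring
      _ ≤ (ρ * (u * v)) ^ E := by
          gcongr
          linarith
      _ = _ := mul_pow _ _ _
  obtain ⟨k, rfl⟩ : ∃ k, E = k + 1 := ⟨E - 1, by omega⟩
  have h2 : (p / 4) ^ (k + 1) ≤ ρ ^ (k + 1) * (u * v) ^ k := by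
    rw [pow_succ (u * v), ← mul_assoc (ρ ^ (k + 1))] at h1
    exact le_of_mul_le_mul_right h1 huv0
  refine h2.trans ?_
  rw [mul_pow]
  have h3 : u ^ k ≤ u ^ i := pow_le_pow_of_le_one hu0.le hu1 (by omega)
  have h4 : v ^ k ≤ v ^ j := pow_le_pow_of_le_one hv0.le hv1 (by omega)
  gcongr

/-- Used with `u` the relative size of either side: if `p n^δ` is large, then so is `ρ q^δ` for a
side of size `q`, however small. This is where `δ ≤ 1 - 1/N` enters. -/
lemma density_le_mul_rpow {p ρ u v δ : ℝ} {N : ℕ} (hu0 : 0 < u) (hu1 : u ≤ 1)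
    (hv0 : 0 < v) (hv1 : v ≤ 1) (hρ : 0 ≤ ρ)
    (h : p * (u * v) ^ (1 / (N : ℝ)) ≤ 4 * ρ * (u * v)) (hN : 1 ≤ N) (hδ : δ ≤ 1 - 1 / N) :
    p ≤ 4 * (ρ * u ^ δ) := by
  have huv0 : 0 < u * v := mul_pos hu0 hv0
  have hN0 : (1 : ℝ) ≤ N := by exact_mod_cast hN
  have hN1 : 1 / (N : ℝ) ≤ 1 := by rw [div_le_one (by linarith)]; exact hN0
  have h1 : p ≤ 4 * ρ * (u * v) ^ (1 - 1 / (N : ℝ)) := by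
    rw [rpow_sub huv0, rpow_one, mul_div_assoc', le_div_iff₀ (by positivity)]
    exact h
  refine h1.trans ?_
  rw [mul_assoc, mul_rpow hu0.le hv0.le]
  have h2 : u ^ (1 - 1 / (N : ℝ)) ≤ u ^ δ := rpow_le_rpow_of_exponent_ge hu0 hu1 hδ
  have h3 : v ^ (1 - 1 / (N : ℝ)) ≤ 1 := rpow_le_one hv0.le hv1 (by linarith)
  have h4 : 0 ≤ u ^ (1 - 1 / (N : ℝ)) := by positivity
  have h5 : u ^ (1 - 1 / (N : ℝ)) * v ^ (1 - 1 / (N : ℝ)) ≤ u ^ δ * 1 := by gcongr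
  rw [mul_one] at h5
  gcongr

end Scale

/-! ### Balanced blocks on both sides and the resulting weights. -/

section BalancedWeight
open Classical Finset

/-- The two sides of a bipartite graph can be split into `m` blocks each, of nearly equal sizes. -/
lemma exists_balanced_blocks {X : Type*} [Fintype X] {G : SimpleGraph X} {A B : Finset X}
    (hdis : Disjoint A B) (hadj : ∀ x y, G.Adj x y → x ∈ A ∧ y ∈ B ∨ x ∈ B ∧ y ∈ A) {m : ℕ}
    (hm : 0 < m) (hmA : m ≤ A.card) (hmB : m ≤ B.card) :
    ∃ b : X → Fin (m + m), (∀ i, (block (A ∪ B) b i).Nonempty) ∧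
      (∀ x y, G.Adj x y → b x ≠ b y) ∧
      (∀ x ∈ A, (m : ℝ) / (2 * A.card) ≤ blockWeight (A ∪ B) b x ∧
        blockWeight (A ∪ B) b x ≤ 2 * m / A.card) ∧
      (∀ x ∈ B, (m : ℝ) / (2 * B.card) ≤ blockWeight (A ∪ B) b x ∧
        blockWeight (A ∪ B) b x ≤ 2 * m / B.card) := by
  obtain ⟨cA, hcA⟩ := exists_balanced_colouring A hm hmA
  obtain ⟨cB, hcB⟩ := exists_balanced_colouring B hm hmB
  set b : X → Fin (m + m) := fun x => if x ∈ A then Fin.castAdd m (cA x) else Fin.natAdd m (cB x)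
    with hb
  have hAB : ∀ x, x ∈ B → x ∉ A := fun x h h' => disjoint_left.mp hdis h' h
  have hne : ∀ i j : Fin m, Fin.castAdd m i ≠ Fin.natAdd m j := fun i j h => by
    have := congrArg Fin.val h
    simp at this
    omega
  have hblA : ∀ i, block (A ∪ B) b (Fin.castAdd m i) = A.filter fun x => cA x = i := by
    intro i
    ext x
    simp only [block, mem_filter, mem_union, hb]
    by_cases hx : x ∈ A
    · simp [hx]
    · have h1 := (hne i (cB x)).symm
      simp only [hx, if_false, h1, and_false, false_and]
  have hblB : ∀ i, block (A ∪ B) b (Fin.natAdd m i) = B.filter fun x => cB x = i := by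
    intro i
    ext x
    simp only [block, mem_filter, mem_union, hb]
    by_cases hx : x ∈ A
    · have := disjoint_left.mp hdis hx
      simp only [hx, if_true, hne, and_false, this, false_and]
    · simp [hx]
  have hA0 : 0 < A.card := hm.trans_le hmA
  have hB0 : 0 < B.card := hm.trans_le hmB
  have hbound : ∀ a k : ℕ, 0 < a → a ≤ 2 * m * k → m * k ≤ 2 * a →
      (m : ℝ) / (2 * a) ≤ 1 / (k : ℝ) ∧ 1 / (k : ℝ) ≤ 2 * m / a := by
    intro a k ha h1 h2
    have hk : 0 < k := by
      rcases Nat.eq_zero_or_pos k with h | h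
      · subst h; omega
      · exact h
    have ha' : (0 : ℝ) < a := by exact_mod_cast ha
    have hk' : (0 : ℝ) < k := by exact_mod_cast hk
    constructor
    · rw [div_le_div_iff₀ (by positivity) hk']
      have : (m : ℝ) * k ≤ 2 * a := by exact_mod_cast h2
      linarith
    · rw [div_le_div_iff₀ hk' ha']
      have : (a : ℝ) ≤ 2 * m * k := by exact_mod_cast h1
      linarith
  refine ⟨b, fun i => ?_, fun x y h => ?_, fun x hx => ?_, fun x hx => ?_⟩
  · refine Fin.addCases (fun i => ?_) (fun i => ?_) i
    · rw [hblA, ← card_pos]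
      by_contra h0
      have := (hcA i).1
      rw [Nat.eq_zero_of_not_pos h0] at this
      omega
    · rw [hblB, ← card_pos]
      by_contra h0
      have := (hcB i).1
      rw [Nat.eq_zero_of_not_pos h0] at this
      omega
  · rcases hadj x y h with h | h
    · simp only [hb, if_pos h.1, if_neg (hAB _ h.2)]
      exact hne _ _
    · simp only [hb, if_pos h.2, if_neg (hAB _ h.1)]
      exact (hne _ _).symm
  · have hbx : b x = Fin.castAdd m (cA x) := if_pos hx
    rw [blockWeight, if_pos (mem_union_left _ hx), hbx, hblA]
    exact hbound _ _ hA0 (hcA _).1 (hcA _).2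
  · have hbx : b x = Fin.natAdd m (cB x) := if_neg (hAB x hx)
    rw [blockWeight, if_pos (mem_union_right _ hx), hbx, hblB]
    exact hbound _ _ hB0 (hcB _).1 (hcB _).2

/-- The double sum runs over ordered pairs, so each edge between the disjoint sides occurs twice. -/
lemma two_mul_crossPairs_mul_le {X : Type*} [Fintype X] {G : SimpleGraph X} {A B : Finset X}
    (hdis : Disjoint A B) {w : X → ℝ} (hw : ∀ x, 0 ≤ w x) {wA wB : ℝ}
    (hwB0 : 0 ≤ wB) (hwA : ∀ x ∈ A, wA ≤ w x) (hwB : ∀ x ∈ B, wB ≤ w x) :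
    2 * crossPairs G A B * (wA * wB) ≤ ∑ x, ∑ y, if G.Adj x y then w x * w y else 0 := by
  have h0 : ∀ x y, 0 ≤ if G.Adj x y then w x * w y else 0 := fun x y => by
    split_ifs
    · exact mul_nonneg (hw x) (hw y)
    · exact le_rfl
  have h1 : crossPairs G A B * (wA * wB) ≤ ∑ x ∈ A, ∑ y ∈ B, if G.Adj x y then w x * w y else 0 := by
    unfold crossPairs
    push_cast
    rw [sum_mul]
    refine sum_le_sum fun x hx => ?_
    rw [sum_mul]
    refine sum_le_sum fun y hy => ?_
    split_ifs
    · rw [one_mul]; exact mul_le_mul (hwA x hx) (hwB y hy) hwB0 (hw x)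
    · simp
  have h2 : ∀ A B : Finset X, ∑ x ∈ A, ∑ y ∈ B, (if G.Adj x y then w x * w y else 0) ≤
      ∑ x ∈ A, ∑ y, if G.Adj x y then w x * w y else 0 := fun A B =>
    sum_le_sum fun x _ => sum_le_sum_of_subset_of_nonneg (subset_univ _) fun y _ _ => h0 x y
  have h3 : ∑ x ∈ A, ∑ y ∈ B, (if G.Adj x y then w x * w y else 0) =
      ∑ x ∈ B, ∑ y ∈ A, if G.Adj x y then w x * w y else 0 := by
    rw [sum_comm]
    refine sum_congr rfl fun x _ => sum_congr rfl fun y _ => ?_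
    rw [mul_comm (w y)]
    exact if_congr (G.adj_comm y x) rfl rfl
  calc _ = crossPairs G A B * (wA * wB) + crossPairs G A B * (wA * wB) := by ring
    _ ≤ (∑ x ∈ A, ∑ y, if G.Adj x y then w x * w y else 0) +
        ∑ x ∈ B, ∑ y, if G.Adj x y then w x * w y else 0 :=
      add_le_add (h1.trans (h2 A B)) ((h1.trans h3.le).trans (h2 B A))
    _ = ∑ x ∈ A ∪ B, ∑ y, if G.Adj x y then w x * w y else 0 := (sum_union hdis).symm
    _ ≤ _ := sum_le_sum_of_subset_of_nonneg (subset_univ _) fun x _ _ =>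
      sum_nonneg fun y _ => h0 x y

lemma sum_adj_weight_le {X : Type*} [Fintype X] {G : SimpleGraph X} {w : X → ℝ} {x : X} {c d : ℝ}
    (hc : 0 ≤ c) (hw : ∀ y, G.Adj x y → w y ≤ c) (hd : ((univ.filter (G.Adj x)).card : ℝ) ≤ d) :
    (∑ y, if G.Adj x y then w y else 0) ≤ d * c := by
  rw [← sum_filter]
  calc _ ≤ ∑ y ∈ univ.filter (G.Adj x), c := sum_le_sum fun y hy => hw y (mem_filter.mp hy).2
    _ = (univ.filter (G.Adj x)).card * c := by rw [sum_const, nsmul_eq_mul]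
    _ ≤ d * c := by gcongr

end BalancedWeight

/-! ### The weighted count in a nearly biregular bipartite host. -/

section BiregularHost
open Classical Finset

/-- Bookkeeping with `ℓ = f + d`, `h = ℓ + k`, `e(H) = f + g` and `s = r + 1`: it extracts the
factor `Q^(s-1)` that convexity puts on the other side, so that it can be cancelled. -/
lemma sampling_identity {η m ρ κ : ℝ} (hκ : κ ≠ 0) (d k f g r : ℕ) :
    (η * (2 * m) ^ (f + d + k) * (ρ / 64) ^ (f + g)) ^ (r + 1) =
      ((2 * m) ^ d * (κ * ρ * m) ^ f) ^ r *
        (2 ^ ((f + d + k) * (r + 1)) / (64 ^ ((f + g) * (r + 1)) * (2 ^ d * κ ^ f) ^ r) *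
          η ^ (r + 1) * m ^ (f + d + (r + 1) * k) * ρ ^ (f + (r + 1) * g)) := by
  have h1 : ((2 * m) ^ d * (κ * ρ * m) ^ f) ^ r =
      (2 ^ d * κ ^ f) ^ r * (m ^ ((f + d) * r) * ρ ^ (f * r)) := by
    simp only [mul_pow, ← pow_mul]; ring
  rw [h1]
  have h2 : ∀ P Q R S T W : ℝ, P ≠ 0 → P * Q * (R / (S * P) * T * W) = Q * (R / S * T * W) := by
    intro P Q R S T W hP
    field_simp
  have h3 : ((2 : ℝ) ^ d * κ ^ f) ^ r ≠ 0 := by positivity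
  rw [mul_assoc (2 ^ _ / _ * _), h2 _ _ _ _ _ _ h3]
  simp only [mul_pow, div_pow, ← pow_mul]
  ring

/-- The requirement that spoiled copies remove few edges, with `Q = (2m)^d (κρm)^f`, vertex weights
at most `2m/q` and edge weight `ρm²/2`. It explains the constant passed to `exists_scale`. -/
lemma sampling_bound {m ρ κ q t : ℝ} (hm : 0 < m) (hρ : 0 < ρ) (hκ : 0 < κ) (hq : 0 < q)
    {f d : ℕ} (hf : 1 ≤ f) (hd : 1 ≤ d)
    (h : 16 * (t + 1) * 2 ^ d * κ ^ f * (ρ ^ (f - 1) * m ^ (f + d - 1)) ≤ q) :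
    4 * ((2 * m) ^ d * (κ * ρ * m) ^ f * (t * (2 * m / q))) ≤ ρ * m ^ 2 / 2 := by
  obtain ⟨f, rfl⟩ : ∃ k, f = k + 1 := ⟨f - 1, by omega⟩
  obtain ⟨d, rfl⟩ : ∃ k, d = k + 1 := ⟨d - 1, by omega⟩
  rw [Nat.add_sub_cancel, (by omega : f + 1 + (d + 1) - 1 = f + d + 1)] at h
  have h1 : 4 * ((2 * m) ^ (d + 1) * (κ * ρ * m) ^ (f + 1) * (t * (2 * m / q))) =
      16 * t * 2 ^ (d + 1) * κ ^ (f + 1) * (ρ ^ f * m ^ (f + d + 1)) / q * (ρ * m ^ 2 / 2) := by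
    field_simp
    ring
  rw [h1]
  have h2 : 16 * t * 2 ^ (d + 1) * κ ^ (f + 1) * (ρ ^ f * m ^ (f + d + 1)) / q ≤ 1 := by
    rw [div_le_one hq]
    refine le_trans ?_ h
    gcongr
    linarith
  have h3 : 0 ≤ ρ * m ^ 2 / 2 := by positivity
  nlinarith

/-- The constant in the lower bound for the weighted number of copies of the glued graph. -/
noncomputable def gluedConstant (h e f l s : ℕ) (κ : ℝ) : ℝ :=
  2 ^ (h * s) / (64 ^ (e * s) * (2 ^ (l - f) * κ ^ f) ^ (s - 1))

lemma gluedConstant_pos (h e f l s : ℕ) {κ : ℝ} (hκ : 0 < κ) : 0 < gluedConstant h e f l s κ := by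
  unfold gluedConstant
  positivity

lemma sum_hom_coe_le {V X : Type*} [Fintype V] [Fintype X] {H : SimpleGraph V}
    (F : H.Subgraph) (hF : IsSparse F.coe) (G : SimpleGraph X) (w : X → ℝ) (hw : ∀ x, 0 ≤ w x)
    {D : ℝ} (hD0 : 0 ≤ D) (hD : ∀ x, (∑ y, if G.Adj x y then w y else 0) ≤ D)
    (hfl : F.edgeSet.ncard ≤ F.verts.ncard) (hsum : 0 < ∑ x, w x) :
    ∑ φ : F.verts → X, (∏ u, w (φ u)) * (if ∀ u ∈ (univ : Finset F.verts),
      ∀ v ∈ (univ : Finset F.verts), F.coe.Adj u v → G.Adj (φ u) (φ v) then 1 else 0) ≤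
      (∑ x, w x) ^ (F.verts.ncard - F.edgeSet.ncard) * D ^ F.edgeSet.ncard := by
  have h1 := hF.sum_hom_mul_pow_le G w hw D hD0 hD univ F.edgeSet.ncard (by
    rw [adjPairs_univ, ncard_edgeSet_coe])
  have hcardl : Fintype.card F.verts = F.verts.ncard := by
    rw [← Nat.card_coe_set_eq, Nat.card_eq_fintype_card]
  have h2 : (∑ x, w x) ^ F.verts.ncard * D ^ F.edgeSet.ncard =
      (∑ x, w x) ^ (F.verts.ncard - F.edgeSet.ncard) * D ^ F.edgeSet.ncard *
        (∑ x, w x) ^ F.edgeSet.ncard := by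
    rw [mul_right_comm, ← pow_add, Nat.sub_add_cancel hfl]
  rw [hcardl, h2] at h1
  refine le_of_mul_le_mul_right (le_trans (le_of_eq ?_) h1) (pow_pos hsum _)
  congr!

set_option maxHeartbeats 1000000 in
/-- A bipartite graph with nearly equal degrees on either side carries a weight for which the
weighted number of copies of the glued graph is large. -/
lemma exists_weight_gluedGraph {V X : Type*} [Fintype V] [Fintype X] {H : SimpleGraph V}
    (F : H.Subgraph) (hF : IsSparse F.coe) (hf : 0 < F.edgeSet.ncard)
    (hfe : F.edgeSet.ncard < H.edgeSet.ncard) (hfl : F.edgeSet.ncard + 1 ≤ F.verts.ncard)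
    {s : ℕ} (hs : 1 ≤ s) {α A₀ η : ℝ} (hα0 : 0 ≤ α) (hα1 : α < 1) (hη : 0 ≤ η)
    (hH : IsErdosSimonovitsGood H α A₀ η) {G : SimpleGraph X} {A B : Finset X}
    (hdis : Disjoint A B) (hadj : ∀ x y, G.Adj x y → x ∈ A ∧ y ∈ B ∨ x ∈ B ∧ y ∈ A)
    (hG : 0 < crossPairs G A B) {K₁ : ℕ} (hK₁ : 1 ≤ K₁)
    (hdA : ∀ x ∈ A, (univ.filter (G.Adj x)).card * A.card ≤ K₁ * crossPairs G A B)
    (hdB : ∀ x ∈ B, (univ.filter (G.Adj x)).card * B.card ≤ K₁ * crossPairs G A B)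
    {ρ δ C : ℝ} (hρe : (crossPairs G A B : ℝ) = ρ * (A.card * B.card))
    (hδ : δ = (1 - α) / ((F.verts.ncard : ℝ) - 1 + (1 - F.edgeSet.ncard) * (1 - α)))
    (hC : (16 * ((((s - 1) * (F.verts)ᶜ.ncard : ℕ) : ℝ) + 1) *
      2 ^ (F.verts.ncard - F.edgeSet.ncard) * (2 * K₁ : ℝ) ^ F.edgeSet.ncard *
      (2 ^ (F.verts.ncard - 1) * (64 * max A₀ 1) ^ (((F.verts.ncard - 1 : ℕ) : ℝ) / (1 - α)))) ^ δ
      ≤ C) (hCA : C ≤ ρ * (A.card : ℝ) ^ δ) (hCB : C ≤ ρ * (B.card : ℝ) ^ δ) :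
    ∃ (m : ℝ) (w : X → ℝ), 0 < m ∧ (∀ x, 0 ≤ w x) ∧ ∑ x, w x = 2 * m ∧
      (∀ x ∈ A, w x ≤ 2 * m / A.card) ∧ (∀ x ∈ B, w x ≤ 2 * m / B.card) ∧
      gluedConstant (Fintype.card V) H.edgeSet.ncard F.edgeSet.ncard F.verts.ncard s (2 * K₁) *
        η ^ s * m ^ (F.verts.ncard + s * (F.verts)ᶜ.ncard) *
        ρ ^ (F.edgeSet.ncard + s * (H.edgeSet.ncard - F.edgeSet.ncard)) ≤
      copyWeight (gluedGraph H F s) G w := by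
  have hA : 0 < A.card := by
    by_contra h
    simp [card_eq_zero.mp (Nat.eq_zero_of_not_pos h), crossPairs] at hG
  have hB : 0 < B.card := by
    by_contra h
    simp [card_eq_zero.mp (Nat.eq_zero_of_not_pos h), crossPairs] at hG
  have hA' : (0 : ℝ) < A.card := by exact_mod_cast hA
  have hB' : (0 : ℝ) < B.card := by exact_mod_cast hB
  have hG' : (0 : ℝ) < crossPairs G A B := by exact_mod_cast hG
  have hK₁' : (1 : ℝ) ≤ K₁ := by exact_mod_cast hK₁
  have hρ0 : 0 < ρ := by
    rw [hρe] at hG'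
    exact (pos_iff_pos_of_mul_pos hG').mpr (mul_pos hA' hB')
  have hρ1 : ρ ≤ 1 := by
    refine le_of_mul_le_mul_right ?_ (mul_pos hA' hB')
    rw [← hρe, one_mul]
    have : crossPairs G A B ≤ A.card * B.card := by
      unfold crossPairs
      calc _ ≤ ∑ x ∈ A, ∑ y ∈ B, 1 := sum_le_sum fun x _ => sum_le_sum fun y _ => by
              split_ifs <;> simp
        _ = _ := by simp
    exact_mod_cast this
  set q : ℝ := min (A.card : ℝ) B.card with hq
  have hq0 : 0 < q := lt_min hA' hB'
  have hCq : C ≤ ρ * q ^ δ := by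
    rcases min_choice (A.card : ℝ) B.card with h | h <;> rw [hq, h] <;> assumption
  set f := F.edgeSet.ncard with hfdef
  set l := F.verts.ncard with hldef
  set e := H.edgeSet.ncard with hedef
  set k := (F.verts)ᶜ.ncard with hkdef
  set t : ℝ := (((s - 1) * k : ℕ) : ℝ) with ht
  have ht0 : 0 ≤ t := Nat.cast_nonneg _
  have hcardl : Fintype.card F.verts = l := by rw [hldef, ← Nat.card_coe_set_eq, Nat.card_eq_fintype_card]
  have hcardk : Fintype.card ↥(F.verts)ᶜ = k := by
    rw [hkdef, ← Nat.card_coe_set_eq, Nat.card_eq_fintype_card]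
  have hcardV : Fintype.card V = l + k := by
    rw [hldef, hkdef, Set.ncard_add_ncard_compl, Nat.card_eq_fintype_card]
  obtain ⟨m, hm0, hmA, hmK, hmq⟩ := exists_scale (A := A₀) (f := f) (l := l)
    (K := 16 * (t + 1) * 2 ^ (l - f) * (2 * K₁ : ℝ) ^ f) hρ0 hρ1
    (by linarith : 0 < 1 - α) (by linarith : 1 - α ≤ 1) (by
      have h1 : (1 : ℝ) ≤ 2 ^ (l - f) := one_le_pow₀ (by norm_num)
      have h2 : (1 : ℝ) ≤ (2 * K₁ : ℝ) ^ f := one_le_pow₀ (by linarith)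
      calc (1 : ℝ) = 1 * 1 * 1 := by norm_num
        _ ≤ _ := by gcongr; linarith) hf hfl hq0 hδ hC hCq
  have hmA' : m ≤ A.card := by exact_mod_cast hmq.trans (min_le_left _ _)
  have hmB' : m ≤ B.card := by exact_mod_cast hmq.trans (min_le_right _ _)
  obtain ⟨b, hne, hb, hwA, hwB⟩ := exists_balanced_blocks hdis hadj hm0 hmA' hmB'
  have hm' : (0 : ℝ) < m := by exact_mod_cast hm0
  set w := blockWeight (A ∪ B) b with hw
  have hw0 : ∀ x, 0 ≤ w x := blockWeight_nonneg _ _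
  have hMcast : ((m + m : ℕ) : ℝ) = 2 * m := by push_cast; ring
  have hsum : ∑ x, w x = 2 * m := by rw [hw, sum_blockWeight hne, hMcast]
  have hω : ∀ x, w x ≤ 2 * m / q := by
    intro x
    by_cases hxA : x ∈ A
    · exact (hwA x hxA).2.trans (by gcongr; exact min_le_left _ _)
    by_cases hxB : x ∈ B
    · exact (hwB x hxB).2.trans (by gcongr; exact min_le_right _ _)
    · have : w x = 0 := if_neg (by simp [hxA, hxB])
      rw [this]; positivity
  have hE : ρ * (m : ℝ) ^ 2 / 2 ≤ ∑ x, ∑ y, if G.Adj x y then w x * w y else 0 := by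
    have := two_mul_crossPairs_mul_le (G := G) hdis hw0 (by positivity) (fun x hx => (hwA x hx).1)
      fun x hx => (hwB x hx).1
    refine le_trans (le_of_eq ?_) this
    rw [hρe]
    field_simp
  -- A vertex of `A` has at most `K₁ρ|B|` neighbours, each of weight at most `2m/|B|`, and
  -- symmetrically for `B`. Weighting removes the imbalance of the sides.
  have hD : ∀ x, (∑ y, if G.Adj x y then w y else 0) ≤ 2 * K₁ * ρ * m := by
    intro x
    by_cases hxA : x ∈ A
    · have h1 : ((univ.filter (G.Adj x)).card : ℝ) ≤ K₁ * ρ * B.card := by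
        have : ((univ.filter (G.Adj x)).card : ℝ) * A.card ≤ K₁ * crossPairs G A B := by
          exact_mod_cast hdA x hxA
        rw [hρe] at this
        exact le_of_mul_le_mul_right (by linarith) hA'
      refine (sum_adj_weight_le (c := 2 * m / B.card) (by positivity) (fun y hy => ?_) h1).trans
        (le_of_eq (by field_simp))
      rcases hadj x y hy with h | h
      · exact (hwB y h.2).2
      · exact absurd h.1 (disjoint_left.mp hdis hxA)
    by_cases hxB : x ∈ B
    · have h1 : ((univ.filter (G.Adj x)).card : ℝ) ≤ K₁ * ρ * A.card := by
        have : ((univ.filter (G.Adj x)).card : ℝ) * B.card ≤ K₁ * crossPairs G A B := by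
          exact_mod_cast hdB x hxB
        rw [hρe] at this
        exact le_of_mul_le_mul_right (by linarith) hB'
      refine (sum_adj_weight_le (c := 2 * m / A.card) (by positivity) (fun y hy => ?_) h1).trans
        (le_of_eq (by field_simp))
      rcases hadj x y hy with h | h
      · exact absurd h.1 hxA
      · exact (hwA y h.2).2
    · rw [sum_eq_zero fun y _ => if_neg fun h => ?_]
      · positivity
      · rcases hadj x y h with h | h
        · exact hxA h.1
        · exact hxB h.1
  set Q : ℝ := (2 * m) ^ (l - f) * (2 * K₁ * ρ * m) ^ f with hQdef
  have hQ0 : 0 < Q := by positivity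
  have hQ : ∑ φ : F.verts → X, (∏ u, w (φ u)) * (if ∀ u ∈ univ, ∀ v ∈ univ, F.coe.Adj u v →
      G.Adj (φ u) (φ v) then 1 else 0) ≤ Q := by
    have := sum_hom_coe_le F hF G w hw0 (by positivity : (0 : ℝ) ≤ 2 * K₁ * ρ * m) hD
      (Nat.le_of_succ_le hfl) (by rw [hsum]; positivity)
    rw [hsum] at this
    exact this
  obtain ⟨d, hd⟩ : ∃ d : ℕ, l = f + d := Nat.exists_eq_add_of_le (Nat.le_of_succ_le hfl)
  have hd' : l - f = d := by rw [hd]; exact Nat.add_sub_cancel_left f d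
  have hmain := pow_le_mul_copyWeight_gluedGraph F hf hne hb hη hH (by omega : 0 < e) hs hω
    (div_nonneg (by linarith) hq0.le) hE (by positivity) hQ (by omega) (by
      rw [hcardk]
      refine sampling_bound hm' hρ0 (by positivity) hq0 hf (by omega) ?_
      rw [Nat.add_sub_cancel' (by omega : f ≤ l)]
      exact hmK) (by
      rw [hMcast]
      have h1 : (2 * m : ℝ) ^ (1 + α) ≤ 4 * (m : ℝ) ^ (1 + α) := by
        rw [Real.mul_rpow (by norm_num) hm'.le]
        gcongr
        calc (2 : ℝ) ^ (1 + α) ≤ 2 ^ (2 : ℝ) := by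
              apply Real.rpow_le_rpow_of_exponent_le <;> linarith
          _ = 4 := by norm_num
      have h2 : (m : ℝ) ^ 2 = m ^ (1 + α) * m ^ (1 - α) := by
        rw [← Real.rpow_add hm', ← Real.rpow_natCast]; congr 1; push_cast; ring
      have hA0 : A₀ * (2 * m : ℝ) ^ (1 + α) ≤ max A₀ 0 * (4 * (m : ℝ) ^ (1 + α)) := by
        have := le_max_left A₀ 0
        have := le_max_right A₀ 0
        gcongr
      have hA1 : 64 * max A₀ 0 ≤ ρ * (m : ℝ) ^ (1 - α) := by
        rcases max_choice A₀ 0 with h | h <;> rw [h]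
        · exact hmA
        · rw [mul_zero]; positivity
      refine hA0.trans ?_
      rw [h2]
      have : 0 ≤ (m : ℝ) ^ (1 + α) := by positivity
      nlinarith)
  refine ⟨m, w, hm', hw0, hsum, fun x hx => (hwA x hx).2, fun x hx => (hwB x hx).2, ?_⟩
  obtain ⟨r, rfl⟩ : ∃ r, s = r + 1 := ⟨s - 1, by omega⟩
  obtain ⟨g, hg⟩ : ∃ g : ℕ, e = f + g := Nat.exists_eq_add_of_le hfe.le
  -- The sample has `M = 2m` vertices and edge weight at least `ρm²/2`, so goodness is used at
  -- density `ρ/64`.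
  have hE' : ρ * (m : ℝ) ^ 2 / 2 / (8 * ((m + m : ℕ) : ℝ) ^ 2) = ρ / 64 := by
    rw [hMcast]; field_simp; ring
  rw [hE', hMcast, hcardV, ← hedef, ← hw, Nat.add_sub_cancel, hQdef, hd', hg, hd,
    sampling_identity (κ := 2 * K₁) (by positivity) d k f g r] at hmain
  refine le_of_mul_le_mul_left (le_trans (le_of_eq ?_) hmain) (by positivity :
    0 < ((2 * m : ℝ) ^ d * (2 * K₁ * ρ * m) ^ f) ^ r)
  rw [gluedConstant, hcardV, hg, hd]
  simp only [Nat.add_sub_cancel_left, Nat.add_sub_cancel]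

end BiregularHost

/-! ### Return to the original host graph, and edge counts of the glued graph. -/

section HostGraph
open Classical Finset

/-- A large weighted number of copies yields many copies. -/
lemma le_copyOnCount_of_le_copyWeight {U X : Type*} [Fintype U] [Fintype X] {Y : SimpleGraph U}
    (hY : ¬ IsSparse Y) {G : SimpleGraph X} {A B : Finset X} (hdis : Disjoint A B)
    (hadj : ∀ x y, G.Adj x y → x ∈ A ∧ y ∈ B ∨ x ∈ B ∧ y ∈ A) (hA : 0 < A.card) (hB : 0 < B.card)
    {w : X → ℝ} (hw : ∀ x, 0 ≤ w x) {m ρ p c : ℝ} {E : ℕ} (hm : 0 < m) (hρ : 0 < ρ) (hp : 0 < p)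
    (hsum : ∑ x, w x = 2 * m) (hwA : ∀ x ∈ A, w x ≤ 2 * m / A.card)
    (hwB : ∀ x ∈ B, w x ≤ 2 * m / B.card) (hE : Y.edgeSet.ncard ≤ E)
    (hdens : ∀ i j, i < E → j < E → (p / 4) ^ E ≤ ρ ^ E *
      (((A.card : ℝ) / Fintype.card X) ^ i * ((B.card : ℝ) / Fintype.card X) ^ j))
    (hc : c * m ^ Fintype.card U * ρ ^ E ≤ copyWeight Y G w) (hX : 0 < Fintype.card X)
    (hX2 : 2 * (Fintype.card U : ℝ) ≤ Fintype.card X) :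
    c * (1 / 4) ^ Fintype.card U * (p / 4) ^ E * (Fintype.card X : ℝ) ^ Fintype.card U ≤
      copyOnCount Y G univ := by
  set S : Finset U := univ.filter fun u => ∃ v, Y.Adj u v with hS
  set I : Finset U := univ.filter fun u => ¬ ∃ v, Y.Adj u v with hI
  have hIS : Disjoint I S := (disjoint_filter_filter_not _ _ _).symm
  have hIS' : I ∪ S = univ := by rw [union_comm]; exact filter_union_filter_not_eq _ _
  have hcard : I.card + S.card = Fintype.card U := by
    rw [← card_union_of_disjoint hIS, hIS', card_univ]
  have hA' : (0 : ℝ) < A.card := by exact_mod_cast hA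
  have hB' : (0 : ℝ) < B.card := by exact_mod_cast hB
  have hX' : (0 : ℝ) < Fintype.card X := by exact_mod_cast hX
  generalize hn : (Fintype.card X : ℝ) = n at hdens hX2 hX' ⊢
  -- The chosen `L` bounds `(2m/|A|)^i (2m/|B|)^j` by means of `hdens`. The powers of `m` and `ρ`
  -- then cancel against those in `hc`, leaving the density `p` of the original graph.
  have h1 := card_pow_mul_copyWeight_le hY hdis hadj hw hwA hwB (I := I) (S := S)
    (L := (2 * m) ^ S.card * (ρ ^ E / ((p / 4) ^ E * n ^ S.card)))
    (fun u => by simp [hS]) (fun u => by simp [hI, hS]) (by positivity) (by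
      intro i j hi hj hij
      have h2 := hdens i j (hi.trans_le hE) (hj.trans_le hE)
      rw [← hij, div_pow (2 * m), div_pow (2 * m)]
      have h3 : (2 * m) ^ i / (A.card : ℝ) ^ i * ((2 * m) ^ j / (B.card : ℝ) ^ j) =
          (2 * m) ^ (i + j) * (1 / ((A.card : ℝ) ^ i * (B.card : ℝ) ^ j)) := by
        rw [pow_add]; field_simp
      rw [h3]
      refine mul_le_mul_of_nonneg_left ?_ (by positivity)
      rw [div_le_div_iff₀ (by positivity) (by positivity), one_mul]
      rw [div_pow (A.card : ℝ), div_pow (B.card : ℝ), div_mul_div_comm, ← pow_add, mul_div_assoc',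
        le_div_iff₀ (by positivity)] at h2
      exact h2)
  rw [hsum, hn] at h1
  have h4 : n ^ I.card * (c * m ^ Fintype.card U * ρ ^ E) ≤
      (2 * m) ^ I.card * ((2 * m) ^ S.card * (ρ ^ E / ((p / 4) ^ E * n ^ S.card))) *
        copyOnCount Y G S := (mul_le_mul_of_nonneg_left hc (by positivity)).trans h1
  have h5 : c * (p / 4) ^ E * n ^ Fintype.card U ≤ 2 ^ Fintype.card U * copyOnCount Y G S := by
    have h6 : 0 < m ^ Fintype.card U * ρ ^ E / ((p / 4) ^ E * n ^ S.card) := by positivity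
    refine le_of_mul_le_mul_right (le_trans (le_of_eq ?_) (h4.trans (le_of_eq ?_))) h6
    · rw [← hcard, pow_add n]; field_simp
    · rw [← hcard]; simp only [pow_add, mul_pow]; field_simp
  -- The comparison of weights only gave copies on the non-isolated vertices; the isolated ones are
  -- now placed injectively.
  have h7 := pow_mul_copyOnCount_le_of_isolated (Y := Y) (G := G) I S (fun v hv u h =>
    (mem_filter.mp hv).2 ⟨u, h⟩) hIS (by rw [hn]; exact hX2) hX
  rw [hIS'] at h7
  have h8 : (1 / 2 : ℝ) ^ Fintype.card U ≤ (1 / 2) ^ I.card :=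
    pow_le_pow_of_le_one (by norm_num) (by norm_num) (card_le_univ _)
  calc _ = (1 / 4) ^ Fintype.card U * (c * (p / 4) ^ E * n ^ Fintype.card U) := by ring
    _ ≤ (1 / 4) ^ Fintype.card U * (2 ^ Fintype.card U * copyOnCount Y G S) := by gcongr
    _ = (1 / 2) ^ Fintype.card U * copyOnCount Y G S := by
      rw [← mul_assoc, ← mul_pow]; norm_num
    _ ≤ (1 / 2) ^ I.card * copyOnCount Y G S :=
      mul_le_mul_of_nonneg_right h8 (copyOnCount_nonneg _ _ _)
    _ ≤ _ := h7

/-- Edges of `H` on `F.verts` outside `F` are merged as well, so the right side may exceed the true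
count. As an exponent of `p` it still gives a positive number of copies, which is enough for the
extremal number. -/
lemma ncard_edgeSet_gluedGraph_le {V : Type*} [Fintype V] {H : SimpleGraph V} (F : H.Subgraph)
    {s : ℕ} (hs : 1 ≤ s) (hfe : F.edgeSet.ncard ≤ H.edgeSet.ncard) :
    (gluedGraph H F s).edgeSet.ncard ≤
      F.edgeSet.ncard + s * (H.edgeSet.ncard - F.edgeSet.ncard) := by
  have h1 := ncard_edgeSet_gluedGraph F hs
  have h2 := adjPairs_toFinset_verts_ge F
  obtain ⟨r, rfl⟩ : ∃ r, s = r + 1 := ⟨s - 1, by omega⟩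
  obtain ⟨g, hg⟩ := Nat.exists_eq_add_of_le hfe
  rw [hg] at h1 ⊢
  rw [Nat.add_sub_cancel_left]
  have h3 := Nat.mul_le_mul_left r h2
  nlinarith

lemma ncard_edgeSet_gluedGraph_eq {V : Type*} [Fintype V] {H : SimpleGraph V} {F : H.Subgraph}
    (hF : F.IsInduced) {s : ℕ} (hs : 1 ≤ s) (hfe : F.edgeSet.ncard ≤ H.edgeSet.ncard) :
    (gluedGraph H F s).edgeSet.ncard =
      F.edgeSet.ncard + s * (H.edgeSet.ncard - F.edgeSet.ncard) := by
  have h1 := ncard_edgeSet_gluedGraph F hs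
  rw [adjPairs_toFinset_verts_eq hF] at h1
  obtain ⟨r, rfl⟩ : ∃ r, s = r + 1 := ⟨s - 1, by omega⟩
  obtain ⟨g, hg⟩ := Nat.exists_eq_add_of_le hfe
  rw [hg] at h1 ⊢
  rw [Nat.add_sub_cancel_left]
  nlinarith

lemma card_gluedVerts {V : Type*} [Fintype V] {H : SimpleGraph V} (F : H.Subgraph) (s : ℕ) :
    Fintype.card (F.verts ⊕ (Fin s × ↥(F.verts)ᶜ)) =
      F.verts.ncard + s * (F.verts)ᶜ.ncard := by
  rw [Fintype.card_sum, Fintype.card_prod, Fintype.card_fin, ← Nat.card_eq_fintype_card,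
    ← Nat.card_eq_fintype_card, Nat.card_coe_set_eq, Nat.card_coe_set_eq]

end HostGraph

/-! ### Bounds for the exponent and the density. -/

section Exponent
open Classical Finset

/-- One minus the second term in the definition of `gluedExponent`. -/
noncomputable def gluedGap (l f : ℕ) (α : ℝ) : ℝ :=
  (1 - α) / ((l : ℝ) - 1 + (1 - f) * (1 - α))

lemma one_sub_gluedGap_le {V : Type*} (H : SimpleGraph V) (F : H.Subgraph) (α : ℝ) :
    1 - gluedGap F.verts.ncard F.edgeSet.ncard α ≤ gluedExponent H F α := le_max_right _ _

/-- The denominator is `(l-1) - (f-1)(1-α)`, which is at least `l - f` because `1-α ≤ 1`. -/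
lemma gluedGap_le {l f : ℕ} {α d : ℝ} (hα0 : 0 ≤ α) (hα1 : α < 1) (hf : 1 ≤ f) (hd : 1 ≤ d)
    (hfl : f + d ≤ l) : gluedGap l f α ≤ (1 - α) / d := by
  have hf' : (1 : ℝ) ≤ f := by exact_mod_cast hf
  unfold gluedGap
  apply div_le_div_of_nonneg_left (by linarith) (by linarith)
  nlinarith

/-- If `H` has a cycle, then `α ≥ 1/h` and the gap is at most `1-α`. If `H` is a forest, then `F`
cannot be a tree, since gluing along a tree would give a forest; so `ℓ ≥ e(F)+2` and the gap is at
most `1/2`. -/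
lemma gluedGap_le_of_not_isSparse {V : Type*} [Fintype V] {H : SimpleGraph V} {F : H.Subgraph}
    (hf : 0 < F.edgeSet.ncard) (hfl : F.edgeSet.ncard + 1 ≤ F.verts.ncard) {s : ℕ} (hs : 1 ≤ s)
    (hY : ¬ IsSparse (gluedGraph H F s)) {α A η : ℝ} (hα0 : 0 ≤ α) (hα1 : α < 1) (hη : 0 < η)
    (hH : IsErdosSimonovitsGood H α A η) {N : ℕ} (hN : Fintype.card V ≤ N) (hN2 : 2 ≤ N) :
    gluedGap F.verts.ncard F.edgeSet.ncard α ≤ 1 - 1 / (N : ℝ) := by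
  have hN' : (2 : ℝ) ≤ N := by exact_mod_cast hN2
  have hN2' : 1 / (N : ℝ) ≤ 1 / 2 := one_div_le_one_div_of_le (by norm_num) hN'
  by_cases hHs : IsSparse H
  · have h1 : F.edgeSet.ncard + 1 ≠ F.verts.ncard := fun h => hY (hHs.gluedGraph F h hs)
    have h2 : ((F.edgeSet.ncard + 2 : ℕ) : ℝ) ≤ F.verts.ncard := by
      exact_mod_cast (by omega : F.edgeSet.ncard + 2 ≤ F.verts.ncard)
    push_cast at h2
    have := gluedGap_le hα0 hα1 hf (by norm_num : (1 : ℝ) ≤ 2) h2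
    linarith
  · have h1 := hH.one_div_le hHs hη
    have h2 : ((F.edgeSet.ncard + 1 : ℕ) : ℝ) ≤ F.verts.ncard := by exact_mod_cast hfl
    push_cast at h2
    have h3 := gluedGap_le hα0 hα1 hf le_rfl h2
    have hV : 0 < Fintype.card V := by
      by_contra h
      have hV : IsEmpty V := Fintype.card_eq_zero_iff.mp (by omega)
      have : F.verts = ∅ := by ext x; exact hV.elim x
      rw [this] at hfl
      simp at hfl
    have hV' : (0 : ℝ) < Fintype.card V := by exact_mod_cast hV
    have h4 : 1 / (N : ℝ) ≤ 1 / (Fintype.card V : ℝ) :=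
      one_div_le_one_div_of_le hV' (by exact_mod_cast hN)
    linarith

/-- What an edge count of at least `C n ^ (1 + α')` means for the density and for `n`. -/
lemma density_bounds {n : ℕ} (hn : 0 < n) {G : SimpleGraph (Fin n)} {p C α' δ : ℝ} (hC : 0 < C)
    (hp : (G.edgeSet.ncard : ℝ) = p * (n : ℝ) ^ 2) (hpC : C * (n : ℝ) ^ (1 + α') ≤ p * (n : ℝ) ^ 2)
    (hδ : 1 - δ ≤ α') (hδ1 : δ ≤ 1) : 0 < p ∧ C ≤ p * (n : ℝ) ^ δ ∧ C ≤ n ∧ C ≤ p * n := by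
  have hn1 : (1 : ℝ) ≤ n := by exact_mod_cast hn
  have hn0 : (0 : ℝ) < n := by linarith
  have hp0 : 0 < p := by
    have h1 : 0 < p * (n : ℝ) ^ 2 := lt_of_lt_of_le (by positivity) hpC
    exact (pos_iff_pos_of_mul_pos h1).mpr (by positivity)
  have h1 : C ≤ p * (n : ℝ) ^ (1 - α') := by
    refine le_of_mul_le_mul_right ?_ (by positivity : 0 < (n : ℝ) ^ (1 + α'))
    refine hpC.trans (le_of_eq ?_)
    rw [mul_assoc, ← Real.rpow_add hn0, ← Real.rpow_natCast]
    congr 2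
    push_cast
    ring
  have h2 : C ≤ p * (n : ℝ) ^ δ :=
    h1.trans (mul_le_mul_of_nonneg_left
      (Real.rpow_le_rpow_of_exponent_le hn1 (by linarith)) hp0.le)
  have h3 : C ≤ p * n := by
    refine h2.trans ?_
    gcongr
    calc (n : ℝ) ^ δ ≤ (n : ℝ) ^ (1 : ℝ) := Real.rpow_le_rpow_of_exponent_le hn1 hδ1
      _ = n := Real.rpow_one _
  refine ⟨hp0, h2, ?_, h3⟩
  have h4 : p * (n : ℝ) ^ 2 ≤ 1 * (n : ℝ) ^ 2 := by
    rw [← hp]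
    have h5 := sum_adj_eq G
    have h6 : (∑ x, ∑ y, if G.Adj x y then (1 : ℝ) else 0) ≤ ∑ x : Fin n, ∑ y : Fin n, (1 : ℝ) :=
      sum_le_sum fun x _ => sum_le_sum fun y _ => by split_ifs <;> norm_num
    simp only [sum_const, card_univ, Fintype.card_fin, nsmul_eq_mul, mul_one] at h6
    have : (0 : ℝ) ≤ G.edgeSet.ncard := Nat.cast_nonneg _
    nlinarith
  -- A density is at most one, so `C ≤ pn` also forces `n ≥ C`.
  have h7 : p ≤ 1 := le_of_mul_le_mul_right h4 (by positivity)
  nlinarith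

end Exponent

/-! ### Supersaturation for the glued graph, with and without a cycle. -/

section GluedSupersaturation
open Classical Finset

lemma le_card_copy_gluedGraph_of_not_isSparse {V : Type*} [Fintype V] {H : SimpleGraph V}
    (F : H.Subgraph) (hF : IsSparse F.coe) (hf : 0 < F.edgeSet.ncard)
    (hfe : F.edgeSet.ncard < H.edgeSet.ncard) (hfl : F.edgeSet.ncard + 1 ≤ F.verts.ncard)
    {s : ℕ} (hs : 1 ≤ s) (hY : ¬ IsSparse (gluedGraph H F s)) :
    ∃ c : ℝ, 0 < c ∧ ∀ α A η : ℝ, 0 ≤ α → α < 1 → 0 < η → IsErdosSimonovitsGood H α A η →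
      ∃ C : ℝ, 0 < C ∧ ∀ (n : ℕ), 0 < n → ∀ (G : SimpleGraph (Fin n)) (p : ℝ),
        (G.edgeSet.ncard : ℝ) = p * (n : ℝ) ^ 2 →
        C * (n : ℝ) ^ (1 + gluedExponent H F α) ≤ p * (n : ℝ) ^ 2 → 0 < p ∧
        c * η ^ s * p ^ (F.edgeSet.ncard + s * (H.edgeSet.ncard - F.edgeSet.ncard)) *
          (n : ℝ) ^ Nat.card (F.verts ⊕ (Fin s × ↥(F.verts)ᶜ)) ≤
          (Nat.card ((gluedGraph H F s).Copy G) : ℝ) := by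
  set E := F.edgeSet.ncard + s * (H.edgeSet.ncard - F.edgeSet.ncard) with hE
  -- Large enough for both uses: `N ≥ E` in `density_pow_le`, and `N ≥ h` for the bound on the gap.
  -- It depends on `H`, `F`, `s` only, so the final constant does not involve `α`, `A` or `η`.
  set N := E + Fintype.card V with hN
  set K₁ : ℕ := 2 * 4 ^ N with hK₁
  set v := Fintype.card (F.verts ⊕ (Fin s × ↥(F.verts)ᶜ)) with hv
  have hK₁1 : 1 ≤ K₁ := by have := Nat.one_le_pow N 4 (by norm_num); omega
  have hK₁0 : (0 : ℝ) < 2 * K₁ := by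
    have : (1 : ℝ) ≤ K₁ := by exact_mod_cast hK₁1
    linarith
  have hV : 0 < Fintype.card V := by
    by_contra h
    have hV : IsEmpty V := Fintype.card_eq_zero_iff.mp (by omega)
    have : F.verts = ∅ := by ext x; exact hV.elim x
    rw [this] at hfl
    simp at hfl
  have hN2 : 2 ≤ N := by omega
  have hfl' : (F.edgeSet.ncard : ℝ) + 1 ≤ F.verts.ncard := by exact_mod_cast hfl
  set c₁ := gluedConstant (Fintype.card V) H.edgeSet.ncard F.edgeSet.ncard F.verts.ncard s (2 * K₁)
    with hc₁
  have hc₁0 : 0 < c₁ := gluedConstant_pos _ _ _ _ _ hK₁0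
  refine ⟨c₁ * (1 / 4) ^ v * (1 / 4) ^ E, by positivity, fun α A₀ η hα0 hα1 hη hH => ?_⟩
  set δ := gluedGap F.verts.ncard F.edgeSet.ncard α with hδ
  set C' : ℝ := (16 * ((((s - 1) * (F.verts)ᶜ.ncard : ℕ) : ℝ) + 1) *
      2 ^ (F.verts.ncard - F.edgeSet.ncard) * (2 * K₁ : ℝ) ^ F.edgeSet.ncard *
      (2 ^ (F.verts.ncard - 1) * (64 * max A₀ 1) ^ (((F.verts.ncard - 1 : ℕ) : ℝ) / (1 - α)))) ^ δ
    with hC'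
  have hδN : δ ≤ 1 - 1 / (N : ℝ) :=
    gluedGap_le_of_not_isSparse hf hfl hs hY hα0 hα1 hη hH (Nat.le_add_left _ _) hN2
  have hδ1 : δ ≤ 1 := hδN.trans (by
    have : (0 : ℝ) ≤ 1 / (N : ℝ) := by positivity
    linarith)
  -- The factor `4` pays for `density_le_mul_rpow`; the second entry makes `n` at least `2v`, as
  -- needed for placing isolated vertices.
  refine ⟨max (4 * C') (2 * v + 1), lt_max_of_lt_right (by positivity), fun n hn G p hp hpC => ?_⟩
  obtain ⟨hp0, hpδ, hCn, -⟩ := density_bounds hn (lt_max_of_lt_right (by positivity)) hp hpC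
    (one_sub_gluedGap_le H F α) hδ1
  refine ⟨hp0, ?_⟩
  have hn0 : (0 : ℝ) < n := by exact_mod_cast hn
  have hGpos : 0 < G.edgeSet.ncard := by
    have : (0 : ℝ) < G.edgeSet.ncard := by rw [hp]; positivity
    exact_mod_cast this
  obtain ⟨A, B, G', hdis, hG'G, hadj, hcross, hdA, hdB, hmax⟩ :=
    exists_biregular_subgraph G (N := N) (by omega) hGpos
  have hA : 0 < A.card := by
    by_contra h
    simp [card_eq_zero.mp (Nat.eq_zero_of_not_pos h), crossPairs] at hcross
  have hB : 0 < B.card := by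
    by_contra h
    simp [card_eq_zero.mp (Nat.eq_zero_of_not_pos h), crossPairs] at hcross
  have hA' : (0 : ℝ) < A.card := by exact_mod_cast hA
  have hB' : (0 : ℝ) < B.card := by exact_mod_cast hB
  have hcross' : (0 : ℝ) < crossPairs G' A B := by exact_mod_cast hcross
  obtain ⟨ρ, hρ⟩ : ∃ ρ : ℝ, ρ = crossPairs G' A B / (A.card * B.card) := ⟨_, rfl⟩
  have hρ0 : 0 < ρ := hρ ▸ div_pos hcross' (mul_pos hA' hB')
  have hρe : (crossPairs G' A B : ℝ) = ρ * (A.card * B.card) := by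
    rw [hρ, div_mul_cancel₀ _ (mul_pos hA' hB').ne']
  clear hρ
  have hu0 : 0 < (A.card : ℝ) / n := div_pos hA' hn0
  have hv0 : 0 < (B.card : ℝ) / n := div_pos hB' hn0
  have hu1 : (A.card : ℝ) / n ≤ 1 := by
    rw [div_le_one hn0]
    exact_mod_cast (card_le_univ A).trans_eq (Fintype.card_fin n)
  have hv1 : (B.card : ℝ) / n ≤ 1 := by
    rw [div_le_one hn0]
    exact_mod_cast (card_le_univ B).trans_eq (Fintype.card_fin n)
  have hdens : p * ((A.card : ℝ) / n * (B.card / n)) ^ (1 / (N : ℝ)) ≤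
      4 * ρ * ((A.card : ℝ) / n * (B.card / n)) := by
    have h1 : (A.card : ℝ) * B.card = (n : ℝ) ^ 2 * ((A.card : ℝ) / n * (B.card / n)) := by
      field_simp
    rw [hp, hρe, Fintype.card_fin, h1, Real.mul_rpow (by positivity) (by positivity)] at hmax
    refine le_of_mul_le_mul_right (le_trans (le_of_eq ?_) (hmax.trans (le_of_eq ?_)))
      (by positivity : 0 < (n : ℝ) ^ 2 * ((n : ℝ) ^ 2) ^ (1 / (N : ℝ))) <;> ring
  have hCle : ∀ a : ℝ, 0 < a → p ≤ 4 * (ρ * (a / n) ^ δ) → C' ≤ ρ * a ^ δ := by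
    intro a ha h
    rw [Real.div_rpow ha.le hn0.le] at h
    have h1 : 4 * C' ≤ p * (n : ℝ) ^ δ := (le_max_left _ _).trans hpδ
    have h2 : p * (n : ℝ) ^ δ ≤ 4 * (ρ * (a ^ δ / (n : ℝ) ^ δ)) * (n : ℝ) ^ δ := by gcongr
    have h3 : 4 * (ρ * (a ^ δ / (n : ℝ) ^ δ)) * (n : ℝ) ^ δ = 4 * (ρ * a ^ δ) := by
      field_simp
    linarith
  have hCA := hCle _ hA' (density_le_mul_rpow hu0 hu1 hv0 hv1 hρ0.le hdens (by omega) hδN)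
  have hCB := hCle _ hB' (density_le_mul_rpow hv0 hv1 hu0 hu1 hρ0.le
    (by rw [mul_comm ((B.card : ℝ) / n)]; exact hdens) (by omega) hδN)
  obtain ⟨m, w, hm0, hw0, hsum, hwA, hwB, hcw⟩ := exists_weight_gluedGraph F hF hf hfe hfl hs hα0 hα1
    hη.le hH hdis hadj hcross hK₁1 hdA hdB hρe rfl hC'.ge hCA hCB
  have hmain := le_copyOnCount_of_le_copyWeight (c := c₁ * η ^ s) (E := E) (p := p) hY hdis hadj hA hB
    hw0 hm0 hρ0 hp0 hsum hwA hwB (ncard_edgeSet_gluedGraph_le F hs hfe.le)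
    (fun i j hi hj => by
      rw [Fintype.card_fin]
      exact density_pow_le (by omega) hu0 hu1 hv0 hv1 hp0.le hρ0.le hdens (Nat.le_add_right _ _)
        hi hj)
    (by rw [card_gluedVerts]; exact hcw) (by rw [Fintype.card_fin]; exact hn) (by
      rw [Fintype.card_fin]
      have := (le_max_right (4 * C') (2 * v + 1)).trans hCn
      linarith)
  rw [← copyOnCount_univ, Nat.card_eq_fintype_card]
  refine le_trans (le_of_eq ?_) (hmain.trans (copyOnCount_mono _ hG'G _))
  rw [Fintype.card_fin, div_pow]
  ring

/-- Forest supersaturation applies as soon as `pn ≥ 8v`, with a constant free of `η`; the factor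
`η^s` is inserted using `η ≤ 4^(e(H))`. -/
lemma le_card_copy_gluedGraph_of_isSparse {V : Type*} [Fintype V] {H : SimpleGraph V}
    (F : H.Subgraph) (hf : 0 < F.edgeSet.ncard) (hfl : F.edgeSet.ncard + 1 ≤ F.verts.ncard)
    {s : ℕ} (hY : IsSparse (gluedGraph H F s)) :
    ∃ c : ℝ, 0 < c ∧ ∀ α A η : ℝ, 0 ≤ α → α < 1 → 0 < η → IsErdosSimonovitsGood H α A η →
      ∃ C : ℝ, 0 < C ∧ ∀ (n : ℕ), 0 < n → ∀ (G : SimpleGraph (Fin n)) (p : ℝ),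
        (G.edgeSet.ncard : ℝ) = p * (n : ℝ) ^ 2 →
        C * (n : ℝ) ^ (1 + gluedExponent H F α) ≤ p * (n : ℝ) ^ 2 → 0 < p ∧
        c * η ^ s * p ^ (gluedGraph H F s).edgeSet.ncard *
          (n : ℝ) ^ Nat.card (F.verts ⊕ (Fin s × ↥(F.verts)ᶜ)) ≤
          (Nat.card ((gluedGraph H F s).Copy G) : ℝ) := by
  set v := Fintype.card (F.verts ⊕ (Fin s × ↥(F.verts)ᶜ)) with hv
  set E := (gluedGraph H F s).edgeSet.ncard with hE
  refine ⟨(1 / 2) ^ v * (1 / 4) ^ E * (1 / (4 ^ H.edgeSet.ncard) ^ s), by positivity,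
    fun α A η hα0 hα1 hη hH => ⟨8 * v + 1, by positivity, fun n hn G p hp hpC => ?_⟩⟩
  have hfl' : (F.edgeSet.ncard : ℝ) + 1 ≤ F.verts.ncard := by exact_mod_cast hfl
  have hδ1 := gluedGap_le hα0 hα1 hf le_rfl hfl'
  obtain ⟨hp0, -, -, hpn⟩ := density_bounds hn (by positivity) hp hpC
    (one_sub_gluedGap_le H F α) (by linarith)
  refine ⟨hp0, ?_⟩
  have hmain := hY.supersaturation hn G p hp (by linarith)
  rw [Nat.card_eq_fintype_card]
  refine le_trans ?_ hmain
  have hη4 : η ^ s ≤ (4 ^ H.edgeSet.ncard) ^ s := by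
    gcongr
    exact hH.le_four_pow hα1
  have h1 : 1 / (4 ^ H.edgeSet.ncard) ^ s * η ^ s ≤ 1 := by
    rw [one_div_mul_eq_div, div_le_one (by positivity)]
    exact hη4
  calc _ = (1 / (4 ^ H.edgeSet.ncard) ^ s * η ^ s) *
        ((1 / 2) ^ v * (p / 4) ^ E * (n : ℝ) ^ v) := by
        rw [div_pow p, div_pow (1 : ℝ) 4, ← hv]; ring
    _ ≤ 1 * ((1 / 2) ^ v * (p / 4) ^ E * (n : ℝ) ^ v) := by gcongr
    _ = _ := one_mul _

/-- Supersaturation for the glued graph. -/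
lemma exists_le_card_copy_gluedGraph {V : Type*} [Finite V] {H : SimpleGraph V}
    (F : H.Subgraph) (hF : F.coe.IsAcyclic) (hf : 0 < F.edgeSet.ncard)
    (hfe : F.edgeSet.ncard < H.edgeSet.ncard) {s : ℕ} (hs : 1 ≤ s) :
    ∃ (c : ℝ) (E : ℕ), 0 < c ∧ (F.IsInduced → E = (gluedGraph H F s).edgeSet.ncard) ∧
      ∀ α A η : ℝ, 0 ≤ α → α < 1 → 0 < η → IsErdosSimonovitsGood H α A η →
      ∃ C : ℝ, 0 < C ∧ ∀ (n : ℕ), 0 < n → ∀ (G : SimpleGraph (Fin n)) (p : ℝ),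
        (G.edgeSet.ncard : ℝ) = p * (n : ℝ) ^ 2 →
        C * (n : ℝ) ^ (1 + gluedExponent H F α) ≤ p * (n : ℝ) ^ 2 → 0 < p ∧
        c * η ^ s * p ^ E * (n : ℝ) ^ Nat.card (F.verts ⊕ (Fin s × ↥(F.verts)ᶜ)) ≤
          (Nat.card ((gluedGraph H F s).Copy G) : ℝ) := by
  have := Fintype.ofFinite V
  have hFs : IsSparse F.coe := hF.isSparse
  have hfl : F.edgeSet.ncard + 1 ≤ F.verts.ncard := by
    have hne : F.verts.Nonempty := by
      obtain ⟨e, he⟩ := Set.nonempty_of_ncard_ne_zero hf.ne'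
      induction e with
      | h x y => exact ⟨x, F.edge_vert he⟩
    have hne' : (univ : Finset F.verts).Nonempty := ⟨⟨hne.some, hne.some_mem⟩, mem_univ _⟩
    have h1 := hFs univ hne'
    rw [adjPairs_univ, ncard_edgeSet_coe, card_univ, ← Nat.card_eq_fintype_card,
      Nat.card_coe_set_eq] at h1
    omega
  by_cases hY : IsSparse (gluedGraph H F s)
  · obtain ⟨c, hc, h⟩ := le_card_copy_gluedGraph_of_isSparse F hf hfl hY
    exact ⟨c, _, hc, fun _ => rfl, h⟩
  · obtain ⟨c, hc, h⟩ := le_card_copy_gluedGraph_of_not_isSparse F hFs hf hfe hfl hs hY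
    exact ⟨c, _, hc, fun hi => (ncard_edgeSet_gluedGraph_eq hi hs hfe.le).symm, h⟩

end GluedSupersaturation

theorem theorem1p7 {V : Type*} [Finite V] (H : SimpleGraph V) (F : H.Subgraph)
    (hF : F.coe.IsAcyclic) (hF_pos : 0 < F.edgeSet.ncard)
    (hF_lt : F.edgeSet.ncard < H.edgeSet.ncard) (s : ℕ) (hs : 1 ≤ s) :
    ∃ K : ℝ, 0 < K ∧
      ∀ α A η : ℝ, 0 ≤ α → α < 1 → 0 < A → 0 < η → IsErdosSimonovitsGood H α A η →
        ∃ C : ℝ, 0 < C ∧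
          (∀ n : ℕ, (SimpleGraph.extremalNumber n (gluedGraph H F s) : ℝ) ≤
            C * (n : ℝ) ^ (1 + gluedExponent H F α)) ∧
          (F.IsInduced →
            IsErdosSimonovitsGood (gluedGraph H F s) (gluedExponent H F α) C
              (1 / 4 ^ H.edgeSet.ncard *
                (η / (4 * 8 ^ H.edgeSet.ncard * (6 * K) ^ F.edgeSet.ncard)) ^ s)) := by
  obtain ⟨c, E, hc, hE, hcount⟩ := exists_le_card_copy_gluedGraph F hF hF_pos hF_lt hs
  -- Any `K ≥ 1` with `1/K ≤ c` works: the denominator in `β` is at least `K`, as `e(F) ≥ 1`, and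
  -- its `s`-th power is no smaller, so `β ≤ η^s/K ≤ c η^s`.
  refine ⟨max 1 (1 / c), lt_max_of_lt_left one_pos, fun α A η hα0 hα1 _ hη hH => ?_⟩
  obtain ⟨C, hC, hcount⟩ := hcount α A η hα0 hα1 hη hH
  have hneE : Nonempty (F.verts ⊕ (Fin s × ↥(F.verts)ᶜ)) := by
    obtain ⟨e, he⟩ := Set.nonempty_of_ncard_ne_zero hF_pos.ne'
    induction e with
    | h x y => exact ⟨Sum.inl ⟨x, F.edge_vert he⟩⟩
  have hcard : Nat.card (F.verts ⊕ (Fin s × ↥(F.verts)ᶜ)) ≠ 0 :=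
    Nat.card_ne_zero.mpr ⟨hneE, inferInstance⟩
  refine ⟨C, hC, fun n => ?_, fun hind => ⟨gluedGraph_isBipartite F hs hH.1, fun n G p hp hpC => ?_⟩⟩
  · classical
    rcases Nat.eq_zero_or_pos n with rfl | hn
    · have h0 : SimpleGraph.extremalNumber 0 (gluedGraph H F s) = 0 := by
        have h : SimpleGraph.extremalNumber (Fintype.card (Fin 0)) (gluedGraph H F s) ≤ 0 := by
          rw [SimpleGraph.extremalNumber_le_iff]
          intro G _ _
          simp [Subsingleton.elim G ⊥]
        rw [Fintype.card_fin] at h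
        exact Nat.le_zero.mp h
      rw [h0]
      push_cast
      positivity
    · have hn0 : (0 : ℝ) < n := by exact_mod_cast hn
      rw [← Fintype.card_fin n, SimpleGraph.extremalNumber_le_iff_of_nonneg _ (by positivity)]
      intro G _ hG
      rw [Fintype.card_fin]
      by_contra! hlt
      have hfin : (G.edgeSet.ncard : ℝ) = G.edgeFinset.card := by
        rw [← SimpleGraph.coe_edgeFinset, Set.ncard_coe_finset]
      -- An `H*`-free graph above the threshold would have a strictly positive number of copies,
      -- whatever the exponent `E`.
      obtain ⟨hp0, hle⟩ := hcount n hn G (G.edgeSet.ncard / (n : ℝ) ^ 2) (by field_simp) (by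
        rw [div_mul_cancel₀ _ (by positivity), hfin]
        exact hlt.le)
      have hzero : Nat.card ((gluedGraph H F s).Copy G) = 0 := by
        have : IsEmpty ((gluedGraph H F s).Copy G) := ⟨fun f => hG ⟨f⟩⟩
        exact Nat.card_of_isEmpty
      rw [hzero, Nat.cast_zero] at hle
      have : 0 < c * η ^ s * (G.edgeSet.ncard / (n : ℝ) ^ 2) ^ E *
          (n : ℝ) ^ Nat.card (F.verts ⊕ (Fin s × ↥(F.verts)ᶜ)) := by positivity
      linarith
  · rcases Nat.eq_zero_or_pos n with rfl | hn
    -- For `n = 0` the bound holds because `H*` has a vertex, so `0^(v(H*)) = 0`.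
    · rw [Nat.cast_zero, zero_pow hcard, mul_zero]
      positivity
    · obtain ⟨hp0, hle⟩ := hcount n hn G p hp hpC
      rw [← hE hind]
      refine le_trans ?_ hle
      have hβ : 1 / 4 ^ H.edgeSet.ncard *
          (η / (4 * 8 ^ H.edgeSet.ncard * (6 * max 1 (1 / c)) ^ F.edgeSet.ncard)) ^ s ≤
          c * η ^ s := by
        set K := max 1 (1 / c)
        have hK1 : 1 ≤ K := le_max_left _ _
        have hKc : 1 / K ≤ c := by
          rw [one_div_le (by linarith) hc]
          exact le_max_right _ _
        have h1 : K ≤ 4 * 8 ^ H.edgeSet.ncard * (6 * K) ^ F.edgeSet.ncard := by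
          have h2 : (1 : ℝ) ≤ 8 ^ H.edgeSet.ncard := one_le_pow₀ (by norm_num)
          have h3 : 6 * K ≤ (6 * K) ^ F.edgeSet.ncard :=
            le_self_pow₀ (by linarith) hF_pos.ne'
          calc K ≤ 1 * 1 * (6 * K) := by linarith
            _ ≤ _ := by gcongr; norm_num
        have h4 : K ≤ (4 * 8 ^ H.edgeSet.ncard * (6 * K) ^ F.edgeSet.ncard) ^ s :=
          h1.trans (le_self_pow₀ (hK1.trans h1) (by omega))
        have h5 : 1 / (4 : ℝ) ^ H.edgeSet.ncard ≤ 1 := by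
          rw [div_le_one (by positivity)]
          exact one_le_pow₀ (by norm_num)
        rw [div_pow]
        calc _ ≤ 1 * (η ^ s / K) := by gcongr
          _ = 1 / K * η ^ s := by ring
          _ ≤ _ := by gcongr
      gcongr
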